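/- Let $K$ be a field (for instance an algebraically closed field of arbitrary characteristic), let $\delta\in K$ with $\delta\neq 0$, and let $r\ge 0$. All modules are right modules, and all of them are finite dimensional. **Hyperoctahedral groups.** $W_n$ is the group of signed permutations of $\{-n,\dots,-1,1,\dots,n\}$, and $\mathcal W_n=KW_n$. A bi-partition $\lambda=(\lambda^1,\lambda^2)$ of $n$ is a pair of partitions with $|\lambda^1|+|\lambda^2|=n$. A $\lambda$-bi-tableau $\mathfrak t=(\mathfrak t^1,\mathfrak t^2)$ is a filling of the boxes of $\lambda^1$ and $\lambda^2$ with elements of $\{\pm1,\dots,\pm n\}$ such that for each $i$ exactly one of $i,-i$ occurs, once. Its row permutations are the elements of $W_n$ that permute the entries within each row and may change the signs of entries in $\mathfrak t^2$; its column permutations permute the entries within each column and may change the signs of entries in $\mathfrak t^1$. The permutation module $M(\lambda)$ has as basis the bi-tabloids $\{\mathfrak t\}$ (classes of bi-tableaux up to row permutations). The Specht module $S(\lambda)\subseteq M(\lambda)$ is spanned by the elements $\{\mathfrak t\}\sum_{\sigma}\mathrm{sgn}(\sigma)\,\sigma$, the sum being over the column permutations $\sigma$ of $\mathfrak t$, where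 $\mathrm{sgn}(\sigma)$ is $(-1)^{\text{number of sign changes}}$ times the sign of the underlying permutation of $\{1,\dots,n\}$. The Young module $Y(\lambda)$ is the indecomposable direct summand of $M(\lambda)$ that contains $S(\lambda)$. For bi-partitions $\lambda,\mu$ of $n$, write $\lambda\unrhd\mu$ if for all $j\ge 0$ $$\sum_{i\le j}\lambda^2_i\ \ge\ \sum_{i\le j}\mu^2_i\qquad\text{and}\qquad |\lambda^2|+\sum_{i\le j}\lambda^1_i\ \ge\ |\mu^2|+\sum_{i\le j}\mu^1_i .$$ **The Brauer algebra of type $C$.** $B=\mathcal B(C_r,\delta)$ has as basis the perfect matchings (diagrams) of two rows of vertices, each labelled $-r,\dots,-1,1,\dots,r$, that are symmetric under $v\mapsto -v$; diagrams are multiplied by concatenation, each closed loop being replaced by $\delta$. For $0\le l\le r$ let $e_l\in B$ be $\delta^{-l}$ times the diagram with horizontal edges $\{i,-i\}$, $1\le i\le l$, in both rows and vertical edges elsewhere, and let $J_k$ be the two-sided ideal generated by the diagrams with at least $k$ horizontal edges in each row. The group algebra $\mathcal W_{r-l}$, acting on $\pm(l+1),\dots,\pm r$, is contained in $B$ and commutes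 with $e_l$. For a $\mathcal W_{r-l}$-module $X$ put $$\mathrm{Ind}_l X=X\otimes_{\mathcal W_{r-l}}e_lB,\qquad \mathrm{ind}_l X=X\otimes_{\mathcal W_{r-l}}e_l(B/J_{l+1}).$$ Let $\Lambda$ be the set of pairs $(l,\lambda)$ with $0\le l\le r$ and $\lambda$ a bi-partition of $r-l$. For $(l,\lambda)\in\Lambda$ put $M(l,\lambda)=\mathrm{Ind}_l M(\lambda)$, and let $Y(l,\lambda)$ be the indecomposable direct summand of $M(l,\lambda)$ that admits a surjection onto $\mathrm{ind}_l Y(\lambda)$. **Proposition.** The modules $Y(\lambda)$ and $Y(l,\lambda)$ exist and are unique up to isomorphism. For $(l,\lambda),(m,\mu)\in\Lambda$: 1. $Y(l,\lambda)$ occurs exactly once in $M(l,\lambda)$: the module $M(l,\lambda)$ is a finite direct sum of indecomposable submodules, and in each such decomposition exactly one summand is isomorphic to $Y(l,\lambda)$. 2. If $l<m$, then $Y(l,\lambda)$ is not isomorphic to a direct summand of $M(m,\mu)$. 3. If $l=m$, then $Y(l,\lambda)$ is isomorphic to a direct summand of $M(l,\mu)$ if and only if $Y(\lambda)$ is isomorphic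 to a direct summand of $M(\mu)$, and this can happen only if $\lambda\unrhd\mu$. 4. If $Y(l,\lambda)\cong Y(m,\mu)$, then $(l,\lambda)=(m,\mu)$. -/

import Mathlib

open scoped TensorProduct

noncomputable section

namespace TypeC

section Gluing

variable {X Y Z U : Type}

/-- The inclusion of the two upper rows into three rows. -/
def upper : X ⊕ Y → X ⊕ Y ⊕ Z := Sum.elim Sum.inl (Sum.inr ∘ Sum.inl)

/-- The inclusion of the outer (first and third) rows into three rows. -/
def outer : X ⊕ Z → X ⊕ Y ⊕ Z := Sum.elim Sum.inl (Sum.inr ∘ Sum.inr)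

/-- Put a diagram `s` on top of a diagram `t`: the equivalence relation on the three rows of
vertices generated by `s` on the two upper rows and by `t` on the two lower rows. -/
def glue (s : Setoid (X ⊕ Y)) (t : Setoid (Y ⊕ Z)) : Setoid (X ⊕ Y ⊕ Z) :=
  Relation.EqvGen.setoid fun a b =>
    (∃ p q, s p q ∧ a = upper p ∧ b = upper q) ∨
      (∃ p q, t p q ∧ a = Sum.inr p ∧ b = Sum.inr q)

/-- Concatenation of diagrams: two outer vertices are joined when they lie in the same connected
component after putting `s` on top of `t`. -/
def comp (s : Setoid (X ⊕ Y)) (t : Setoid (Y ⊕ Z)) : Setoid (X ⊕ Z) :=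
  (glue s t).comap outer

/-- The classes of an equivalence relation which contain no element of the form `f x`. -/
def Avoiding {A B : Type} (R : Setoid B) (f : A → B) : Type :=
  {q : Quotient R // ∀ p, Quotient.mk R (f p) ≠ q}

/-- The number of closed loops that arise when `s` is put on top of `t`: the connected components
which contain no outer vertex. -/
def loops (s : Setoid (X ⊕ Y)) (t : Setoid (Y ⊕ Z)) : ℕ :=
  Nat.card (Avoiding (glue s t) outer)

theorem glue_upper {s : Setoid (X ⊕ Y)} {t : Setoid (Y ⊕ Z)} {p q : X ⊕ Y} (h : s p q) :
    glue s t (upper p) (upper q) :=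
  Relation.EqvGen.rel _ _ (Or.inl ⟨p, q, h, rfl, rfl⟩)

theorem glue_lower {s : Setoid (X ⊕ Y)} {t : Setoid (Y ⊕ Z)} {p q : Y ⊕ Z} (h : t p q) :
    glue s t (Sum.inr p) (Sum.inr q) :=
  Relation.EqvGen.rel _ _ (Or.inr ⟨p, q, h, rfl, rfl⟩)

theorem glue_le {s : Setoid (X ⊕ Y)} {t : Setoid (Y ⊕ Z)} {E : Setoid (X ⊕ Y ⊕ Z)}
    (hs : ∀ p q, s p q → E (upper p) (upper q))
    (ht : ∀ p q, t p q → E (Sum.inr p) (Sum.inr q)) : glue s t ≤ E := by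
  refine Setoid.eqvGen_le ?_
  rintro _ _ (⟨p, q, h, rfl, rfl⟩ | ⟨p, q, h, rfl, rfl⟩)
  exacts [hs p q h, ht p q h]

/-- Gluing `S` and `P` along `O`, abstractly: components of the glued object `T`. -/
theorem pushout_aux {T S P O A : Type} [Finite T] [Finite S] [Finite P]
    (h : P → T) (f : S → T) (o : O → P) (k : O → S)
    (hfk : ∀ x, f (k x) = h (o x))
    (G : Setoid P) (J : Setoid T) (J' : Setoid S)
    (hG : ∀ p q, G p q → J (h p) (h q)) (hJ' : ∀ p q, J' p q → J (f p) (f q))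
    (hk : ∀ p q, G (o p) (o q) → J' (k p) (k q))
    (hcov : ∀ x : T, (∃ p, h p = x) ∨ ∃ p, f p = x)
    (hφ : ∀ ψ : P → Quotient J' ⊕ Avoiding G o,
      (∀ p q, G p q → ψ p = ψ q) → (∀ x, ψ (o x) = Sum.inl (Quotient.mk _ (k x))) →
      ∃ φ : T → Quotient J' ⊕ Avoiding G o,
        (∀ p, φ (h p) = ψ p) ∧ (∀ p, φ (f p) = Sum.inl (Quotient.mk _ p)) ∧
        ∀ x y, J x y → φ x = φ y) (a : A → S) :
    J.comap (f ∘ a) = J'.comap a ∧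
      Nat.card (Avoiding J (f ∘ a)) = Nat.card (Avoiding J' a) + Nat.card (Avoiding G o) := by
  classical
  let ψ₀ : Quotient G → Quotient J' ⊕ Avoiding G o := fun q =>
    if hq : ∃ x, Quotient.mk G (o x) = q then Sum.inl (Quotient.mk _ (k hq.choose))
    else Sum.inr ⟨q, fun p hp => hq ⟨p, hp⟩⟩
  obtain ⟨φ, h1, h2, h3⟩ := hφ (fun p => ψ₀ (Quotient.mk _ p))
    (fun p q hpq => by rw [Quotient.sound (s := G) hpq])
    (fun x => by
      have hx : ∃ y, Quotient.mk G (o y) = Quotient.mk G (o x) := ⟨x, rfl⟩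
      simp only [ψ₀, dif_pos hx]
      congr 1
      exact Quotient.sound (s := J') (hk _ _ (Quotient.exact hx.choose_spec)))
  have hinr : ∀ (q : P) (hq : ∀ x, Quotient.mk G (o x) ≠ Quotient.mk G q),
      ψ₀ (Quotient.mk _ q) = Sum.inr ⟨_, hq⟩ := by
    intro q hq
    have hx : ¬ ∃ y, Quotient.mk G (o y) = Quotient.mk G q := fun ⟨y, hy⟩ => hq y hy
    simp only [ψ₀, dif_neg hx]
  let inv : Quotient J' ⊕ Avoiding G o → Quotient J :=
    Sum.elim (Quotient.map' f hJ') (fun q => Quotient.map' h hG q.1)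
  have hinvφ : ∀ x, inv (φ x) = Quotient.mk _ x := by
    have hf : ∀ p, inv (φ (f p)) = Quotient.mk _ (f p) := fun p => by rw [h2]; rfl
    intro x
    rcases hcov x with ⟨p, rfl⟩ | ⟨p, rfl⟩
    · by_cases hq : ∃ x, Quotient.mk G (o x) = Quotient.mk G p
      · obtain ⟨y, hy⟩ := hq
        have e : J (h (o y)) (h p) := hG _ _ (Quotient.exact hy)
        rw [← h3 _ _ e, ← hfk, hf, hfk]
        exact Quotient.sound (s := J) e
      · rw [h1, hinr p (fun y hy => hq ⟨y, hy⟩)]; rfl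
    · exact hf p
  let e : Quotient J ≃ Quotient J' ⊕ Avoiding G o :=
    { toFun := Quotient.lift φ h3
      invFun := inv
      left_inv := by rintro ⟨x⟩; exact hinvφ x
      right_inv := by
        rintro (⟨⟨p⟩⟩ | ⟨⟨p⟩, hp⟩)
        · exact h2 p
        · exact (h1 p).trans (hinr p hp) }
  have he : ∀ p, e (Quotient.mk _ (f p)) = Sum.inl (Quotient.mk _ p) := h2
  constructor
  · ext x y
    change J (f (a x)) (f (a y)) ↔ J' (a x) (a y)
    refine ⟨fun hxy => ?_, hJ' _ _⟩
    have := h3 _ _ hxy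
    rw [h2, h2] at this
    exact Quotient.exact (Sum.inl_injective this)
  · have : Finite (Quotient J') := Quotient.finite _
    have : Finite (Quotient G) := Quotient.finite _
    have : Finite (Avoiding J' a) := inferInstanceAs (Finite (Subtype _))
    have : Finite (Avoiding G o) := inferInstanceAs (Finite (Subtype _))
    rw [← Nat.card_sum]
    refine Nat.card_congr ?_
    refine (Equiv.subtypeEquiv e (q := fun z => ∀ p, Sum.inl (Quotient.mk J' (a p)) ≠ z)
      (fun q => forall_congr' fun p => ?_)).trans ?_
    · rw [← he, Function.comp, ne_eq, ne_eq, e.injective.eq_iff]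
    · refine Equiv.subtypeSum.trans (Equiv.sumCongr (Equiv.subtypeEquivRight fun q => ?_)
        (Equiv.subtypeUnivEquiv fun q => ?_))
      · simp [Sum.inl_injective.eq_iff]
      · simp

theorem comp_left_aux [Finite X] [Finite Y] [Finite Z] [Finite U]
    (s : Setoid (X ⊕ Y)) (t : Setoid (Y ⊕ Z)) (u : Setoid (Z ⊕ U)) :
    (glue s (glue t u)).comap (outer ∘ outer) = comp (comp s t) u ∧
      Nat.card (Avoiding (glue s (glue t u)) (outer ∘ outer)) =
        loops (comp s t) u + loops s t := by
  have hs : ∀ p q, glue s t p q → glue s (glue t u)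
      (Sum.map id (Sum.map id Sum.inl) p) (Sum.map id (Sum.map id Sum.inl) q) := by
    refine glue_le (E := (glue s (glue t u)).comap (Sum.map id (Sum.map id Sum.inl))) ?_ ?_
    · rintro (p | p) (q | q) h <;> exact glue_upper h
    · rintro (p | p) (q | q) h <;> exact glue_lower (glue_upper h)
  refine pushout_aux (T := X ⊕ Y ⊕ Z ⊕ U) (S := X ⊕ Z ⊕ U) (P := X ⊕ Y ⊕ Z) (O := X ⊕ Z)
    (Sum.map id (Sum.map id Sum.inl)) outer outer upper ?_ _ _ _ hs ?_ ?_ ?_ ?_ outer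
  · rintro (x | x) <;> rfl
  · refine glue_le (E := (glue s (glue t u)).comap outer) ?_ ?_
    · rintro (p | p) (q | q) h <;> exact hs _ _ h
    · rintro (p | p) (q | q) h <;> exact glue_lower (glue_lower h)
  · intro p q h
    exact glue_upper h
  · rintro (x | x | x | x)
    exacts [Or.inl ⟨.inl x, rfl⟩, Or.inl ⟨.inr (.inl x), rfl⟩, Or.inl ⟨.inr (.inr x), rfl⟩,
      Or.inr ⟨.inr (.inr x), rfl⟩]
  · intro ψ h1 h2
    have hx : ∀ x, ψ (Sum.inl x) = Sum.inl (Quotient.mk _ (Sum.inl x)) := fun x => h2 (Sum.inl x)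
    have hz : ∀ x, ψ (Sum.inr (Sum.inr x)) = Sum.inl (Quotient.mk _ (Sum.inr (Sum.inl x))) :=
      fun x => h2 (Sum.inr x)
    refine ⟨Sum.elim (fun x => ψ (.inl x)) (Sum.elim (fun y => ψ (.inr (.inl y)))
      (fun z => Sum.inl (Quotient.mk _ (Sum.inr z)))), ?_, ?_, ?_⟩
    · rintro (x | x | x)
      exacts [rfl, rfl, (hz x).symm]
    · rintro (x | x)
      exacts [hx x, rfl]
    · refine glue_le (E := Setoid.ker _) ?_ (fun p q h => glue_le
        (E := (Setoid.ker (Sum.elim (fun x => ψ (.inl x)) (Sum.elim (fun y => ψ (.inr (.inl y)))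
          (fun z => Sum.inl (Quotient.mk _ (Sum.inr z)))))).comap Sum.inr) ?_ ?_ h)
      · rintro (p | p) (q | q) h <;> exact h1 _ _ (glue_upper h)
      · rintro (p | p) (q | q) h
        · exact h1 _ _ (glue_lower h)
        · exact (h1 _ _ (glue_lower h)).trans (hz q)
        · exact (hz p).symm.trans (h1 _ _ (glue_lower h))
        · exact (hz p).symm.trans ((h1 _ _ (glue_lower h)).trans (hz q))
      · intro p q h
        exact congrArg Sum.inl (Quotient.sound (glue_lower h))

theorem comp_right_aux [Finite X] [Finite Y] [Finite Z] [Finite U]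
    (s : Setoid (X ⊕ Y)) (t : Setoid (Y ⊕ Z)) (u : Setoid (Z ⊕ U)) :
    (glue s (glue t u)).comap (outer ∘ outer) = comp s (comp t u) ∧
      Nat.card (Avoiding (glue s (glue t u)) (outer ∘ outer)) =
        loops s (comp t u) + loops t u := by
  have e : (outer ∘ outer : X ⊕ U → X ⊕ Y ⊕ Z ⊕ U) =
      Sum.map id outer ∘ (outer : X ⊕ U → X ⊕ Y ⊕ U) := by
    funext x; rcases x with x | x <;> rfl
  rw [e]
  refine pushout_aux (T := X ⊕ Y ⊕ Z ⊕ U) (S := X ⊕ Y ⊕ U) (P := Y ⊕ Z ⊕ U) (O := Y ⊕ U)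
    Sum.inr (Sum.map id outer) outer Sum.inr (fun _ => rfl) _ _ _ (fun _ _ h => glue_lower h)
    ?_ ?_ ?_ ?_ outer
  · refine glue_le (E := (glue s (glue t u)).comap (Sum.map id outer)) ?_ ?_
    · rintro (p | p) (q | q) h <;> exact glue_upper h
    · intro p q h
      exact glue_lower h
  · intro p q h
    exact glue_lower h
  · rintro (x | x)
    exacts [Or.inr ⟨.inl x, rfl⟩, Or.inl ⟨x, rfl⟩]
  · intro ψ h1 h2
    have hy : ∀ x, ψ (Sum.inl x) = Sum.inl (Quotient.mk _ (Sum.inr (Sum.inl x))) :=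
      fun x => h2 (Sum.inl x)
    refine ⟨Sum.elim (fun x => Sum.inl (Quotient.mk _ (Sum.inl x))) ψ, fun _ => rfl, ?_, ?_⟩
    · rintro (x | x)
      exacts [rfl, h2 x]
    · refine glue_le (E := Setoid.ker _) ?_ h1
      have hu : ∀ p : X ⊕ Y, (Sum.elim (fun x => Sum.inl (Quotient.mk _ (Sum.inl x))) ψ :
          X ⊕ Y ⊕ Z ⊕ U → _) (upper p) = Sum.inl (Quotient.mk (glue s (comp t u)) (upper p)) := by
        rintro (p | p)
        exacts [rfl, hy p]
      intro p q h
      exact (hu p).trans ((congrArg Sum.inl (Quotient.sound (glue_upper h))).trans (hu q).symm)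

theorem comp_assoc [Finite X] [Finite Y] [Finite Z] [Finite U]
    (s : Setoid (X ⊕ Y)) (t : Setoid (Y ⊕ Z)) (u : Setoid (Z ⊕ U)) :
    comp (comp s t) u = comp s (comp t u) :=
  (comp_left_aux s t u).1.symm.trans (comp_right_aux s t u).1

theorem loops_assoc [Finite X] [Finite Y] [Finite Z] [Finite U]
    (s : Setoid (X ⊕ Y)) (t : Setoid (Y ⊕ Z)) (u : Setoid (Z ⊕ U)) :
    loops s t + loops (comp s t) u = loops t u + loops s (comp t u) := by
  rw [add_comm, add_comm (loops t u)]
  exact (comp_left_aux s t u).2.symm.trans (comp_right_aux s t u).2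

/-- The diagram of a bijection `σ`, in which the top vertex `σ v` is joined to the bottom
vertex `v`. -/
def graphOf (σ : X ≃ Y) : Setoid (Y ⊕ X) := Setoid.ker (Sum.elim id σ)

theorem glue_graphOf_left (σ : X ≃ Y) (t : Setoid (X ⊕ Z)) :
    glue (graphOf σ) t = t.comap (Sum.elim (Sum.inl ∘ σ.symm) id) := by
  have key : ∀ a : Y ⊕ X ⊕ Z, glue (graphOf σ) t a
      (Sum.inr (Sum.elim (Sum.inl ∘ σ.symm) id a)) := by
    rintro (a | a)
    · exact glue_upper (p := .inl a) (q := .inr (σ.symm a)) (σ.apply_symm_apply a).symm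
    · exact Setoid.refl' _ _
  refine le_antisymm (glue_le ?_ fun p q h => h) ?_
  · have hg : ∀ p : Y ⊕ X, Sum.elim (Sum.inl ∘ σ.symm) id (upper p) =
        (Sum.inl (σ.symm (Sum.elim id σ p)) : X ⊕ Z) := by
      rintro (p | p) <;> simp [upper]
    intro p q h
    rw [Setoid.comap_rel, hg, hg, show Sum.elim id σ p = Sum.elim id σ q from h]
  · intro a b h
    exact Setoid.trans' _ (key a) (Setoid.trans' _ (glue_lower h) (Setoid.symm' _ (key b)))

theorem comp_graphOf_left (σ : X ≃ Y) (t : Setoid (X ⊕ Z)) :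
    comp (graphOf σ) t = t.comap (Sum.map σ.symm id) := by
  rw [comp, glue_graphOf_left, ← Setoid.comap_comp]
  congr 1
  funext x; rcases x with x | x <;> rfl

theorem loops_graphOf_left (σ : X ≃ Y) (t : Setoid (X ⊕ Z)) : loops (graphOf σ) t = 0 := by
  have : IsEmpty (Avoiding (glue (graphOf σ) t) outer) := by
    refine ⟨?_⟩
    rintro ⟨⟨a | a | a⟩, h⟩
    · exact h (.inl a) rfl
    · refine h (.inl (σ a)) (Quotient.sound ?_)
      exact glue_upper (p := .inl (σ a)) (q := .inr a) rfl
    · exact h (.inr a) rfl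
  exact Nat.card_of_isEmpty

theorem glue_graphOf_right (s : Setoid (X ⊕ Y)) (σ : Z ≃ Y) :
    glue s (graphOf σ) = s.comap (Sum.elim Sum.inl (Sum.elim Sum.inr (Sum.inr ∘ σ))) := by
  have key : ∀ a : X ⊕ Y ⊕ Z, glue s (graphOf σ) a
      (upper (Sum.elim Sum.inl (Sum.elim Sum.inr (Sum.inr ∘ σ)) a)) := by
    rintro (a | a | a)
    · exact Setoid.refl' _ _
    · exact Setoid.refl' _ _
    · exact glue_lower (p := .inr a) (q := .inl (σ a)) rfl
  refine le_antisymm (glue_le ?_ ?_) ?_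
  · rintro (p | p) (q | q) h <;> exact h
  · have hg : ∀ p : Y ⊕ Z, Sum.elim Sum.inl (Sum.elim Sum.inr (Sum.inr ∘ σ)) (Sum.inr p) =
        (Sum.inr (Sum.elim id σ p) : X ⊕ Y) := by
      rintro (p | p) <;> simp
    intro p q h
    rw [Setoid.comap_rel, hg, hg, show Sum.elim id σ p = Sum.elim id σ q from h]
  · intro a b h
    exact Setoid.trans' _ (key a) (Setoid.trans' _ (glue_upper h) (Setoid.symm' _ (key b)))

theorem comp_graphOf_right (s : Setoid (X ⊕ Y)) (σ : Z ≃ Y) :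
    comp s (graphOf σ) = s.comap (Sum.map id σ) := by
  rw [comp, glue_graphOf_right, ← Setoid.comap_comp]
  congr 1
  funext x; rcases x with x | x <;> rfl

theorem loops_graphOf_right (s : Setoid (X ⊕ Y)) (σ : Z ≃ Y) : loops s (graphOf σ) = 0 := by
  have : IsEmpty (Avoiding (glue s (graphOf σ)) outer) := by
    refine ⟨?_⟩
    rintro ⟨⟨a | a | a⟩, h⟩
    · exact h (.inl a) rfl
    · refine h (.inr (σ.symm a)) (Quotient.sound ?_)
      exact glue_lower (p := .inr (σ.symm a)) (q := .inl a) (σ.apply_symm_apply a)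
    · exact h (.inr a) rfl
  exact Nat.card_of_isEmpty

/-- Every class has exactly two elements: the relation is a perfect matching. -/
def IsMatching (s : Setoid X) : Prop := ∀ x, ∃! y, y ≠ x ∧ s x y

theorem isMatching_graphOf (σ : X ≃ Y) : IsMatching (graphOf σ) := by
  rintro (x | x)
  · refine ⟨.inr (σ.symm x), ⟨by simp, (σ.apply_symm_apply x).symm⟩, ?_⟩
    rintro (y | y) ⟨h1, h2⟩
    · exact absurd (congrArg Sum.inl h2.symm) h1
    · exact congrArg Sum.inr (σ.injective (h2.symm.trans (σ.apply_symm_apply x).symm))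
  · refine ⟨.inl (σ x), ⟨by simp, rfl⟩, ?_⟩
    rintro (y | y) ⟨h1, h2⟩
    · exact congrArg Sum.inl h2.symm
    · exact absurd (congrArg Sum.inr (σ.injective h2.symm)) h1

/-- A set of classes of a perfect matching has an even number of elements. -/
theorem IsMatching.even_card [Finite X] {s : Setoid X} (hs : IsMatching s) (C : Set X)
    (hC : ∀ x y, s x y → x ∈ C → y ∈ C) : Even C.ncard := by
  classical
  have := Fintype.ofFinite X
  choose f hf huniq using hs
  have hff : ∀ x, f (f x) = x := fun x =>
    (huniq (f x) x ⟨(hf x).1.symm, Setoid.symm' _ (hf x).2⟩).symm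
  have h := Finset.sum_involution (s := C.toFinset) (f := fun _ => (1 : ZMod 2))
    (fun x _ => f x) (fun _ _ => by decide) (fun x _ _ => (hf x).1)
    (fun x hx => by simpa using hC _ _ (hf x).2 (by simpa using hx)) (fun x _ => hff x)
  rw [Finset.sum_const, nsmul_eq_mul, mul_one, ZMod.natCast_eq_zero_iff_even] at h
  rwa [Set.ncard_eq_toFinset_card']

theorem two_mul_card_le_of_connected {A : Type} [Fintype A] (H : SimpleGraph A)
    (h : H.Connected) (N : A → Finset A) (hN : ∀ a b, H.Adj a b → b ∈ N a) :
    2 * Fintype.card A ≤ (∑ a, (N a).card) + 2 := by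
  classical
  have h1 := h.card_vert_le_card_edgeSet_add_one
  rw [Nat.card_eq_fintype_card, Nat.card_eq_fintype_card, ← SimpleGraph.edgeFinset_card] at h1
  have h2 := H.sum_degrees_eq_twice_card_edges
  have h3 : ∑ a, H.degree a ≤ ∑ a, (N a).card := Finset.sum_le_sum fun a _ =>
    Finset.card_le_card fun b hb => hN a b (by simpa using hb)
  omega

theorem IsMatching.comp [Finite X] [Finite Y] [Finite Z] {s : Setoid (X ⊕ Y)}
    {t : Setoid (Y ⊕ Z)} (hs : IsMatching s) (ht : IsMatching t) : IsMatching (comp s t) := by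
  classical
  have := Fintype.ofFinite X
  have := Fintype.ofFinite Y
  have := Fintype.ofFinite Z
  intro p₀
  have hs' := hs
  have ht' := ht
  choose f hf hfu using hs'
  choose g hg hgu using ht'
  let G : SimpleGraph (X ⊕ Y ⊕ Z) := SimpleGraph.fromRel fun a b =>
    (∃ p q, s p q ∧ a = upper p ∧ b = upper q) ∨ (∃ p q, t p q ∧ a = Sum.inr p ∧ b = Sum.inr q)
  have hGJ : ∀ a b, G.Reachable a b ↔ glue s t a b := by
    intro a b
    constructor
    · rintro ⟨w⟩
      induction w with
      | nil => exact Setoid.refl' _ _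
      | cons h _ ih =>
        refine Setoid.trans' _ ?_ ih
        rcases h.2 with h | h
        · exact Relation.EqvGen.rel _ _ h
        · exact Setoid.symm' _ (Relation.EqvGen.rel _ _ h)
    · have : glue s t ≤ G.reachableSetoid := by
        refine Setoid.eqvGen_le fun x y h => ?_
        by_cases hxy : x = y
        · subst hxy; exact SimpleGraph.Reachable.refl _
        · exact SimpleGraph.Adj.reachable ⟨hxy, Or.inl h⟩
      exact fun h => this h
  let N : X ⊕ Y ⊕ Z → Finset (X ⊕ Y ⊕ Z) := Sum.elim (fun x => {upper (f (.inl x))})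
    (Sum.elim (fun y => {upper (f (.inr y)), .inr (g (.inl y))}) (fun z => {.inr (g (.inr z))}))
  let w : X ⊕ Y ⊕ Z → ℕ := Sum.elim (fun _ => 1) (Sum.elim (fun _ => 2) (fun _ => 1))
  have hNs : ∀ p q : X ⊕ Y, s p q → p ≠ q → (upper q : X ⊕ Y ⊕ Z) ∈ N (upper p) := by
    intro p q h hne
    rw [hfu p q ⟨hne.symm, h⟩]
    rcases p with p | p <;> simp [N, upper]
  have hNt : ∀ p q : Y ⊕ Z, t p q → p ≠ q → (.inr q : X ⊕ Y ⊕ Z) ∈ N (.inr p) := by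
    intro p q h hne
    rw [hgu p q ⟨hne.symm, h⟩]
    rcases p with p | p <;> simp [N]
  have hN : ∀ a b, G.Adj a b → b ∈ N a := by
    rintro a b ⟨hne, (⟨p, q, h, rfl, rfl⟩ | ⟨p, q, h, rfl, rfl⟩) |
      (⟨p, q, h, rfl, rfl⟩ | ⟨p, q, h, rfl, rfl⟩)⟩
    · exact hNs _ _ h (fun e => hne (congrArg _ e))
    · exact hNt _ _ h (fun e => hne (congrArg _ e))
    · exact hNs _ _ (Setoid.symm' _ h) (fun e => hne (congrArg _ e))
    · exact hNt _ _ (Setoid.symm' _ h) (fun e => hne (congrArg _ e))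
  have hNw : ∀ a, (N a).card ≤ w a := by
    rintro (a | a | a)
    · simp [N, w]
    · exact Finset.card_le_two
    · simp [N, w]
  let C := G.connectedComponentMk (outer p₀)
  obtain ⟨c, hcC⟩ : ∃ c : X ⊕ Y ⊕ Z → Prop, ∀ a, c a ↔ a ∈ C.supp := ⟨_, fun _ => Iff.rfl⟩
  have hc : ∀ a, c a ↔ glue s t (outer p₀) a := by
    intro a
    rw [← hGJ, hcC]
    exact SimpleGraph.ConnectedComponent.eq.trans ⟨fun h => h.symm, fun h => h.symm⟩
  have hedge := two_mul_card_le_of_connected C.toSimpleGraph C.connected_toSimpleGraph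
    (fun a => (N a).subtype _) (fun a b hab => by simpa using hN _ _ hab)
  have hsum : ∑ a : C, ((N a).subtype (· ∈ C)).card ≤ ∑ a, if c a then w a else 0 := by
    rw [← Finset.sum_filter]
    refine (Finset.sum_le_sum fun a _ => ?_).trans
      (le_of_eq (Finset.sum_subtype _ (fun a => by rw [Finset.mem_filter, and_iff_right (Finset.mem_univ a)]; exact hcC a) w).symm)
    rw [Finset.card_subtype]
    exact (Finset.card_filter_le _ _).trans (hNw a)
  have hcard : Fintype.card C = ∑ a, if c a then 1 else 0 := by
    rw [← Finset.card_filter]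
    exact Fintype.card_of_subtype _ (fun a => by rw [Finset.mem_filter, and_iff_right (Finset.mem_univ a)]; exact hcC a)
  replace hedge := hedge.trans (Nat.add_le_add_right hsum 2)
  rw [hcard] at hedge
  have hev : ∀ {A : Type} [Fintype A] (P : A → Prop) [DecidablePred P],
      {x | P x}.ncard = ∑ x, if P x then 1 else 0 := by
    intro A _ P _
    rw [← Finset.card_filter, Set.ncard_eq_toFinset_card']
    congr 1; ext; simp
  have e1 : Even ((∑ x, if c (Sum.inl x) then 1 else 0) +
      ∑ y, if c (Sum.inr (Sum.inl y)) then 1 else 0) := by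
    have h := hs.even_card {p | c (upper p)} fun x y hxy hx =>
      (hc _).2 (Setoid.trans' _ ((hc _).1 hx) (glue_upper hxy))
    rw [hev, Fintype.sum_sum_type] at h
    exact h
  have e2 : Even ((∑ y, if c (Sum.inr (Sum.inl y)) then 1 else 0) +
      ∑ z, if c (Sum.inr (Sum.inr z)) then 1 else 0) := by
    have h := ht.even_card {p | c (Sum.inr p)} fun x y hxy hx =>
      (hc _).2 (Setoid.trans' _ ((hc _).1 hx) (glue_lower hxy))
    rw [hev, Fintype.sum_sum_type] at h
    exact h
  have hk : {q : X ⊕ Z | c (outer q)}.ncard = (∑ x, if c (Sum.inl x) then 1 else 0) +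
      ∑ z, if c (Sum.inr (Sum.inr z)) then 1 else 0 := by
    rw [hev, Fintype.sum_sum_type]; rfl
  have hp₀ : p₀ ∈ {q : X ⊕ Z | c (outer q)} := (hc _).2 (Setoid.refl' _ _)
  have hpos : 0 < {q : X ⊕ Z | c (outer q)}.ncard := (Set.ncard_pos (Set.toFinite _)).2 ⟨_, hp₀⟩
  have hw2 : (∑ a, if c (Sum.inr (Sum.inl a)) then (2 : ℕ) else 0) =
      2 * ∑ a, if c (Sum.inr (Sum.inl a)) then 1 else 0 := by
    rw [Finset.mul_sum]; exact Finset.sum_congr rfl fun a _ => by split_ifs <;> rfl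
  simp only [Fintype.sum_sum_type, w, Sum.elim_inl, Sum.elim_inr] at hedge
  rw [hw2] at hedge
  have h2 : {q : X ⊕ Z | c (outer q)}.ncard = 2 := by
    rw [Nat.even_iff] at e1 e2
    omega
  have h1 := Set.ncard_sdiff_singleton_of_mem hp₀
  rw [h2] at h1
  obtain ⟨q, hq⟩ := Set.ncard_eq_one.1 h1
  have hqq : ∀ y, (y ≠ p₀ ∧ TypeC.comp s t p₀ y) ↔ y = q := by
    intro y
    have := Set.ext_iff.1 hq y
    simp only [Set.mem_sdiff, Set.mem_ofPred_eq, Set.mem_singleton_iff, hc] at this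
    rw [← this, and_comm]; rfl
  exact ⟨q, (hqq q).2 rfl, fun y hy => (hqq y).1 hy⟩

end Gluing
/-! ### Hyperoctahedral groups -/

/-- The vertices `-n, …, -1, 1, …, n`: the pair `(i, ε)` stands for `ε * (i + 1)`. -/
abbrev Node (n : ℕ) : Type := Fin n × ℤˣ

/-- The reflection `v ↦ -v`. -/
def reflect {A : Type} (v : A × ℤˣ) : A × ℤˣ := (v.1, -v.2)

theorem reflect_reflect {A : Type} (v : A × ℤˣ) : reflect (reflect v) = v := by
  simp [reflect]

/-- The signed permutations of `-n, …, -1, 1, …, n`. -/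
def signedPerm (n : ℕ) : Subgroup (Equiv.Perm (Node n)) where
  carrier := {σ | ∀ v, σ (reflect v) = reflect (σ v)}
  mul_mem' {σ τ} hσ hτ v := by
    rw [Equiv.Perm.mul_apply, Equiv.Perm.mul_apply, hτ, hσ]
  one_mem' _ := rfl
  inv_mem' {σ} hσ v := by
    rw [Equiv.Perm.inv_eq_iff_eq, hσ]; exact congrArg reflect (σ.apply_symm_apply v).symm

/-- The hyperoctahedral group `W_n`. -/
abbrev Hyp (n : ℕ) : Type := signedPerm n

instance (n : ℕ) : Fintype (Hyp n) := Fintype.ofFinite _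

/-- The permutation of `1, …, n` underlying a signed permutation. -/
def Hyp.underlying {n : ℕ} (σ : Hyp n) : Equiv.Perm (Fin n) where
  toFun i := (σ.1 (i, 1)).1
  invFun i := (σ.1.symm (i, 1)).1
  left_inv i := by
    beta_reduce
    rcases Int.units_eq_one_or (σ.1 (i, 1)).2 with h | h
    · have : ((σ.1 (i, 1)).1, 1) = σ.1 (i, 1) := Prod.ext rfl h.symm
      rw [this, Equiv.symm_apply_apply]
    · have : ((σ.1 (i, 1)).1, 1) = σ.1 (reflect (i, 1)) := by
        rw [σ.2]; exact Prod.ext rfl (by simp [reflect, h])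
      rw [this, Equiv.symm_apply_apply]; rfl
  right_inv i := by
    beta_reduce
    have hs : ∀ v, σ.1.symm (reflect v) = reflect (σ.1.symm v) := (σ⁻¹).2
    rcases Int.units_eq_one_or (σ.1.symm (i, 1)).2 with h | h
    · have : ((σ.1.symm (i, 1)).1, 1) = σ.1.symm (i, 1) := Prod.ext rfl h.symm
      rw [this, Equiv.apply_symm_apply]
    · have : ((σ.1.symm (i, 1)).1, 1) = σ.1.symm (reflect (i, 1)) := by
        rw [hs]; exact Prod.ext rfl (by simp [reflect, h])
      rw [this, Equiv.apply_symm_apply]; rfl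

/-- The sign of a signed permutation: `(-1)` to the number of sign changes, times the sign of the
underlying permutation. -/
def Hyp.sgn {n : ℕ} (σ : Hyp n) : ℤˣ :=
  (∏ i, (σ.1 (i, 1)).2) * Equiv.Perm.sign σ.underlying

/-! ### The Brauer algebra of type `C` -/

/-- A Brauer diagram of type `C`: a perfect matching of the top vertices `Sum.inl v` and the bottom
vertices `Sum.inr v`, symmetric under the reflection `v ↦ -v`. -/
@[ext]
structure Diagram (r : ℕ) where
  rel : Setoid (Node r ⊕ Node r)
  matching : IsMatching rel
  mirror : ∀ x y, rel x y → rel (Sum.map reflect reflect x) (Sum.map reflect reflect y)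

/-- Concatenation: the first diagram is put on top of the second one. -/
def Diagram.mul {r : ℕ} (d e : Diagram r) : Diagram r where
  rel := comp d.rel e.rel
  matching := d.matching.comp e.matching
  mirror := by
    have h : glue d.rel e.rel ≤ (glue d.rel e.rel).comap
        (Sum.map reflect (Sum.map reflect reflect)) := by
      refine glue_le ?_ ?_
      · rintro (p | p) (q | q) h <;> exact glue_upper (d.mirror _ _ h)
      · rintro p q h; exact glue_lower (e.mirror _ _ h)
    rintro (x | x) (y | y) hxy <;> exact h hxy

/-- The diagram of a signed permutation `σ`: the top vertex `σ v` is joined to the bottom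
vertex `v`. -/
def Diagram.ofPerm {r : ℕ} (σ : Hyp r) : Diagram r where
  rel := graphOf σ.1
  matching := isMatching_graphOf σ.1
  mirror := by
    have hh : ∀ x : Node r ⊕ Node r, Sum.elim id σ.1 (Sum.map reflect reflect x) =
        reflect (Sum.elim id σ.1 x) := by
      rintro (x | x)
      exacts [rfl, σ.2 x]
    intro x y h
    have h' : Sum.elim id σ.1 x = Sum.elim id σ.1 y := h
    change Sum.elim id σ.1 _ = Sum.elim id σ.1 _
    rw [hh, hh, h']

theorem Diagram.ofPerm_mul {r : ℕ} (σ τ : Hyp r) :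
    (ofPerm σ).mul (ofPerm τ) = ofPerm (σ * τ) := by
  refine Diagram.ext ?_
  change comp (graphOf σ.1) (graphOf τ.1) = graphOf (σ.1 * τ.1)
  rw [comp_graphOf_left]
  have hh : ∀ x : Node r ⊕ Node r, Sum.elim id (σ.1 * τ.1) x =
      σ.1 (Sum.elim id τ.1 (Sum.map σ.1.symm id x)) := by
    rintro (x | x) <;> simp
  ext x y
  change Sum.elim id τ.1 _ = Sum.elim id τ.1 _ ↔ Sum.elim id _ _ = Sum.elim id _ _
  rw [hh, hh, σ.1.injective.eq_iff]

section Algebra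

variable (K : Type*) [Field K] (δ : K) (r : ℕ)

/-- The Brauer algebra of type `C` with parameter `δ`: the vector space with basis the diagrams. -/
def Brauer (_ : K) (r : ℕ) : Type _ := Diagram r →₀ K

instance : AddCommGroup (Brauer K δ r) := inferInstanceAs (AddCommGroup (Diagram r →₀ K))

instance : Module K (Brauer K δ r) := inferInstanceAs (Module K (Diagram r →₀ K))

variable {K δ r}

/-- The basis element given by a diagram. -/
def Brauer.diag (d : Diagram r) : Brauer K δ r := Finsupp.single d (1 : K)

variable (K δ r)

/-- The multiplication: `d * e = δ ^ (number of closed loops) • (d on top of e)` for diagrams `d`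
and `e`, extended bilinearly. -/
def Brauer.mulLin : Brauer K δ r →ₗ[K] Brauer K δ r →ₗ[K] Brauer K δ r :=
  Finsupp.linearCombination K fun d : Diagram r =>
    (Finsupp.linearCombination K fun e : Diagram r =>
      δ ^ loops d.rel e.rel • (Brauer.diag (d.mul e) : Brauer K δ r) :
        Brauer K δ r →ₗ[K] Brauer K δ r)

variable {K δ r}

instance : Mul (Brauer K δ r) := ⟨fun x y => Brauer.mulLin K δ r x y⟩

instance : One (Brauer K δ r) := ⟨Brauer.diag (Diagram.ofPerm 1)⟩

theorem Brauer.mul_def (x y : Brauer K δ r) : x * y = Brauer.mulLin K δ r x y := rfl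

theorem Brauer.diag_mul_diag (d e : Diagram r) :
    (Brauer.diag d * Brauer.diag e : Brauer K δ r) =
      δ ^ loops d.rel e.rel • Brauer.diag (d.mul e) := by
  rw [Brauer.mul_def, Brauer.mulLin, Brauer.diag, Brauer.diag]
  erw [Finsupp.linearCombination_single, one_smul, Finsupp.linearCombination_single, one_smul]

theorem Brauer.induction {P : Brauer K δ r → Prop} (x : Brauer K δ r)
    (h0 : P 0) (hadd : ∀ x y, P x → P y → P (x + y))
    (hd : ∀ (a : K) d, P (a • Brauer.diag d)) : P x := by
  refine Finsupp.induction_linear (motive := P) x h0 hadd fun d a => ?_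
  have := hd a d
  rw [Brauer.diag] at this
  erw [Finsupp.smul_single, smul_eq_mul, mul_one] at this
  exact this

theorem Brauer.one_def : (1 : Brauer K δ r) = Brauer.diag (Diagram.ofPerm 1) := rfl

theorem Brauer.ofPerm_mul_diag (σ : Hyp r) (d : Diagram r) :
    (Brauer.diag (Diagram.ofPerm σ) * Brauer.diag d : Brauer K δ r) =
      Brauer.diag ((Diagram.ofPerm σ).mul d) := by
  rw [Brauer.diag_mul_diag]
  change δ ^ loops (graphOf σ.1) d.rel • _ = _
  rw [loops_graphOf_left, pow_zero, one_smul]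

theorem Brauer.diag_mul_ofPerm (σ : Hyp r) (d : Diagram r) :
    (Brauer.diag d * Brauer.diag (Diagram.ofPerm σ) : Brauer K δ r) =
      Brauer.diag (d.mul (Diagram.ofPerm σ)) := by
  rw [Brauer.diag_mul_diag]
  change δ ^ loops d.rel (graphOf σ.1) • _ = _
  rw [loops_graphOf_right, pow_zero, one_smul]

protected theorem Brauer.smul_mul (a : K) (x y : Brauer K δ r) : a • x * y = a • (x * y) := by
  simp only [Brauer.mul_def, map_smul, LinearMap.smul_apply]

protected theorem Brauer.mul_smul' (a : K) (x y : Brauer K δ r) : x * a • y = a • (x * y) := by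
  simp only [Brauer.mul_def, map_smul]

protected theorem Brauer.add_mul' (x y z : Brauer K δ r) : (x + y) * z = x * z + y * z := by
  simp only [Brauer.mul_def, map_add, LinearMap.add_apply]

protected theorem Brauer.mul_add' (x y z : Brauer K δ r) : x * (y + z) = x * y + x * z := by
  simp only [Brauer.mul_def, map_add]

protected theorem Brauer.zero_mul' (x : Brauer K δ r) : 0 * x = 0 := by
  simp only [Brauer.mul_def, map_zero, LinearMap.zero_apply]

protected theorem Brauer.mul_zero' (x : Brauer K δ r) : x * 0 = 0 := by
  simp only [Brauer.mul_def, map_zero]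

instance : Ring (Brauer K δ r) where
  __ := (inferInstance : AddCommGroup (Brauer K δ r))
  left_distrib := Brauer.mul_add'
  right_distrib := Brauer.add_mul'
  zero_mul := Brauer.zero_mul'
  mul_zero := Brauer.mul_zero'
  one_mul x := by
    refine Brauer.induction (P := fun x => 1 * x = x) x (Brauer.mul_zero' _) (fun x y hx hy => ?_) (fun a d => ?_)
    · rw [Brauer.mul_add', hx, hy]
    · rw [Brauer.mul_smul', Brauer.one_def, Brauer.ofPerm_mul_diag]
      congr 2
      refine Diagram.ext ?_
      change comp (graphOf (1 : Equiv.Perm (Node r))) d.rel = d.rel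
      rw [comp_graphOf_left]
      ext x y
      rcases x with x | x <;> rcases y with y | y <;> rfl
  mul_one x := by
    refine Brauer.induction (P := fun x => x * 1 = x) x (Brauer.zero_mul' _) (fun x y hx hy => ?_) (fun a d => ?_)
    · rw [Brauer.add_mul', hx, hy]
    · rw [Brauer.smul_mul, Brauer.one_def, Brauer.diag_mul_ofPerm]
      congr 2
      refine Diagram.ext ?_
      change comp d.rel (graphOf (1 : Equiv.Perm (Node r))) = d.rel
      rw [comp_graphOf_right]
      ext x y
      rcases x with x | x <;> rcases y with y | y <;> rfl
  mul_assoc x y z := by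
    refine Brauer.induction (P := fun x => x * y * z = x * (y * z)) x ?_ (fun x x' hx hx' => ?_) (fun a d => ?_)
    · simp only [Brauer.zero_mul']
    · simp only [Brauer.add_mul', hx, hx']
    refine Brauer.induction (P := fun y => _ * y * z = _ * (y * z)) y ?_ (fun x x' hx hx' => ?_) (fun b e => ?_)
    · simp only [Brauer.zero_mul', Brauer.mul_zero']
    · simp only [Brauer.add_mul', Brauer.mul_add', hx, hx']
    refine Brauer.induction (P := fun z => _ * _ * z = _ * (_ * z)) z ?_ (fun x x' hx hx' => ?_) (fun c f => ?_)
    · simp only [Brauer.mul_zero']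
    · simp only [Brauer.mul_add', hx, hx']
    simp only [Brauer.smul_mul, Brauer.mul_smul', Brauer.diag_mul_diag]
    have h1 : loops d.rel e.rel + loops (d.mul e).rel f.rel =
        loops e.rel f.rel + loops d.rel (e.mul f).rel := loops_assoc _ _ _
    have h2 : (d.mul e).mul f = d.mul (e.mul f) := Diagram.ext (comp_assoc _ _ _)
    have h3 : δ ^ loops d.rel e.rel * δ ^ loops (d.mul e).rel f.rel =
        δ ^ loops e.rel f.rel * δ ^ loops d.rel (e.mul f).rel := by
      rw [← pow_add, ← pow_add, h1]
    simp only [smul_smul]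
    rw [h2]
    congr 1
    linear_combination (a * b * c) * h3

instance : Algebra K (Brauer K δ r) :=
  Algebra.ofModule Brauer.smul_mul Brauer.mul_smul'

variable (K δ r) in
/-- The group `W_r` inside the Brauer algebra. -/
def Brauer.ofHyp : Hyp r →* Brauer K δ r where
  toFun σ := Brauer.diag (Diagram.ofPerm σ)
  map_one' := rfl
  map_mul' σ τ := by rw [Brauer.ofPerm_mul_diag, Diagram.ofPerm_mul]

end Algebra

/-- The vertices of `W_{r-l}` identified with the vertices `±(l+1), …, ±r`. -/
def shiftEquiv {r : ℕ} (l : Fin (r + 1)) :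
    Node (r - l) ≃ {v : Node r // (l : ℕ) ≤ v.1} where
  toFun v := ⟨(⟨l + v.1, by have := v.1.2; omega⟩, v.2), by simp⟩
  invFun v := (⟨v.1.1 - l, by have := v.1.1.2; have := v.2; omega⟩, v.1.2)
  left_inv v := by ext <;> simp
  right_inv v := by
    have := v.2
    ext <;> simp
    omega

/-- The embedding of `W_{r-l}` into `W_r` as the signed permutations that fix `±1, …, ±l`. -/
def Hyp.shift {r : ℕ} (l : Fin (r + 1)) : Hyp (r - l) →* Hyp r :=
  ((Equiv.Perm.extendDomainHom (shiftEquiv l)).comp (signedPerm (r - l)).subtype).codRestrict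
    (signedPerm r) (by
      intro σ v
      change σ.1.extendDomain (shiftEquiv l) (reflect v) =
        reflect (σ.1.extendDomain (shiftEquiv l) v)
      by_cases hv : (l : ℕ) ≤ v.1
      · obtain ⟨w, hw⟩ := (shiftEquiv l).surjective ⟨v, hv⟩
        have e1 : v = (shiftEquiv l w : Node r) := by rw [hw]
        have e2 : ∀ u, reflect (shiftEquiv l u : Node r) = shiftEquiv l (reflect u) :=
          fun u => rfl
        rw [e1, e2, Equiv.Perm.extendDomain_apply_image, Equiv.Perm.extendDomain_apply_image,
          σ.2, e2]
      · rw [Equiv.Perm.extendDomain_apply_not_subtype (p := fun v : Node r => (l : ℕ) ≤ v.1) _ _ hv,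
          Equiv.Perm.extendDomain_apply_not_subtype (p := fun v : Node r => (l : ℕ) ≤ v.1)]
        exact hv)

theorem Hyp.shift_of_lt {r : ℕ} (l : Fin (r + 1)) (σ : Hyp (r - l)) (v : Node r)
    (hv : ¬ (l : ℕ) ≤ v.1) : (Hyp.shift l σ).1 v = v :=
  Equiv.Perm.extendDomain_apply_not_subtype (p := fun v : Node r => (l : ℕ) ≤ v.1) _ _ hv

theorem Hyp.le_shift {r : ℕ} (l : Fin (r + 1)) (σ : Hyp (r - l)) (v : Node r)
    (hv : (l : ℕ) ≤ v.1) : (l : ℕ) ≤ ((Hyp.shift l σ).1 v).1 := by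
  change (l : ℕ) ≤ (σ.1.extendDomain (shiftEquiv l) v).1
  rw [Equiv.Perm.extendDomain_apply_subtype (p := fun v : Node r => (l : ℕ) ≤ v.1) _ _ hv]
  exact (shiftEquiv l _).2

theorem eq_neg_of_ne {a b : ℤˣ} : b ≠ a → b = -a := by
  revert a b; decide

/-- Labels for the edges of the diagram with the horizontal edges `{i, -i}` for `1 ≤ i ≤ l` in both
rows and with vertical edges elsewhere. -/
def arcLabel {r : ℕ} (l : ℕ) : Node r ⊕ Node r → (Fin r ⊕ Fin r) ⊕ Node r :=
  Sum.elim (fun v => if l ≤ v.1 then .inr v else .inl (.inl v.1))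
    (fun v => if l ≤ v.1 then .inr v else .inl (.inr v.1))

/-- The diagram with the horizontal edges `{i, -i}` for `1 ≤ i ≤ l` in both rows and with vertical
edges elsewhere. -/
def Diagram.arcs {r : ℕ} (l : ℕ) : Diagram r where
  rel := Setoid.ker (arcLabel l)
  matching := by
    have hu' : ∀ a : ℤˣ, -a ≠ a := by decide
    rintro (⟨i, a⟩ | ⟨i, a⟩)
    · by_cases h : l ≤ i
      · refine ⟨.inr (i, a), ⟨by simp, by simp [arcLabel, h]⟩, ?_⟩
        rintro (⟨j, b⟩ | ⟨j, b⟩) ⟨h1, h2⟩ <;>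
          change arcLabel l _ = arcLabel l _ at h2 <;>
          simp only [arcLabel, Sum.elim_inl, Sum.elim_inr] at h2 <;>
          split_ifs at h2 <;> simp_all
      · refine ⟨.inl (i, -a), ⟨by simp [hu'], by simp [arcLabel, h]⟩, ?_⟩
        rintro (⟨j, b⟩ | ⟨j, b⟩) ⟨h1, h2⟩
        · have h3 : i = j := by
            change arcLabel l _ = arcLabel l _ at h2
            simp only [arcLabel, Sum.elim_inl] at h2
            split_ifs at h2
            simpa using h2
          subst h3
          rw [eq_neg_of_ne (a := a) (b := b) (fun e => h1 (by rw [e]))]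
        · change arcLabel l _ = arcLabel l _ at h2
          simp only [arcLabel, Sum.elim_inl, Sum.elim_inr] at h2
          split_ifs at h2; simp at h2
    · by_cases h : l ≤ i
      · refine ⟨.inl (i, a), ⟨by simp, by simp [arcLabel, h]⟩, ?_⟩
        rintro (⟨j, b⟩ | ⟨j, b⟩) ⟨h1, h2⟩ <;>
          change arcLabel l _ = arcLabel l _ at h2 <;>
          simp only [arcLabel, Sum.elim_inl, Sum.elim_inr] at h2 <;>
          split_ifs at h2 <;> simp_all
      · refine ⟨.inr (i, -a), ⟨by simp [hu'], by simp [arcLabel, h]⟩, ?_⟩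
        rintro (⟨j, b⟩ | ⟨j, b⟩) ⟨h1, h2⟩
        · change arcLabel l _ = arcLabel l _ at h2
          simp only [arcLabel, Sum.elim_inl, Sum.elim_inr] at h2
          split_ifs at h2; simp at h2
        · have h3 : i = j := by
            change arcLabel l _ = arcLabel l _ at h2
            simp only [arcLabel, Sum.elim_inr] at h2
            split_ifs at h2
            simpa using h2
          subst h3
          rw [eq_neg_of_ne (a := a) (b := b) (fun e => h1 (by rw [e]))]
  mirror := by
    have hh : ∀ x : Node r ⊕ Node r, arcLabel l (Sum.map reflect reflect x) =
        Sum.map id reflect (arcLabel l x) := by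
      rintro (⟨i, a⟩ | ⟨i, a⟩) <;> by_cases h : l ≤ i <;> simp [arcLabel, reflect, h]
    intro x y h
    have h' : arcLabel l x = arcLabel l y := h
    change arcLabel l _ = arcLabel l _
    rw [hh, hh, h']

theorem Diagram.shift_mul_arcs {r : ℕ} (l : Fin (r + 1)) (σ : Hyp (r - l)) :
    (ofPerm (Hyp.shift l σ)).mul (arcs l) = (arcs l).mul (ofPerm (Hyp.shift l σ)) := by
  refine Diagram.ext ?_
  change comp (graphOf (Hyp.shift l σ).1) (arcs l).rel = comp (arcs l).rel (graphOf _)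
  rw [comp_graphOf_left, comp_graphOf_right]
  set τ := (Hyp.shift l σ).1 with hτ
  have h1 : ∀ v : Node r, ¬ (l : ℕ) ≤ v.1 → τ v = v := Hyp.shift_of_lt l σ
  have h2 : ∀ v : Node r, (l : ℕ) ≤ v.1 → (l : ℕ) ≤ (τ v).1 := Hyp.le_shift l σ
  have h3 : ∀ v : Node r, ¬ (l : ℕ) ≤ v.1 → τ.symm v = v := fun v hv => by
    rw [Equiv.symm_apply_eq, h1 v hv]
  have h4 : ∀ v : Node r, (l : ℕ) ≤ v.1 → (l : ℕ) ≤ (τ.symm v).1 := fun v hv => by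
    by_contra hc
    have := h1 _ hc
    rw [Equiv.apply_symm_apply] at this
    exact hc (this ▸ hv)
  have hh : ∀ x : Node r ⊕ Node r, arcLabel l (Sum.map id τ x) =
      Sum.map id τ (arcLabel l (Sum.map τ.symm id x)) := by
    rintro (v | v) <;> by_cases hv : (l : ℕ) ≤ v.1
    · simp [arcLabel, hv, h4 v hv]
    · simp [arcLabel, hv, h3 v hv]
    · simp [arcLabel, hv, h2 v hv]
    · simp [arcLabel, hv, h1 v hv]
  ext x y
  change arcLabel l _ = arcLabel l _ ↔ arcLabel l _ = arcLabel l _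
  rw [hh, hh, (Function.Injective.sumMap Function.injective_id τ.injective).eq_iff]

/-- `d.HasHorizontal k`: at least `k` horizontal edges in the top row, that is, at least `2 * k` top
vertices are joined to another top vertex. (There are as many horizontal edges in the bottom
row.) -/
def Diagram.HasHorizontal {r : ℕ} (d : Diagram r) (k : ℕ) : Prop :=
  2 * k ≤ Nat.card {v : Node r // ∃ u, u ≠ v ∧ d.rel (Sum.inl v) (Sum.inl u)}

section Functors

variable (K : Type*) [Field K] (δ : K) {r : ℕ}

/-- The group algebra of `W_n`. -/
abbrev HypAlg (n : ℕ) : Type _ := MonoidAlgebra K (Hyp n)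

/-- The idempotent `e_l`, namely `δ ^ (-l)` times the diagram with horizontal edges `{i, -i}` for
`1 ≤ i ≤ l` in both rows. -/
def Brauer.idem (l : Fin (r + 1)) : Brauer K δ r :=
  (δ⁻¹) ^ (l : ℕ) • Brauer.diag (Diagram.arcs l)

/-- The group algebra of `W_{r-l}` inside the Brauer algebra, acting on `±(l+1), …, ±r`. -/
def Brauer.ofHypAlg (l : Fin (r + 1)) : HypAlg K (r - l) →ₐ[K] Brauer K δ r :=
  MonoidAlgebra.lift K _ _ ((Brauer.ofHyp K δ r).comp (Hyp.shift l))

theorem Brauer.ofHypAlg_mul_idem (l : Fin (r + 1)) (a : HypAlg K (r - l)) :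
    Brauer.ofHypAlg K δ l a * Brauer.idem K δ l = Brauer.idem K δ l * Brauer.ofHypAlg K δ l a := by
  induction a using MonoidAlgebra.induction_on with
  | of σ =>
    have h : Brauer.ofHypAlg K δ l (MonoidAlgebra.of K _ σ) =
        Brauer.diag (Diagram.ofPerm (Hyp.shift l σ)) := by
      simp [Brauer.ofHypAlg, Brauer.ofHyp]
    rw [h, Brauer.idem, mul_smul_comm, smul_mul_assoc, Brauer.ofPerm_mul_diag,
      Brauer.diag_mul_ofPerm, Diagram.shift_mul_arcs]
  | add a b ha hb => rw [map_add, add_mul, mul_add, ha, hb]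
  | smul c a ha => rw [map_smul, smul_mul_assoc, mul_smul_comm, ha]

/-- The two-sided ideal `J_k` generated by the diagrams with at least `k` horizontal edges. -/
def Brauer.idealJ (r k : ℕ) : Ideal (Brauer K δ r) :=
  (TwoSidedIdeal.span
    (Set.range fun d : {d : Diagram r // d.HasHorizontal k} =>
      (Brauer.diag d.1 : Brauer K δ r))).asIdeal

instance (r k : ℕ) : (Brauer.idealJ K δ r k).IsTwoSided :=
  inferInstanceAs (TwoSidedIdeal.asIdeal _).IsTwoSided

variable {K δ} {Q : Type*} [Ring Q] [Algebra K Q]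

/-- For a homomorphism `π` from the Brauer algebra to `Q`, the right ideal `e_l Q`. It is a
`W_{r-l}`-`Brauer`-bimodule. -/
def Corner (π : Brauer K δ r →ₐ[K] Q) (l : Fin (r + 1)) : Type _ :=
  LinearMap.range (LinearMap.mulLeft K (π (Brauer.idem K δ l)))

variable (π : Brauer K δ r →ₐ[K] Q) (l : Fin (r + 1))

instance : AddCommGroup (Corner π l) := inferInstanceAs (AddCommGroup (LinearMap.range _))

instance : Module K (Corner π l) := inferInstanceAs (Module K (LinearMap.range _))

/-- The element of `Q` given by an element of `e_l Q`. -/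
def Corner.val {π : Brauer K δ r →ₐ[K] Q} {l : Fin (r + 1)} : Corner π l →ₗ[K] Q :=
  Submodule.subtype _

theorem Corner.ext {π : Brauer K δ r →ₐ[K] Q} {l : Fin (r + 1)} {x y : Corner π l}
    (h : x.val = y.val) : x = y := Subtype.ext h

/-- The left action of `W_{r-l}` on `e_l Q`. -/
instance : Module (HypAlg K (r - l)) (Corner π l) where
  smul a x := ⟨π (Brauer.ofHypAlg K δ l a) * x.val, by
    obtain ⟨_, y, rfl⟩ := x
    refine ⟨π (Brauer.ofHypAlg K δ l a) * y, ?_⟩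
    change π _ * (π _ * y) = π _ * (π _ * y)
    rw [← mul_assoc, ← mul_assoc, ← map_mul, ← map_mul, Brauer.ofHypAlg_mul_idem]⟩
  one_smul x := Corner.ext <| by
    change π (Brauer.ofHypAlg K δ l 1) * x.val = x.val
    rw [map_one, map_one, one_mul]
  mul_smul a b x := Corner.ext <| by
    change π (Brauer.ofHypAlg K δ l (a * b)) * x.val = π _ * (π _ * x.val)
    rw [map_mul, map_mul, mul_assoc]
  smul_zero a := Corner.ext <| mul_zero (π (Brauer.ofHypAlg K δ l a))
  smul_add a x y := Corner.ext <| mul_add (π (Brauer.ofHypAlg K δ l a)) x.val y.val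
  add_smul a b x := Corner.ext <| by
    change π (Brauer.ofHypAlg K δ l (a + b)) * x.val = π _ * x.val + π _ * x.val
    rw [map_add, map_add, add_mul]
  zero_smul x := Corner.ext <| by
    change π (Brauer.ofHypAlg K δ l 0) * x.val = 0
    rw [map_zero, map_zero, zero_mul]

/-- The right action of the Brauer algebra on `e_l Q`. -/
instance : Module (Brauer K δ r)ᵐᵒᵖ (Corner π l) where
  smul b x := ⟨x.val * π b.unop, by
    obtain ⟨_, y, rfl⟩ := x
    exact ⟨y * π b.unop, (mul_assoc _ _ _).symm⟩⟩
  one_smul x := Corner.ext <| by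
    change x.val * π 1 = x.val
    rw [map_one, mul_one]
  mul_smul a b x := Corner.ext <| by
    change x.val * π (b.unop * a.unop) = x.val * π b.unop * π a.unop
    rw [map_mul, mul_assoc]
  smul_zero a := Corner.ext <| zero_mul (π a.unop)
  smul_add a x y := Corner.ext <| add_mul x.val y.val (π a.unop)
  add_smul a b x := Corner.ext <| by
    change x.val * π (a.unop + b.unop) = x.val * π a.unop + x.val * π b.unop
    rw [map_add, mul_add]
  zero_smul x := Corner.ext <| by
    change x.val * π 0 = 0
    rw [map_zero, mul_zero]

instance : SMulCommClass K (Brauer K δ r)ᵐᵒᵖ (Corner π l) where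
  smul_comm c b x := Corner.ext <| (smul_mul_assoc c x.val (π b.unop)).symm

variable (M : Type*) [AddCommGroup M] [Module K M] [Module (HypAlg K (r - l))ᵐᵒᵖ M]

/-- The relations `a x ⊗ m = x ⊗ m a` that define the tensor product over the group algebra. -/
def balanced : Submodule (Brauer K δ r)ᵐᵒᵖ (Corner π l ⊗[K] M) :=
  Submodule.span _ {z | ∃ (a : HypAlg K (r - l)) (x : Corner π l) (m : M),
    z = (a • x) ⊗ₜ[K] m - x ⊗ₜ[K] (MulOpposite.op a • m)}

/-- The right module `M ⊗ e_l Q` over the Brauer algebra, where the tensor product is over the group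
algebra of `W_{r-l}`. The two factors are written in the opposite order. -/
abbrev TensorCorner : Type _ := (Corner π l ⊗[K] M) ⧸ balanced π l M

variable (δ)

/-- `Ind_l M = M ⊗ e_l B`. -/
abbrev IndBig : Type _ := TensorCorner (AlgHom.id K (Brauer K δ r)) l M

/-- `ind_l M = M ⊗ e_l (B / J_{l+1})`. -/
abbrev IndLayer : Type _ :=
  TensorCorner (Ideal.Quotient.mkₐ K (Brauer.idealJ K δ r (l + 1))) l M

end Functors

/-! ### Bi-partitions, tabloids, permutation modules -/

/-- A bi-partition of `n`. -/
@[ext]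
structure BiPartition (n : ℕ) where
  fst : YoungDiagram
  snd : YoungDiagram
  card_add : fst.card + snd.card = n

/-- The dominance order `lam ⊵ mu` on bi-partitions in which the second components are compared
first. The second component is the one in which row permutations may change signs. -/
def BiPartition.Dominates {n : ℕ} (lam mu : BiPartition n) : Prop :=
  (∀ j, ∑ i ∈ Finset.range j, mu.snd.rowLen i ≤ ∑ i ∈ Finset.range j, lam.snd.rowLen i) ∧
    ∀ j, mu.snd.card + ∑ i ∈ Finset.range j, mu.fst.rowLen i ≤
      lam.snd.card + ∑ i ∈ Finset.range j, lam.fst.rowLen i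

section Tabloids

variable (K : Type*) [Field K] {n : ℕ} (lam : BiPartition n)

/-- The boxes of a bi-partition; a box is a pair (row, column) in one of the two diagrams. -/
abbrev BiPartition.Box : Type := lam.fst.cells ⊕ lam.snd.cells

/-- A bi-tableau: a filling of the boxes with elements of `{-n, …, -1, 1, …, n}` such that for each
`i` exactly one of `i`, `-i` occurs, and it occurs once. It is recorded as a bijection from signed
boxes to `{-n, …, -1, 1, …, n}` that commutes with `-1`; the entry of the box `c` is the image
of `(c, 1)`. -/
structure BiTableau where
  entry : lam.Box × ℤˣ ≃ Node n
  entry_reflect : ∀ x, entry (reflect x) = reflect (entry x)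

variable {lam}

/-- What row permutations preserve of a signed box: the row, and in the first diagram the sign. -/
def rowLabel (x : lam.Box × ℤˣ) : (ℕ × ℤˣ) ⊕ ℕ :=
  Sum.elim (fun c => .inl (c.1.1, x.2)) (fun c => .inr c.1.1) x.1

/-- What column permutations preserve of a signed box: the column, and in the second diagram the
sign. -/
def colLabel (x : lam.Box × ℤˣ) : ℕ ⊕ (ℕ × ℤˣ) :=
  Sum.elim (fun c => .inl c.1.2) (fun c => .inr (c.1.2, x.2)) x.1

namespace BiTableau

/-- The signed permutations that preserve the labels of the entries. -/
def labelGroup {A : Type} (t : BiTableau lam) (f : lam.Box × ℤˣ → A) : Subgroup (Hyp n) where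
  carrier := {σ | ∀ v, f (t.entry.symm (σ.1 v)) = f (t.entry.symm v)}
  mul_mem' {σ τ} hσ hτ v := (hσ (τ.1 v)).trans (hτ v)
  one_mem' _ := rfl
  inv_mem' {σ} hσ v := by
    have := hσ (σ.1.symm v)
    rw [Equiv.apply_symm_apply] at this
    exact this.symm

/-- The row permutations: they permute the entries within each row and may change the signs of
entries in the second diagram. -/
def rowGroup (t : BiTableau lam) : Subgroup (Hyp n) := t.labelGroup rowLabel

/-- The column permutations: they permute the entries within each column and may change the signs
of entries in the first diagram. -/
def colGroup (t : BiTableau lam) : Subgroup (Hyp n) := t.labelGroup colLabel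

/-- The right action of `W_n` on bi-tableaux by permuting the entries. -/
def act (t : BiTableau lam) (σ : Hyp n) : BiTableau lam where
  entry := t.entry.trans σ.1.symm
  entry_reflect x := by
    have hs : ∀ v, σ.1.symm (reflect v) = reflect (σ.1.symm v) := (σ⁻¹).2
    change σ.1.symm (t.entry (reflect x)) = reflect (σ.1.symm (t.entry x))
    rw [t.entry_reflect, hs]

theorem act_one (t : BiTableau lam) : t.act 1 = t := rfl

theorem act_mul (t : BiTableau lam) (σ τ : Hyp n) : t.act (σ * τ) = (t.act σ).act τ := rfl

/-- The action on tableaux replaces the row group by a conjugate. -/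
theorem mem_rowGroup_act (t : BiTableau lam) (σ τ : Hyp n) :
    τ ∈ (t.act σ).rowGroup ↔ σ * τ * σ⁻¹ ∈ t.rowGroup := by
  change (∀ v, rowLabel (t.entry.symm (σ.1 (τ.1 v))) = rowLabel (t.entry.symm (σ.1 v))) ↔
    ∀ v, rowLabel (t.entry.symm (σ.1 (τ.1 (σ.1.symm v)))) = rowLabel (t.entry.symm v)
  constructor
  · intro h v
    rw [h, Equiv.apply_symm_apply]
  · intro h v
    have := h (σ.1 v)
    rwa [Equiv.symm_apply_apply] at this

end BiTableau

variable (lam) in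
/-- Row equivalence of bi-tableaux. -/
def rowEquiv : Setoid (BiTableau lam) where
  r t s := ∃ σ ∈ t.rowGroup, s = t.act σ
  iseqv :=
    { refl := fun t => ⟨1, one_mem _, rfl⟩
      symm := by
        rintro t _ ⟨σ, hσ, rfl⟩
        refine ⟨σ⁻¹, ?_, ?_⟩
        · rw [BiTableau.mem_rowGroup_act]
          simpa using hσ
        · rw [← BiTableau.act_mul, mul_inv_cancel, BiTableau.act_one]
      trans := by
        rintro t _ _ ⟨σ, hσ, rfl⟩ ⟨τ, hτ, rfl⟩
        refine ⟨σ * τ, ?_, (BiTableau.act_mul _ _ _).symm⟩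
        rw [BiTableau.mem_rowGroup_act] at hτ
        simpa using mul_mem hτ hσ }

variable (lam) in
/-- Bi-tabloids: row equivalence classes of bi-tableaux. -/
def Tabloid : Type := Quotient (rowEquiv lam)

/-- The right action of `W_n` on bi-tabloids. -/
def Tabloid.act (σ : Hyp n) : Tabloid lam → Tabloid lam :=
  Quotient.map (fun t => t.act σ) (by
    rintro t _ ⟨τ, hτ, rfl⟩
    refine ⟨σ⁻¹ * τ * σ, ?_, ?_⟩
    · rw [BiTableau.mem_rowGroup_act]
      simpa [mul_assoc] using hτ
    · rw [← BiTableau.act_mul, ← BiTableau.act_mul]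
      congr 1
      group)

variable (lam) in
/-- The permutation module `M(λ)` of `W_n`, with basis the bi-tabloids. -/
def PermMod : Type _ := Tabloid lam →₀ K

instance : AddCommGroup (PermMod K lam) := inferInstanceAs (AddCommGroup (Tabloid lam →₀ K))

instance : Module K (PermMod K lam) := inferInstanceAs (Module K (Tabloid lam →₀ K))

/-- The linear extension of the right action of a signed permutation on bi-tabloids. -/
def PermMod.actLin (σ : Hyp n) : Module.End K (PermMod K lam) :=
  Finsupp.lmapDomain K K (Tabloid.act (lam := lam) σ)

theorem PermMod.actLin_one : PermMod.actLin K (lam := lam) 1 = 1 := by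
  refine (congrArg (Finsupp.lmapDomain K K) (funext ?_)).trans (Finsupp.lmapDomain_id K K)
  rintro ⟨t⟩; rfl

theorem PermMod.actLin_mul (σ τ : Hyp n) :
    PermMod.actLin K (lam := lam) (σ * τ) = PermMod.actLin K τ * PermMod.actLin K σ := by
  refine (congrArg (Finsupp.lmapDomain K K) (funext ?_)).trans
    (Finsupp.lmapDomain_comp K K (Tabloid.act σ) (Tabloid.act τ))
  rintro ⟨t⟩; rfl

variable (lam) in
/-- The linear extension of the right action on bi-tabloids. -/
def PermMod.action : (HypAlg K n)ᵐᵒᵖ →ₐ[K] Module.End K (PermMod K lam) :=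
  AlgHom.opComm (MonoidAlgebra.lift K _ _
    { toFun := fun σ => MulOpposite.op (PermMod.actLin K σ)
      map_one' := by rw [PermMod.actLin_one, MulOpposite.op_one]
      map_mul' := fun σ τ => by rw [PermMod.actLin_mul, MulOpposite.op_mul] })

/-- `M(λ)` as a right module over the group algebra of `W_n`. -/
instance : Module (HypAlg K n)ᵐᵒᵖ (PermMod K lam) :=
  Module.compHom _ (PermMod.action K lam).toRingHom

instance : IsScalarTower K (HypAlg K n)ᵐᵒᵖ (PermMod K lam) where
  smul_assoc c a m := by
    change PermMod.action K lam (c • a) m = c • PermMod.action K lam a m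
    rw [map_smul, LinearMap.smul_apply]

/-- The alternating column sum of a bi-tableau. -/
def colSum (t : BiTableau lam) : HypAlg K n := by
  classical exact ∑ σ with σ ∈ t.colGroup, MonoidAlgebra.single σ (((σ.sgn : ℤ) : K))

/-- The basis element `{t}` of `M(λ)`. -/
def tabloidOf (t : BiTableau lam) : PermMod K lam :=
  Finsupp.single (Quotient.mk (rowEquiv lam) t : Tabloid lam) (1 : K)

/-- The polytabloid `{t} k_t`. -/
def polytabloid (t : BiTableau lam) : PermMod K lam :=
  MulOpposite.op (colSum K t) • tabloidOf K t

variable (lam) in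
/-- The Specht module `S(λ)`. -/
def specht : Submodule (HypAlg K n)ᵐᵒᵖ (PermMod K lam) :=
  Submodule.span _ (Set.range (polytabloid K))

end Tabloids

/-! ### Direct summands and Young modules -/

section Summands

variable (R : Type*) [Ring R]

/-- A nonzero module that is not the direct sum of two nonzero submodules. -/
def Indecomposable (M : Type*) [AddCommGroup M] [Module R M] : Prop :=
  Nontrivial M ∧ ∀ P Q : Submodule R M, IsCompl P Q → P = ⊥ ∨ Q = ⊥

/-- `N` is isomorphic to a direct summand of `M`. -/
def IsSummand (N M : Type*) [AddCommGroup N] [Module R N] [AddCommGroup M] [Module R M] : Prop :=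
  ∃ P Q : Submodule R M, IsCompl P Q ∧ Nonempty (N ≃ₗ[R] P)

variable {R} in
/-- `M` is the internal direct sum of the indecomposable submodules `P 0, …, P (k - 1)`. -/
def IsDecomposition {M : Type*} [AddCommGroup M] [Module R M] {k : ℕ}
    (P : Fin k → Submodule R M) : Prop :=
  DirectSum.IsInternal P ∧ ∀ i, Indecomposable R (P i)

/-- `M` is a finite direct sum of indecomposable submodules, and in every such decomposition exactly
one of the summands is isomorphic to `N`. -/
def OccursOnce (N M : Type*) [AddCommGroup N] [Module R N] [AddCommGroup M] [Module R M] : Prop :=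
  (∃ (k : ℕ) (P : Fin k → Submodule R M), IsDecomposition P) ∧
    ∀ (k : ℕ) (P : Fin k → Submodule R M), IsDecomposition P →
      ∃! i, Nonempty (N ≃ₗ[R] P i)

end Summands

section Young

variable (K : Type*) [Field K]

/-- `Y` is the Young module `Y(λ)` of `W_n`: an indecomposable direct summand of `M(λ)` that
contains the Specht module. -/
def IsYoungHyp {n : ℕ} (lam : BiPartition n)
    (Y : Submodule (HypAlg K n)ᵐᵒᵖ (PermMod K lam)) : Prop :=
  Indecomposable (HypAlg K n)ᵐᵒᵖ Y ∧ (∃ Z, IsCompl Y Z) ∧ specht K lam ≤ Y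

/-- The index set of pairs `(l, λ)` with `0 ≤ l ≤ r` and `λ` a bi-partition of `r - l`. -/
abbrev Index (r : ℕ) : Type := Σ l : Fin (r + 1), BiPartition (r - l)

variable {K} (δ : K) {r : ℕ}

/-- The permutation module `M(l, λ) = Ind_l M(λ)` of the Brauer algebra. -/
abbrev BPermMod (x : Index r) : Type _ := IndBig δ x.1 (PermMod K x.2)

/-- `N` is the Young module `Y(l, λ)`: an indecomposable direct summand of `M(l, λ)` that has a
quotient isomorphic to `ind_l Y(λ)`. -/
def IsYoung (x : Index r) (N : Submodule (Brauer K δ r)ᵐᵒᵖ (BPermMod δ x)) : Prop :=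
  Indecomposable (Brauer K δ r)ᵐᵒᵖ N ∧ (∃ P, IsCompl N P) ∧
    ∃ Y, IsYoungHyp K x.2 Y ∧
      ∃ f : N →ₗ[(Brauer K δ r)ᵐᵒᵖ] IndLayer δ x.1 Y, Function.Surjective f

end Young

end TypeC

end

/-!
A Young module is singled out among the indecomposable summands of its permutation module by a ring
homomorphism `χ` from the endomorphism ring to `K`. By Fitting's lemma an endomorphism of an
indecomposable module of finite length is nilpotent or bijective, and as `χ` is multiplicative, a
direct sum decomposition has exactly one summand whose projection is not killed by `χ`; this
summand, say `N`, divides another module `X` if and only if `χ (b ∘ a) ≠ 0` for some homomorphisms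
`a` to `X` and `b` back.

For `M(λ)` the image of `M(μ)` under the alternating column sum of a `λ`-bi-tableau is zero unless
`λ ⊵ μ`, and a line for `μ = λ`. Hence the endomorphisms of `M(λ)` multiply a polytabloid by
scalars, and this defines `χ`.

For `M(l, λ)` the quotient algebra `e_l (B / J_{l+1}) e_l` is the group algebra of `W_{r-l}`, so
that multiplying `ind_l M(λ)` by `e_l` gives back `M(λ)`, on which the endomorphisms of `M(l, λ)`
therefore act. The composition of this action with `χ` detects `Y(l, λ)`. If `l < m`, every
homomorphism from `M(m, μ)` to `ind_l M(λ)` vanishes, because `M(m, μ)` is generated by elements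
fixed by `e_m ∈ J_{l+1}`.
-/

open scoped TensorProduct

noncomputable section

namespace TypeC

/-! ### Indecomposable summands -/

section Indecomposable

variable {R : Type*} [Ring R] {M N N' : Type*} [AddCommGroup M] [Module R M]
  [AddCommGroup N] [Module R N] [AddCommGroup N'] [Module R N']

theorem Indecomposable.bijective_of_not_isNilpotent [IsNoetherian R N] [IsArtinian R N]
    (hN : Indecomposable R N) {u : Module.End R N} (hu : ¬ IsNilpotent u) :
    Function.Bijective u := by
  obtain ⟨n, hn, hn0⟩ := (u.eventually_isCompl_ker_pow_range_pow.and
    (Filter.eventually_ne_atTop 0)).exists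
  have hker : LinearMap.ker (u ^ n) = ⊥ :=
    (hN.2 _ _ hn).resolve_right fun h => hu ⟨n, LinearMap.range_eq_bot.1 h⟩
  have hrange : LinearMap.range (u ^ n) = ⊤ := by simpa [hker] using hn.sup_eq_top
  have hunit : IsUnit (u ^ n) :=
    (Module.End.isUnit_iff _).2 ⟨LinearMap.ker_eq_bot.1 hker, LinearMap.range_eq_top.1 hrange⟩
  exact (Module.End.isUnit_iff _).1 ((isUnit_pow_iff hn0).1 hunit)

theorem isSummand_of_comp_eq_id {f : N →ₗ[R] M} {g : M →ₗ[R] N} (h : g ∘ₗ f = LinearMap.id) :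
    IsSummand R N M := by
  have hgf : Function.LeftInverse g f := LinearMap.congr_fun h
  have hidem : IsIdempotentElem (f ∘ₗ g) := by
    ext x
    simp [hgf (g x)]
  have hrange : LinearMap.range (f ∘ₗ g) = LinearMap.range f :=
    LinearMap.range_comp_of_range_eq_top _ (LinearMap.range_eq_top.2 hgf.surjective)
  exact ⟨LinearMap.range f, _, hrange ▸ LinearMap.IsIdempotentElem.isCompl hidem,
    ⟨LinearEquiv.ofInjective f hgf.injective⟩⟩

theorem isSummand_of_bijective {f : N →ₗ[R] M} {g : M →ₗ[R] N}
    (h : Function.Bijective (g ∘ₗ f)) : IsSummand R N M := by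
  let e := LinearEquiv.ofBijective _ h
  exact isSummand_of_comp_eq_id (f := f) (g := e.symm.toLinearMap ∘ₗ g)
    (LinearMap.ext fun x => e.symm_apply_apply x)

theorem isSummand_of_linearEquiv (e : N ≃ₗ[R] M) : IsSummand R N M :=
  isSummand_of_comp_eq_id (g := e.symm.toLinearMap) e.symm_comp

theorem IsSummand.exists_comp_eq_id (h : IsSummand R N M) :
    ∃ (i : N →ₗ[R] M) (p : M →ₗ[R] N), p ∘ₗ i = LinearMap.id := by
  obtain ⟨P, Q, hPQ, ⟨e⟩⟩ := h
  refine ⟨P.subtype ∘ₗ e.toLinearMap, e.symm.toLinearMap ∘ₗ P.projectionOnto Q hPQ, ?_⟩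
  ext x
  simp

theorem Indecomposable.nonempty_linearEquiv_of_isSummand [Nontrivial N]
    (hN' : Indecomposable R N') (h : IsSummand R N N') : Nonempty (N ≃ₗ[R] N') := by
  obtain ⟨P, Q, hPQ, ⟨e⟩⟩ := h
  have hP : P ≠ ⊥ := Submodule.nontrivial_iff_ne_bot.1 e.toEquiv.symm.nontrivial
  have hQ : Q = ⊥ := (hN'.2 P Q hPQ).resolve_left hP
  have hP' : P = ⊤ := by simpa [hQ] using hPQ.sup_eq_top
  exact ⟨e.trans (.ofTop P hP')⟩

end Indecomposable

section Decomposition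

variable {R : Type*} [Ring R] {M : Type*} [AddCommGroup M] [Module R M]

theorem exists_disjoint_sup_eq_of_not_indecomposable {N : Submodule R M} (h0 : N ≠ ⊥)
    (hN : ¬ Indecomposable R N) :
    ∃ A B : Submodule R M, Disjoint A B ∧ A ⊔ B = N ∧ A < N ∧ B < N := by
  have : Nontrivial N := Submodule.nontrivial_iff_ne_bot.2 h0
  simp only [Indecomposable, this, true_and, not_forall, not_or] at hN
  obtain ⟨P, Q, hPQ, hP, hQ⟩ := hN
  have map_lt {A : Submodule R N} (hA : A ≠ ⊤) : A.map N.subtype < N := by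
    have := Submodule.map_strictMono_of_injective N.injective_subtype hA.lt_top
    rwa [Submodule.map_subtype_top] at this
  refine ⟨P.map N.subtype, Q.map N.subtype,
    Submodule.disjoint_map N.injective_subtype hPQ.disjoint, ?_, map_lt fun h => hQ ?_,
    map_lt fun h => hP ?_⟩
  · rw [← Submodule.map_sup, hPQ.sup_eq_top, Submodule.map_subtype_top]
  · simpa [h] using hPQ.inf_eq_bot
  · simpa [h] using hPQ.inf_eq_bot

theorem exists_finset_indecomposable [IsArtinian R M] (N : Submodule R M) :
    ∃ s : Finset (Submodule R M), s.SupIndep id ∧ s.sup id = N ∧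
      ∀ P ∈ s, Indecomposable R P := by
  classical
  induction N using WellFoundedLT.induction with
  | ind N ih =>
    by_cases h0 : N = ⊥
    · exact ⟨∅, Finset.supIndep_empty _, by simp [h0], by simp⟩
    by_cases hN : Indecomposable R N
    · exact ⟨{N}, Finset.supIndep_singleton _ _, by simp, by simpa using hN⟩
    obtain ⟨A, B, hAB, rfl, hA, hB⟩ := exists_disjoint_sup_eq_of_not_indecomposable h0 hN
    obtain ⟨s, hs, rfl, hsi⟩ := ih A hA
    obtain ⟨t, ht, rfl, hti⟩ := ih B hB
    refine ⟨s ∪ t, hs.union ht hAB, Finset.sup_union, fun P hP => ?_⟩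
    exact (Finset.mem_union.1 hP).elim (hsi P) (hti P)

theorem exists_isDecomposition (R M : Type*) [Ring R] [AddCommGroup M] [Module R M]
    [IsArtinian R M] : ∃ (k : ℕ) (P : Fin k → Submodule R M), IsDecomposition P := by
  obtain ⟨s, hs, hsup, hsi⟩ := exists_finset_indecomposable (⊤ : Submodule R M)
  refine ⟨s.card, fun i => s.equivFin.symm i, ?_, fun i => hsi _ (s.equivFin.symm i).2⟩
  rw [DirectSum.isInternal_submodule_iff_iSupIndep_and_iSup_eq_top]
  constructor
  · exact (iSupIndep_comp_coe_iff_supIndep.2 hs).comp s.equivFin.symm.injective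
  · rw [← hsup, Finset.sup_eq_iSup, iSup_subtype', ← s.equivFin.symm.iSup_comp]
    rfl

variable {ι : Type*} [DecidableEq ι] {P : ι → Submodule R M}

/-- The projection of an internal direct sum onto its `i`-th summand. -/
def summandProj (h : DirectSum.IsInternal P) (i : ι) : M →ₗ[R] P i :=
  DirectSum.component R ι _ i ∘ₗ
    (LinearEquiv.ofBijective (DirectSum.coeLinearMap P) h).symm.toLinearMap

variable (h : DirectSum.IsInternal P)

theorem summandProj_comp_subtype (i : ι) : summandProj h i ∘ₗ (P i).subtype = LinearMap.id :=
  LinearMap.ext fun x => h.ofBijective_coeLinearMap_same x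

theorem summandProj_comp_subtype_of_ne {i j : ι} (hij : i ≠ j) :
    summandProj h i ∘ₗ (P j).subtype = 0 :=
  LinearMap.ext fun x => h.ofBijective_coeLinearMap_of_ne hij.symm x

theorem sum_subtype_comp_summandProj [Fintype ι] :
    ∑ i, (P i).subtype ∘ₗ summandProj h i = LinearMap.id := by
  ext x
  let e := LinearEquiv.ofBijective (DirectSum.coeLinearMap P) h
  calc (∑ i, (P i).subtype ∘ₗ summandProj h i) x
      = e (∑ i, DirectSum.of (fun i => P i) i (e.symm x i)) := by
        simp only [LinearMap.sum_apply, map_sum]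
        exact Finset.sum_congr rfl fun i _ => (DirectSum.coeLinearMap_of P i _).symm
    _ = x := by rw [DirectSum.sum_univ_of, e.apply_symm_apply]

end Decomposition

/-! ### Summands detected by a character of the endomorphism ring -/

section Detects

variable {R : Type*} [Ring R] {M : Type*} [AddCommGroup M] [Module R M]
  {D : Type*} [Semiring D] (χ : Module.End R M →+* D)
  {N N' X : Type*} [AddCommGroup N] [Module R N] [AddCommGroup N'] [Module R N']
  [AddCommGroup X] [Module R X]

/-- The multiplicative functional `χ` on `End M` is nonzero on some endomorphism of `M` that factors
through `N`. When `D` is a domain and `M` has finite length, exactly one indecomposable summand of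
`M` is detected by `χ`, up to isomorphism. -/
def Detects (N : Type*) [AddCommGroup N] [Module R N] : Prop :=
  ∃ (i : N →ₗ[R] M) (p : M →ₗ[R] N), χ (i ∘ₗ p) ≠ 0

variable {χ}

theorem detects_iff_of_comp_eq_id {i : N →ₗ[R] M} {p : M →ₗ[R] N} (hpi : p ∘ₗ i = LinearMap.id) :
    Detects χ N ↔ χ (i ∘ₗ p) ≠ 0 := by
  refine ⟨fun ⟨j, q, hjq⟩ h => hjq ?_, fun h => ⟨i, p, h⟩⟩
  have hfactor : j ∘ₗ q = (j ∘ₗ p) * (i ∘ₗ p) * (i ∘ₗ q) := by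
    ext x
    simp [← LinearMap.comp_apply p i, hpi]
  rw [hfactor, map_mul, map_mul, h, mul_zero, zero_mul]

theorem detects_iff_of_isCompl {P Q : Submodule R M} (h : IsCompl P Q) :
    Detects χ P ↔ χ (P.projection Q h) ≠ 0 :=
  detects_iff_of_comp_eq_id (Submodule.projectionOnto_comp_subtype h)

theorem Detects.of_isSummand (hN : Detects χ N) (h : IsSummand R N X) : Detects χ X := by
  obtain ⟨i, p, hip⟩ := hN
  obtain ⟨s, t, hts⟩ := h.exists_comp_eq_id
  refine ⟨i ∘ₗ t, s ∘ₗ p, ?_⟩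
  rwa [LinearMap.comp_assoc, ← LinearMap.comp_assoc p s t, hts, LinearMap.id_comp]

variable [IsDomain D]

theorem Indecomposable.bijective_comp_of_map_ne_zero [IsNoetherian R N] [IsArtinian R N]
    (hN : Indecomposable R N) {f : N →ₗ[R] M} {g : M →ₗ[R] N} (h : χ (f ∘ₗ g) ≠ 0) :
    Function.Bijective (g ∘ₗ f) := by
  refine hN.bijective_of_not_isNilpotent ?_
  rintro ⟨n, hn⟩
  have pow_comp (n : ℕ) :
      (f ∘ₗ g : Module.End R M) ^ (n + 1) = f ∘ₗ ((g ∘ₗ f : Module.End R N) ^ n) ∘ₗ g := by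
    induction n with
    | zero => rw [zero_add, pow_one, pow_zero]; rfl
    | succ n ih => rw [pow_succ, ih, pow_succ]; rfl
  refine pow_ne_zero (n + 1) h ?_
  rw [← map_pow, pow_comp, hn, LinearMap.zero_comp, LinearMap.comp_zero, map_zero]

theorem Detects.isSummand [IsNoetherian R N] [IsArtinian R N] (hN : Indecomposable R N)
    (hd : Detects χ N) (hX : Detects χ X) : IsSummand R N X := by
  obtain ⟨i, p, hip⟩ := hd
  obtain ⟨j, q, hjq⟩ := hX
  refine isSummand_of_bijective (f := q ∘ₗ i) (g := p ∘ₗ j)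
    (hN.bijective_comp_of_map_ne_zero (χ := χ) (f := i) (g := (p ∘ₗ j) ∘ₗ q) ?_)
  have : i ∘ₗ (p ∘ₗ j) ∘ₗ q = (i ∘ₗ p) * (j ∘ₗ q) := rfl
  rw [this, map_mul]
  exact mul_ne_zero hip hjq

theorem Detects.nonempty_linearEquiv [IsNoetherian R N] [IsArtinian R N]
    (hN : Indecomposable R N) (hN' : Indecomposable R N') (h : Detects χ N) (h' : Detects χ N') :
    Nonempty (N ≃ₗ[R] N') :=
  have := hN.1
  hN'.nonempty_linearEquiv_of_isSummand (h.isSummand hN h')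

theorem existsUnique_detects {ι : Type*} [Finite ι] [DecidableEq ι] {P : ι → Submodule R M}
    (hP : DirectSum.IsInternal P) : ∃! i, Detects χ (P i) := by
  have := Fintype.ofFinite ι
  simp only [detects_iff_of_comp_eq_id (summandProj_comp_subtype hP _)]
  have hsum : ∑ i, χ ((P i).subtype ∘ₗ summandProj hP i) = 1 := by
    rw [← map_sum, sum_subtype_comp_summandProj]
    exact map_one χ
  obtain ⟨i, -, hi⟩ := Finset.exists_ne_zero_of_sum_ne_zero (hsum.trans_ne one_ne_zero)
  refine ⟨i, hi, fun j hj => by_contra fun hij => mul_ne_zero hi hj ?_⟩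
  have : ((P i).subtype ∘ₗ summandProj hP i) * ((P j).subtype ∘ₗ summandProj hP j) =
      (P i).subtype ∘ₗ (summandProj hP i ∘ₗ (P j).subtype) ∘ₗ summandProj hP j := rfl
  rw [← map_mul, this, summandProj_comp_subtype_of_ne hP (Ne.symm hij), LinearMap.zero_comp,
    LinearMap.comp_zero, map_zero]

variable (χ) in
theorem exists_indecomposable_isCompl_detects [IsArtinian R M] :
    ∃ N : Submodule R M, Indecomposable R N ∧ (∃ P, IsCompl N P) ∧ Detects χ N := by
  obtain ⟨k, P, hP, hPi⟩ := exists_isDecomposition R M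
  obtain ⟨i, hi, -⟩ := existsUnique_detects (χ := χ) hP
  have hproj (x : P i) : summandProj hP i x = x :=
    LinearMap.congr_fun (summandProj_comp_subtype hP i) x
  exact ⟨P i, hPi i, ⟨_, LinearMap.isCompl_of_proj hproj⟩, hi⟩

theorem Indecomposable.occursOnce_of_detects [IsArtinian R M] [IsNoetherian R N] [IsArtinian R N]
    (hN : Indecomposable R N) (hd : Detects χ N) : OccursOnce R N M := by
  refine ⟨exists_isDecomposition R M, fun k P hP => ?_⟩
  obtain ⟨i, hi, huniq⟩ := existsUnique_detects (χ := χ) hP.1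
  exact ⟨i, hd.nonempty_linearEquiv hN (hP.2 i) hi,
    fun j ⟨e⟩ => huniq j (hd.of_isSummand (isSummand_of_linearEquiv e))⟩

end Detects

/-! ### Polytabloids -/

section Sign

theorem reflect_ne {A : Type} (v : A × ℤˣ) : reflect v ≠ v := fun h =>
  units_ne_neg_self v.2 (congrArg Prod.snd h).symm

theorem eq_or_eq_reflect {A : Type} {v w : A × ℤˣ} (h : w.1 = v.1) : w = v ∨ w = reflect v := by
  by_cases h' : w.2 = v.2
  · exact Or.inl (Prod.ext h h')
  · exact Or.inr (Prod.ext h (eq_neg_of_ne h'))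

namespace Hyp

variable {n : ℕ}

theorem apply_eq (σ : Hyp n) (v : Node n) :
    σ.1 v = ((σ.1 (v.1, 1)).1, (σ.1 (v.1, 1)).2 * v.2) := by
  rcases eq_or_eq_reflect (v := (v.1, 1)) (w := v) rfl with h | h
  · rw [h, mul_one]
  · rw [h, σ.2]
    simp [reflect]

theorem underlying_mul (σ τ : Hyp n) : (σ * τ).underlying = σ.underlying * τ.underlying :=
  Equiv.ext fun i => (congrArg Prod.fst (σ.apply_eq (τ.1 (i, 1))) :)

theorem sgn_mul (σ τ : Hyp n) : (σ * τ).sgn = σ.sgn * τ.sgn := by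
  have hsigns : ∏ i, ((σ * τ).1 (i, 1)).2 = (∏ i, (σ.1 (i, 1)).2) * ∏ i, (τ.1 (i, 1)).2 := by
    rw [← Equiv.prod_comp τ.underlying fun i => (σ.1 (i, 1)).2, ← Finset.prod_mul_distrib]
    exact Finset.prod_congr rfl fun i _ => congrArg Prod.snd (σ.apply_eq (τ.1 (i, 1)))
  rw [sgn, hsigns, underlying_mul, map_mul]
  exact mul_mul_mul_comm _ _ _ _

theorem sgn_one : (1 : Hyp n).sgn = 1 := by
  simpa using sgn_mul (1 : Hyp n) 1

/-- The signed permutation exchanging `v` with `w` and `-v` with `-w`. For `w = -v` this is the sign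
change at `v`. -/
def swap (v w : Node n) : Hyp n :=
  ⟨Equiv.prodShear (Equiv.swap v.1 w.1)
    fun i => Equiv.mulLeft (if i = v.1 ∨ i = w.1 then v.2 * w.2 else 1),
    fun _ => Prod.ext rfl (mul_neg _ _)⟩

theorem swap_apply_left (v w : Node n) : (swap v w).1 v = w :=
  Prod.ext (by simp [swap]) (by simp [swap, mul_left_comm v.2])

theorem swap_apply_right (v w : Node n) : (swap v w).1 w = v :=
  Prod.ext (by simp [swap]) (by simp [swap])

theorem swap_apply_of_ne {v w x : Node n} (hv : x.1 ≠ v.1) (hw : x.1 ≠ w.1) :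
    (swap v w).1 x = x :=
  Prod.ext (Equiv.swap_apply_of_ne_of_ne hv hw) (by simp [swap, hv, hw])

theorem eq_or_eq_reflect_or_ne (v w x : Node n) :
    (x = v ∨ x = reflect v) ∨ (x = w ∨ x = reflect w) ∨ x.1 ≠ v.1 ∧ x.1 ≠ w.1 := by
  by_cases hv : x.1 = v.1
  · exact .inl (eq_or_eq_reflect hv)
  by_cases hw : x.1 = w.1
  · exact .inr (.inl (eq_or_eq_reflect hw))
  · exact .inr (.inr ⟨hv, hw⟩)

theorem swap_mul_self (v w : Node n) : swap v w * swap v w = 1 := by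
  refine Subtype.ext (Equiv.ext fun x => ?_)
  change (swap v w).1 ((swap v w).1 x) = x
  obtain (rfl | rfl) | (rfl | rfl) | ⟨hv, hw⟩ := eq_or_eq_reflect_or_ne v w x
  · rw [swap_apply_left, swap_apply_right]
  · rw [(swap v w).2, (swap v w).2, swap_apply_left, swap_apply_right]
  · rw [swap_apply_right, swap_apply_left]
  · rw [(swap v w).2, (swap v w).2, swap_apply_right, swap_apply_left]
  · rw [swap_apply_of_ne hv hw, swap_apply_of_ne hv hw]

theorem sgn_swap {v w : Node n} (hvw : v ≠ w) : (swap v w).sgn = -1 := by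
  have hu : (swap v w).underlying = Equiv.swap v.1 w.1 := Equiv.ext fun _ => rfl
  have hsigns : ∏ i, ((swap v w).1 (i, 1)).2 = ∏ _i ∈ {v.1, w.1}, v.2 * w.2 := by
    simp only [swap, Equiv.prodShear_apply, Equiv.coe_mulLeft, mul_one]
    rw [Finset.prod_ite, Finset.prod_const_one, mul_one]
    exact Finset.prod_congr (by ext; simp) fun _ _ => rfl
  rw [sgn, hu, hsigns]
  by_cases h : v.1 = w.1
  · obtain rfl := (eq_or_eq_reflect h.symm).resolve_left hvw.symm
    simp [reflect]
  · rw [Finset.prod_pair h, Int.units_mul_self, Equiv.Perm.sign_swap h, one_mul]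

end Hyp

end Sign

section Polytabloids

variable {n : ℕ} {lam mu : BiPartition n}

theorem rowLabel_reflect {x y : lam.Box × ℤˣ} (h : rowLabel x = rowLabel y) :
    rowLabel (reflect x) = rowLabel (reflect y) := by
  rcases x with ⟨x | x, a⟩ <;> rcases y with ⟨y | y, b⟩ <;> simp_all [rowLabel, reflect]

theorem colLabel_reflect {x y : lam.Box × ℤˣ} (h : colLabel x = colLabel y) :
    colLabel (reflect x) = colLabel (reflect y) := by
  rcases x with ⟨x | x, a⟩ <;> rcases y with ⟨y | y, b⟩ <;> simp_all [colLabel, reflect]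

theorem eq_of_rowLabel_eq_of_colLabel_eq {x y : lam.Box × ℤˣ} (hr : rowLabel x = rowLabel y)
    (hc : colLabel x = colLabel y) : x = y := by
  rcases x with ⟨⟨⟨x1, x2⟩, hx⟩ | ⟨⟨x1, x2⟩, hx⟩, a⟩ <;>
    rcases y with ⟨⟨⟨y1, y2⟩, hy⟩ | ⟨⟨y1, y2⟩, hy⟩, b⟩ <;>
    simp_all [rowLabel, colLabel]

namespace BiTableau

theorem symm_reflect (t : BiTableau lam) (v : Node n) :
    t.entry.symm (reflect v) = reflect (t.entry.symm v) := by
  rw [Equiv.symm_apply_eq, t.entry_reflect, Equiv.apply_symm_apply]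

theorem ext_symm {t s : BiTableau lam} (h : ∀ v, t.entry.symm v = s.entry.symm v) : t = s := by
  obtain ⟨t, ht⟩ := t
  obtain ⟨s, hs⟩ := s
  obtain rfl : t = s := Equiv.symm_bijective.injective (Equiv.ext h)
  rfl

/-- The signed permutation which carries `t` to `s`. -/
def diff (t s : BiTableau lam) : Hyp n := ⟨s.entry.symm.trans t.entry, fun v => by
  simp only [Equiv.trans_apply, s.symm_reflect, t.entry_reflect]⟩

theorem symm_diff (t s : BiTableau lam) (v : Node n) :
    t.entry.symm ((t.diff s).1 v) = s.entry.symm v := t.entry.symm_apply_apply _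

theorem act_diff (t s : BiTableau lam) : t.act (t.diff s) = s :=
  ext_symm fun v => t.symm_diff s v

theorem mem_labelGroup_act {A : Type} (t : BiTableau lam) (f : lam.Box × ℤˣ → A) (σ τ : Hyp n) :
    τ ∈ (t.act σ).labelGroup f ↔ σ * τ * σ⁻¹ ∈ t.labelGroup f := by
  refine σ.1.forall_congr fun {v} => ?_
  change f (t.entry.symm (σ.1 (τ.1 v))) = f (t.entry.symm (σ.1 v)) ↔
    f (t.entry.symm (σ.1 (τ.1 (σ.1.symm (σ.1 v))))) = f (t.entry.symm (σ.1 v))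
  rw [Equiv.symm_apply_apply]

theorem swap_mem_labelGroup {A : Type} (t : BiTableau lam) {f : lam.Box × ℤˣ → A}
    (hf : ∀ {x y}, f x = f y → f (reflect x) = f (reflect y)) {v w : Node n}
    (h : f (t.entry.symm v) = f (t.entry.symm w)) : Hyp.swap v w ∈ t.labelGroup f := by
  have hreflect := hf h
  simp only [← t.symm_reflect] at hreflect
  intro x
  obtain (rfl | rfl) | (rfl | rfl) | ⟨hv, hw⟩ := Hyp.eq_or_eq_reflect_or_ne v w x
  · rw [Hyp.swap_apply_left, h]
  · rw [(Hyp.swap _ _).2, Hyp.swap_apply_left, hreflect]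
  · rw [Hyp.swap_apply_right, h]
  · rw [(Hyp.swap _ _).2, Hyp.swap_apply_right, hreflect]
  · rw [Hyp.swap_apply_of_ne hv hw]

end BiTableau

theorem tabloid_eq_iff {t s : BiTableau lam} :
    (Quotient.mk (rowEquiv lam) t : Tabloid lam) = Quotient.mk (rowEquiv lam) s ↔
      ∀ v, rowLabel (t.entry.symm v) = rowLabel (s.entry.symm v) := by
  refine ⟨fun h v => ?_, fun h => Quotient.sound ⟨t.diff s, fun v => ?_, (t.act_diff s).symm⟩⟩
  · obtain ⟨σ, hσ, rfl⟩ := Quotient.exact h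
    exact (hσ v).symm
  · rw [t.symm_diff, h]

variable (K : Type*) [Field K]

theorem tabloidOf_congr {t s : BiTableau lam}
    (h : ∀ v, rowLabel (t.entry.symm v) = rowLabel (s.entry.symm v)) :
    tabloidOf K t = tabloidOf K s :=
  congrArg (fun T : Tabloid lam => (Finsupp.single T 1 : Tabloid lam →₀ K)) (tabloid_eq_iff.2 h)

theorem op_single_smul_tabloidOf (σ : Hyp n) (c : K) (t : BiTableau lam) :
    MulOpposite.op (MonoidAlgebra.single σ c) • tabloidOf K t = c • tabloidOf K (t.act σ) := by
  have haction : PermMod.action K lam (MulOpposite.op (MonoidAlgebra.single σ c)) =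
      c • PermMod.actLin K σ := by
    simp [PermMod.action, MonoidAlgebra.lift_single]
  calc MulOpposite.op (MonoidAlgebra.single σ c) • tabloidOf K t
      = PermMod.action K lam (MulOpposite.op (MonoidAlgebra.single σ c)) (tabloidOf K t) := rfl
    _ = c • tabloidOf K (t.act σ) := by
      rw [haction, LinearMap.smul_apply]
      exact congrArg (c • ·) Finsupp.mapDomain_single

theorem span_range_tabloidOf :
    Submodule.span K (Set.range (tabloidOf K : BiTableau lam → PermMod K lam)) = ⊤ := by
  have hsurj : Function.Surjective (Quotient.mk (rowEquiv lam)) := Quotient.mk_surjective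
  have := (Finsupp.basisSingleOne : Module.Basis (Tabloid lam) K (Tabloid lam →₀ K)).span_eq
  rw [Finsupp.coe_basisSingleOne] at this
  refine Eq.trans (congrArg _ ?_) this
  exact (hsurj.range_comp fun T => (Finsupp.single T 1 : Tabloid lam →₀ K))

variable {K} in
theorem op_smul_mem_of_forall_tabloidOf {a : HypAlg K n} {P : Submodule K (PermMod K lam)}
    (h : ∀ s, MulOpposite.op a • tabloidOf K s ∈ P) (m : PermMod K lam) :
    MulOpposite.op a • m ∈ P := by
  have hspan : Submodule.span K (Set.range (tabloidOf K)) ≤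
      P.comap (Algebra.lsmul K K (PermMod K lam) (MulOpposite.op a)) :=
    Submodule.span_le.2 (Set.range_subset_iff.2 h)
  rw [span_range_tabloidOf] at hspan
  exact hspan (Submodule.mem_top (x := m))

theorem single_mul_colSum {t : BiTableau lam} {σ : Hyp n} (hσ : σ ∈ t.colGroup) :
    MonoidAlgebra.single σ (1 : K) * colSum K t = ((σ.sgn : ℤ) : K) • colSum K t := by
  classical
  rw [colSum, Finset.mul_sum, Finset.smul_sum]
  refine Finset.sum_equiv (Equiv.mulLeft σ) (fun τ => ?_) fun τ _ => ?_
  · simp [t.colGroup.mul_mem_cancel_left hσ]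
  · rw [Equiv.coe_mulLeft, MonoidAlgebra.single_mul_single, one_mul, MonoidAlgebra.smul_single,
      smul_eq_mul, Hyp.sgn_mul, ← Int.cast_mul, ← Units.val_mul, ← mul_assoc, Int.units_mul_self,
      one_mul]

theorem single_mul_colSum_act (t : BiTableau lam) (σ : Hyp n) :
    MonoidAlgebra.single σ (1 : K) * colSum K (t.act σ) =
      colSum K t * MonoidAlgebra.single σ (1 : K) := by
  classical
  rw [colSum, colSum, Finset.mul_sum, Finset.sum_mul]
  refine Finset.sum_equiv (MulAut.conj σ).toEquiv (fun τ => ?_) fun τ _ => ?_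
  · simp only [Finset.mem_filter_univ]
    exact t.mem_labelGroup_act colLabel σ τ
  · have hsgn : (σ * τ * σ⁻¹).sgn = τ.sgn := by
      rw [Hyp.sgn_mul, Hyp.sgn_mul, mul_right_comm, ← Hyp.sgn_mul, mul_inv_cancel, Hyp.sgn_one,
        one_mul]
    simp [MonoidAlgebra.single_mul_single, hsgn]

theorem op_single_smul_polytabloid (t : BiTableau lam) (σ : Hyp n) :
    MulOpposite.op (MonoidAlgebra.single σ (1 : K)) • polytabloid K t =
      polytabloid K (t.act σ) := by
  rw [polytabloid, smul_smul, ← MulOpposite.op_mul, ← single_mul_colSum_act, MulOpposite.op_mul,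
    ← smul_smul, op_single_smul_tabloidOf, one_smul, polytabloid]

theorem op_colSum_smul_tabloidOf_act {t : BiTableau lam} {σ : Hyp n} (hσ : σ ∈ t.colGroup) :
    MulOpposite.op (colSum K t) • tabloidOf K (t.act σ) = ((σ.sgn : ℤ) : K) • polytabloid K t := by
  rw [← one_smul K (tabloidOf K _), ← op_single_smul_tabloidOf, smul_smul, ← MulOpposite.op_mul,
    single_mul_colSum K hσ, MulOpposite.op_smul, smul_assoc, polytabloid]

theorem specht_le {t : BiTableau lam} {Y : Submodule (HypAlg K n)ᵐᵒᵖ (PermMod K lam)}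
    (h : polytabloid K t ∈ Y) : specht K lam ≤ Y := by
  refine Submodule.span_le.2 (Set.range_subset_iff.2 fun s => ?_)
  rw [← t.act_diff s, ← op_single_smul_polytabloid]
  exact Y.smul_mem _ h

open Classical in
theorem op_colSum_smul_tabloidOf (t : BiTableau lam) (s : BiTableau mu) :
    MulOpposite.op (colSum K t) • tabloidOf K s =
      ∑ σ with σ ∈ t.colGroup, ((σ.sgn : ℤ) : K) • tabloidOf K (s.act σ) := by
  rw [colSum, Finset.op_sum, Finset.sum_smul]
  simp only [op_single_smul_tabloidOf]

-- An involution is used instead of `x = -x` because the characteristic may be two.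
theorem op_colSum_smul_tabloidOf_eq_zero {t : BiTableau lam} {s : BiTableau mu} {τ : Hyp n}
    (hc : τ ∈ t.colGroup) (hr : τ ∈ s.rowGroup) (hsgn : τ.sgn = -1) (hτ : τ * τ = 1) :
    MulOpposite.op (colSum K t) • tabloidOf K s = 0 := by
  classical
  rw [op_colSum_smul_tabloidOf]
  refine Finset.sum_involution (fun σ _ => τ * σ) (fun σ _ => ?_) (fun σ _ _ h => ?_)
    (fun σ hσ => ?_) fun σ _ => by rw [← mul_assoc, hτ, one_mul]
  · rw [tabloidOf_congr K (t := s.act (τ * σ)) (s := s.act σ) fun v => hr (σ.1 v), Hyp.sgn_mul,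
      hsgn, ← add_smul]
    simp
  · rw [mul_eq_right.1 h, Hyp.sgn_one] at hsgn
    exact absurd hsgn (by decide)
  · simp only [Finset.mem_filter, Finset.mem_univ, true_and] at hσ ⊢
    exact mul_mem hc hσ

/-- The coefficient of `{t}` in an element of the permutation module. -/
def coeff (t : BiTableau lam) : PermMod K lam →ₗ[K] K :=
  Finsupp.lapply (Quotient.mk (rowEquiv lam) t : Tabloid lam)

theorem coeff_tabloidOf_self (t : BiTableau lam) : coeff K t (tabloidOf K t) = 1 :=
  Finsupp.single_eq_same

theorem coeff_tabloidOf_of_ne {t s : BiTableau lam}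
    (h : (Quotient.mk (rowEquiv lam) s : Tabloid lam) ≠ Quotient.mk _ t) :
    coeff K t (tabloidOf K s) = 0 :=
  Finsupp.single_eq_of_ne' h

theorem coeff_polytabloid (t : BiTableau lam) : coeff K t (polytabloid K t) = 1 := by
  classical
  have hne (σ) (hσ : σ ∈ t.colGroup) (h1 : σ ≠ 1) :
      (Quotient.mk (rowEquiv lam) (t.act σ) : Tabloid lam) ≠ Quotient.mk _ t := fun e =>
    h1 (Subtype.ext (Equiv.ext fun v => t.entry.symm.injective
      (eq_of_rowLabel_eq_of_colLabel_eq (tabloid_eq_iff.1 e v) (hσ v))))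
  rw [polytabloid, op_colSum_smul_tabloidOf, map_sum, Finset.sum_eq_single 1]
  · rw [map_smul, BiTableau.act_one, coeff_tabloidOf_self, Hyp.sgn_one]
    simp
  · intro σ hσ h1
    rw [map_smul, coeff_tabloidOf_of_ne K (hne σ (by simpa using hσ) h1), smul_zero]
  · intro h1
    simp [one_mem] at h1

end Polytabloids

/-! ### Dominance -/

section Counting

open Finset

theorem card_filter_fst_lt (D : YoungDiagram) (j : ℕ) :
    #{x ∈ D.cells | x.1 < j} = ∑ i ∈ range j, D.rowLen i := by
  rw [card_eq_sum_card_fiberwise (f := Prod.fst) (t := range j) fun x hx => by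
    simpa using (mem_filter.1 hx).2]
  refine sum_congr rfl fun i hi => ?_
  rw [YoungDiagram.rowLen_eq_card, YoungDiagram.row, filter_filter]
  refine congrArg card (filter_congr fun x _ => and_iff_right_of_imp ?_)
  rintro rfl
  exact mem_range.1 hi

theorem card_filter_fst_lt_snd_eq (D : YoungDiagram) (j c : ℕ) :
    #{x ∈ {x ∈ D.cells | x.1 < j} | x.2 = c} = min j (D.colLen c) := by
  have himage : {x ∈ {x ∈ D.cells | x.1 < j} | x.2 = c} =
      (range (min j (D.colLen c))).image (·, c) := by
    ext ⟨a, b⟩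
    simp only [mem_filter, YoungDiagram.mem_cells, mem_image, mem_range, lt_min_iff, Prod.mk.injEq,
      YoungDiagram.mem_iff_lt_colLen]
    exact ⟨fun ⟨⟨ha, haj⟩, hb⟩ => ⟨a, ⟨haj, hb ▸ ha⟩, rfl, hb.symm⟩,
      fun ⟨i, ⟨hij, hi⟩, ha, hb⟩ => ha ▸ hb ▸ ⟨⟨hi, hij⟩, rfl⟩⟩
  rw [himage, card_image_of_injective _ (Prod.mk_left_injective c), card_range]

variable {T : Finset (ℕ × ℕ)} {D : YoungDiagram}

theorem card_filter_fst_lt_snd_eq_le {c : ℕ} (hT : #{x ∈ T | x.2 = c} ≤ D.colLen c) (j : ℕ) :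
    #{x ∈ {x ∈ T | x.1 < j} | x.2 = c} ≤ #{x ∈ {x ∈ D.cells | x.1 < j} | x.2 = c} := by
  rw [card_filter_fst_lt_snd_eq]
  refine le_min ?_ ((card_le_card (filter_subset_filter _ (filter_subset _ _))).trans hT)
  refine (card_le_card_of_injOn Prod.fst (t := range j) ?_ ?_).trans_eq (card_range j)
  · intro x hx
    simp only [coe_filter, mem_filter, Set.mem_ofPred_eq] at hx
    simpa using hx.1.2
  · intro x hx y hy h
    simp only [coe_filter, mem_filter, Set.mem_ofPred_eq] at hx hy
    exact Prod.ext h (hx.2.trans hy.2.symm)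

theorem card_filter_fst_lt_eq_sum {S : Finset (ℕ × ℕ)} {C : Finset ℕ} (hS : ∀ x ∈ S, x.2 ∈ C)
    (j : ℕ) : #{x ∈ S | x.1 < j} = ∑ c ∈ C, #{x ∈ {x ∈ S | x.1 < j} | x.2 = c} :=
  card_eq_sum_card_fiberwise fun x hx => hS x (mem_filter.1 hx).1

theorem card_filter_fst_lt_le (hT : ∀ c, #{x ∈ T | x.2 = c} ≤ D.colLen c) (j : ℕ) :
    #{x ∈ T | x.1 < j} ≤ ∑ i ∈ range j, D.rowLen i := by
  have hC (x) (hx : x ∈ T ∪ D.cells) : x.2 ∈ (T ∪ D.cells).image Prod.snd :=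
    mem_image_of_mem _ hx
  rw [← card_filter_fst_lt, card_filter_fst_lt_eq_sum fun x hx => hC x (mem_union_left _ hx),
    card_filter_fst_lt_eq_sum fun x hx => hC x (mem_union_right _ hx)]
  exact sum_le_sum fun c _ => card_filter_fst_lt_snd_eq_le (hT c) j

theorem subset_cells_of_le_card_filter_fst_lt (hT : ∀ c, #{x ∈ T | x.2 = c} ≤ D.colLen c)
    (hrow : ∀ j, ∑ i ∈ range j, D.rowLen i ≤ #{x ∈ T | x.1 < j}) : T ⊆ D.cells := by
  intro x hx
  have hC (y) (hy : y ∈ T ∪ D.cells) : y.2 ∈ (T ∪ D.cells).image Prod.snd :=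
    mem_image_of_mem _ hy
  have hsum := (card_filter_fst_lt_le hT (D.colLen x.2)).antisymm (hrow _)
  rw [← card_filter_fst_lt, card_filter_fst_lt_eq_sum fun x hx => hC x (mem_union_left _ hx),
    card_filter_fst_lt_eq_sum fun x hx => hC x (mem_union_right _ hx),
    sum_eq_sum_iff_of_le fun c _ => card_filter_fst_lt_snd_eq_le (hT c) _] at hsum
  have hcol := hsum x.2 (hC x (mem_union_left _ hx))
  rw [card_filter_fst_lt_snd_eq, min_self] at hcol
  have hfilter := eq_of_subset_of_card_le
    (filter_subset_filter (·.2 = x.2) (filter_subset (·.1 < D.colLen x.2) T))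
    ((hT x.2).trans_eq hcol.symm)
  have hxj : x ∈ {y ∈ {y ∈ T | y.1 < D.colLen x.2} | y.2 = x.2} :=
    hfilter ▸ mem_filter.2 ⟨hx, rfl⟩
  exact YoungDiagram.mem_iff_lt_colLen.2 (mem_filter.1 (mem_filter.1 hxj).1).2

theorem ext_of_sum_rowLen {D E : YoungDiagram}
    (h : ∀ j, ∑ i ∈ range j, D.rowLen i = ∑ i ∈ range j, E.rowLen i) : D = E := by
  have hrow (i : ℕ) : D.rowLen i = E.rowLen i := by
    simpa [sum_range_succ, h i] using h (i + 1)
  ext ⟨i, j⟩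
  rw [YoungDiagram.mem_cells, YoungDiagram.mem_cells, YoungDiagram.mem_iff_lt_rowLen,
    YoungDiagram.mem_iff_lt_rowLen, hrow]

end Counting

section Dominance

open Finset

variable {n : ℕ} {lam mu : BiPartition n}

theorem BiPartition.Dominates.antisymm (h : lam.Dominates mu) (h' : mu.Dominates lam) :
    lam = mu := by
  have hsnd : lam.snd = mu.snd := ext_of_sum_rowLen fun j => (h'.1 j).antisymm (h.1 j)
  have hfst (j : ℕ) :=
    (Nat.add_left_cancel_iff.1 (hsnd ▸ (h'.2 j).antisymm (h.2 j)) :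
      ∑ i ∈ range j, lam.fst.rowLen i = ∑ i ∈ range j, mu.fst.rowLen i)
  exact BiPartition.ext (ext_of_sum_rowLen hfst) hsnd

theorem nonempty_biTableau (lam : BiPartition n) : Nonempty (BiTableau lam) := by
  have hcard : Fintype.card lam.Box = n := by
    simpa using lam.card_add
  exact ⟨⟨Equiv.prodCongr (Fintype.equivFinOfCardEq hcard) (Equiv.refl _), fun _ => rfl⟩⟩

/-- The row of a box within its diagram. -/
def boxRow : lam.Box → ℕ := Sum.elim (·.1.1) (·.1.1)

/-- The column of a box within its diagram. -/
def boxCol : lam.Box → ℕ := Sum.elim (·.1.2) (·.1.2)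

/-- The box of a bi-tableau that contains `i` up to sign. -/
def BiTableau.box (t : BiTableau lam) (i : Fin n) : lam.Box := (t.entry.symm (i, 1)).1

theorem BiTableau.box_fst (t : BiTableau lam) (v : Node n) :
    t.box v.1 = (t.entry.symm v).1 := by
  rcases eq_or_eq_reflect (v := (v.1, 1)) (w := v) rfl with h | h
  · rw [h, box]
  · rw [h, t.symm_reflect]
    rfl

theorem BiTableau.box_bijective (t : BiTableau lam) : Function.Bijective t.box := by
  refine ⟨fun i j h => ?_, fun b => ⟨(t.entry (b, 1)).1, ?_⟩⟩
  · rcases eq_or_eq_reflect h with h' | h'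
    · exact congrArg Prod.fst (t.entry.symm.injective h')
    · rw [← t.symm_reflect] at h'
      exact (congrArg Prod.fst (t.entry.symm.injective h') :)
  · rw [t.box_fst, Equiv.symm_apply_apply]

theorem BiTableau.card_filter_box (t : BiTableau lam) (P : lam.Box → Prop) [DecidablePred P]
    (p q : ℕ × ℕ → Prop) [DecidablePred p] [DecidablePred q] (hp : ∀ c, P (.inl c) ↔ p c.1)
    (hq : ∀ c, P (.inr c) ↔ q c.1) :
    #{i | P (t.box i)} = #{x ∈ lam.fst.cells | p x} + #{x ∈ lam.snd.cells | q x} := by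
  have hcells (D : YoungDiagram) (p : ℕ × ℕ → Prop) [DecidablePred p] :
      ∑ c : D.cells, (if p c then 1 else 0) = #{x ∈ D.cells | p x} := by
    rw [card_filter, sum_coe_sort D.cells fun x => if p x then 1 else 0]
  rw [card_bijective t.box t.box_bijective (t := {b | P b}) (by simp), card_filter,
    Fintype.sum_sum_type]
  simp only [hp, hq, hcells]

theorem card_filter_isRight_boxRow_lt (s : BiTableau mu) (j : ℕ) :
    #{i | (s.box i).isRight ∧ boxRow (s.box i) < j} = ∑ i ∈ range j, mu.snd.rowLen i := by
  rw [s.card_filter_box (fun b => b.isRight ∧ boxRow b < j) (fun _ => False) (·.1 < j)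
    (by simp) (by simp [boxRow]), card_filter_fst_lt]
  simp

theorem card_filter_isLeft_boxRow_lt (s : BiTableau mu) (j : ℕ) :
    #{i | (s.box i).isLeft ∧ boxRow (s.box i) < j} = ∑ i ∈ range j, mu.fst.rowLen i := by
  rw [s.card_filter_box (fun b => b.isLeft ∧ boxRow b < j) (·.1 < j) (fun _ => False)
    (by simp [boxRow]) (by simp), card_filter_fst_lt]
  simp

theorem card_filter_isRight (s : BiTableau mu) :
    #{i | (s.box i).isRight} = mu.snd.card := by
  rw [s.card_filter_box (fun b => b.isRight) (fun _ => False) (fun _ => True) (by simp) (by simp)]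
  simp

theorem card_filter_isRight_boxCol_eq (t : BiTableau lam) (c : ℕ) :
    #{i | (t.box i).isRight ∧ boxCol (t.box i) = c} = lam.snd.colLen c := by
  rw [t.card_filter_box (fun b => b.isRight ∧ boxCol b = c) (fun _ => False) (·.2 = c)
    (by simp) (by simp [boxCol]), YoungDiagram.colLen_eq_card, YoungDiagram.col]
  simp

theorem card_filter_isLeft_boxCol_eq (t : BiTableau lam) (c : ℕ) :
    #{i | (t.box i).isLeft ∧ boxCol (t.box i) = c} = lam.fst.colLen c := by
  rw [t.card_filter_box (fun b => b.isLeft ∧ boxCol b = c) (·.2 = c) (fun _ => False)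
    (by simp [boxCol]) (by simp), YoungDiagram.colLen_eq_card, YoungDiagram.col]
  simp

theorem BiTableau.fst_entry_box (t : BiTableau lam) (i : Fin n) (a : ℤˣ) :
    (t.entry (t.box i, a)).1 = i :=
  t.box_bijective.1 (by rw [t.box_fst, Equiv.symm_apply_apply])

theorem rowLabel_eq_of_isRight {x y : lam.Box × ℤˣ} (hx : x.1.isRight) (hy : y.1.isRight)
    (h : boxRow x.1 = boxRow y.1) : rowLabel x = rowLabel y := by
  rcases x with ⟨x | x, a⟩ <;> rcases y with ⟨y | y, b⟩ <;> simp_all [boxRow, rowLabel]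

theorem rowLabel_eq_of_isLeft {b b' : lam.Box} (hb : b.isLeft) (hb' : b'.isLeft)
    (h : boxRow b = boxRow b') (a : ℤˣ) : rowLabel (b, a) = rowLabel (b', a) := by
  rcases b with b | b <;> rcases b' with b' | b' <;> simp_all [boxRow, rowLabel]

theorem colLabel_eq_of_isRight {b b' : lam.Box} (hb : b.isRight) (hb' : b'.isRight)
    (h : boxCol b = boxCol b') (a : ℤˣ) : colLabel (b, a) = colLabel (b', a) := by
  rcases b with b | b <;> rcases b' with b' | b' <;> simp_all [boxCol, colLabel]

theorem colLabel_eq_of_isLeft {x y : lam.Box × ℤˣ} (hx : x.1.isLeft) (hy : y.1.isLeft)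
    (h : boxCol x.1 = boxCol y.1) : colLabel x = colLabel y := by
  rcases x with ⟨x | x, a⟩ <;> rcases y with ⟨y | y, b⟩ <;> simp_all [boxCol, colLabel]

/-- The row of `i` in `s` paired with the column of `i` in `t`. -/
def position (t : BiTableau lam) (s : BiTableau mu) (i : Fin n) : ℕ × ℕ :=
  (boxRow (s.box i), boxCol (t.box i))

/-- Two entries in the same row of `s` are in different columns of `t`. Here rows and columns are
taken together with the signs that the row and column groups preserve. -/
def Transverse (t : BiTableau lam) (s : BiTableau mu) : Prop :=
  ∀ v w, rowLabel (s.entry.symm v) = rowLabel (s.entry.symm w) →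
    colLabel (t.entry.symm v) = colLabel (t.entry.symm w) → v = w

namespace Transverse

variable {t : BiTableau lam} {s : BiTableau mu} (h : Transverse t s)

include h

theorem isRight {i : Fin n} (hi : (s.box i).isRight) : (t.box i).isRight := by
  by_contra hc
  refine reflect_ne (i, 1) (h _ _ ?_ ?_)
  · rw [s.symm_reflect]
    revert hi
    rw [BiTableau.box]
    rcases s.entry.symm (i, 1) with ⟨x | x, a⟩ <;> simp [rowLabel, reflect]
  · rw [t.symm_reflect]
    revert hc
    rw [BiTableau.box]
    rcases t.entry.symm (i, 1) with ⟨x | x, a⟩ <;> simp [colLabel, reflect]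

theorem isLeft {i : Fin n} (hi : (t.box i).isLeft) : (s.box i).isLeft := by
  rw [← Sum.not_isRight] at hi ⊢
  exact mt h.isRight hi

theorem injOn_isRight : Set.InjOn (position t s) {i | (s.box i).isRight} := by
  intro i hi j hj hij
  have hlabels := h (t.entry (t.box i, 1)) (t.entry (t.box j, 1))
    (rowLabel_eq_of_isRight (by rwa [← s.box_fst, t.fst_entry_box])
      (by rwa [← s.box_fst, t.fst_entry_box])
      (by simpa only [position, ← s.box_fst, t.fst_entry_box] using congrArg Prod.fst hij))
    (by
      simpa only [Equiv.symm_apply_apply] using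
        colLabel_eq_of_isRight (h.isRight hi) (h.isRight hj) (congrArg Prod.snd hij) 1)
  rw [← t.fst_entry_box i 1, hlabels, t.fst_entry_box]

theorem injOn_isLeft : Set.InjOn (position t s) {i | (t.box i).isLeft} := by
  intro i hi j hj hij
  have hlabels := h (s.entry (s.box i, 1)) (s.entry (s.box j, 1))
    (by
      simpa only [Equiv.symm_apply_apply] using
        rowLabel_eq_of_isLeft (h.isLeft hi) (h.isLeft hj) (congrArg Prod.fst hij) 1)
    (colLabel_eq_of_isLeft (by rwa [← t.box_fst, s.fst_entry_box])
      (by rwa [← t.box_fst, s.fst_entry_box])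
      (by simpa only [position, ← t.box_fst, s.fst_entry_box] using congrArg Prod.snd hij))
  rw [← s.fst_entry_box i 1, hlabels, s.fst_entry_box]

/-- The positions of the entries in the second diagram of `s`. -/
def rightPositions (t : BiTableau lam) (s : BiTableau mu) : Finset (ℕ × ℕ) :=
  ({i | (s.box i).isRight} : Finset (Fin n)).image (position t s)

/-- The positions of the entries in the first diagram of `t`. -/
def leftPositions (t : BiTableau lam) (s : BiTableau mu) : Finset (ℕ × ℕ) :=
  ({i | (t.box i).isLeft} : Finset (Fin n)).image (position t s)

theorem card_rightPositions_snd_eq_le (c : ℕ) :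
    #{x ∈ rightPositions t s | x.2 = c} ≤ lam.snd.colLen c := by
  rw [rightPositions, filter_image, filter_filter, ← card_filter_isRight_boxCol_eq t]
  exact card_image_le.trans (card_le_card fun i hi => by
    rw [mem_filter] at hi ⊢
    exact ⟨hi.1, h.isRight hi.2.1, hi.2.2⟩)

omit h in
theorem card_leftPositions_snd_eq_le (t : BiTableau lam) (s : BiTableau mu) (c : ℕ) :
    #{x ∈ leftPositions t s | x.2 = c} ≤ lam.fst.colLen c := by
  rw [leftPositions, filter_image, filter_filter, ← card_filter_isLeft_boxCol_eq t]
  exact card_image_le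

theorem card_rightPositions_fst_lt (j : ℕ) :
    #{x ∈ rightPositions t s | x.1 < j} = ∑ i ∈ range j, mu.snd.rowLen i := by
  rw [rightPositions, filter_image,
    card_image_of_injOn (h.injOn_isRight.mono (by simp +contextual)), filter_filter,
    ← card_filter_isRight_boxRow_lt s]
  rfl

theorem card_leftPositions_fst_lt (j : ℕ) :
    #{x ∈ leftPositions t s | x.1 < j} = #{i | (t.box i).isLeft ∧ boxRow (s.box i) < j} := by
  rw [leftPositions, filter_image, card_image_of_injOn (h.injOn_isLeft.mono (by simp +contextual)),
    filter_filter]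
  rfl

theorem card_add_sum_rowLen_le (j : ℕ) :
    mu.snd.card + ∑ i ∈ range j, mu.fst.rowLen i ≤
      lam.snd.card + #{x ∈ leftPositions t s | x.1 < j} := by
  have hdisjoint : Disjoint ({i | (s.box i).isRight} : Finset (Fin n))
      ({i | (s.box i).isLeft ∧ boxRow (s.box i) < j} : Finset (Fin n)) :=
    disjoint_filter.2 fun i _ hright hleft => Sum.not_isLeft.2 hright hleft.1
  rw [h.card_leftPositions_fst_lt, ← card_filter_isRight s, ← card_filter_isLeft_boxRow_lt s,
    ← card_filter_isRight t, ← card_union_of_disjoint hdisjoint]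
  refine (card_le_card fun i hi => ?_).trans (card_union_le _ _)
  simp only [mem_union, mem_filter_univ] at hi ⊢
  rcases hi with hi | hi
  · exact .inl (h.isRight hi)
  · by_cases ht : (t.box i).isRight
    · exact .inl ht
    · exact .inr ⟨Sum.not_isRight.1 ht, hi.2⟩

theorem dominates : lam.Dominates mu := by
  refine ⟨fun j => ?_, fun j => (h.card_add_sum_rowLen_le j).trans ?_⟩
  · exact (h.card_rightPositions_fst_lt j).symm.trans_le
      (card_filter_fst_lt_le h.card_rightPositions_snd_eq_le j)
  · exact Nat.add_le_add_left
      (card_filter_fst_lt_le (card_leftPositions_snd_eq_le t s) j) _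

end Transverse

namespace Transverse

variable {t s : BiTableau lam} (h : Transverse t s)

include h

theorem rightPositions_subset : rightPositions t s ⊆ lam.snd.cells :=
  subset_cells_of_le_card_filter_fst_lt h.card_rightPositions_snd_eq_le
    fun j => (h.card_rightPositions_fst_lt j).ge

theorem leftPositions_subset : leftPositions t s ⊆ lam.fst.cells :=
  subset_cells_of_le_card_filter_fst_lt (card_leftPositions_snd_eq_le t s)
    fun j => Nat.le_of_add_le_add_left (h.card_add_sum_rowLen_le j)

theorem isRight_iff {i : Fin n} : (s.box i).isRight ↔ (t.box i).isRight := by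
  have hfilter : ({i | (s.box i).isRight} : Finset (Fin n)) =
      ({i | (t.box i).isRight} : Finset (Fin n)) :=
    eq_of_subset_of_card_le (monotone_filter_right _ fun _ _ => h.isRight)
      (by rw [card_filter_isRight, card_filter_isRight])
  simpa using Finset.ext_iff.1 hfilter i

theorem exists_rowLabel_eq_colLabel_eq (v : Node n) :
    ∃ x : lam.Box × ℤˣ, rowLabel x = rowLabel (s.entry.symm v) ∧
      colLabel x = colLabel (t.entry.symm v) := by
  have hright (hv : (s.box v.1).isRight) : position t s v.1 ∈ lam.snd.cells :=
    h.rightPositions_subset (mem_image_of_mem _ (mem_filter_univ v.1 |>.2 hv))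
  have hleft (hv : (t.box v.1).isLeft) : position t s v.1 ∈ lam.fst.cells :=
    h.leftPositions_subset (mem_image_of_mem _ (mem_filter_univ v.1 |>.2 hv))
  have hiff := h.isRight_iff (i := v.1)
  rw [position, s.box_fst, t.box_fst] at hright hleft
  rw [s.box_fst, t.box_fst] at hiff
  rcases hs : s.entry.symm v with ⟨x | x, a⟩ <;> rcases ht : t.entry.symm v with ⟨y | y, b⟩ <;>
    rw [hs, ht] at hright hleft hiff
  · exact ⟨(.inl ⟨(x.1.1, y.1.2), hleft rfl⟩, a), rfl, rfl⟩
  · exact (Bool.false_ne_true (hiff.2 rfl)).elim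
  · exact (Bool.false_ne_true (hiff.1 rfl)).elim
  · exact ⟨(.inr ⟨(x.1.1, y.1.2), hright rfl⟩, b), rfl, rfl⟩

theorem exists_biTableau : ∃ u : BiTableau lam, ∀ v,
    rowLabel (u.entry.symm v) = rowLabel (s.entry.symm v) ∧
      colLabel (u.entry.symm v) = colLabel (t.entry.symm v) := by
  choose f hrow hcol using h.exists_rowLabel_eq_colLabel_eq
  have hinj : Function.Injective f := fun v w e =>
    h v w (by rw [← hrow, ← hrow, e]) (by rw [← hcol, ← hcol, e])
  have hbij : Function.Bijective f :=
    hinj.bijective_of_nat_card_le (Nat.card_congr t.entry).le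
  have hreflect (v : Node n) : f (reflect v) = reflect (f v) := by
    refine eq_of_rowLabel_eq_of_colLabel_eq ?_ ?_
    · rw [hrow, s.symm_reflect, rowLabel_reflect (hrow v)]
    · rw [hcol, t.symm_reflect, colLabel_reflect (hcol v)]
  let f' := Equiv.ofBijective f hbij
  exact ⟨⟨f'.symm, fun x => by
    rw [Equiv.symm_apply_eq]
    exact ((hreflect _).trans (congrArg reflect (f'.apply_symm_apply x))).symm⟩,
    fun v => ⟨hrow v, hcol v⟩⟩

theorem exists_colGroup : ∃ σ ∈ t.colGroup, ∀ v,
    rowLabel (s.entry.symm v) = rowLabel ((t.act σ).entry.symm v) := by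
  obtain ⟨u, hu⟩ := h.exists_biTableau
  refine ⟨t.diff u, fun v => ?_, fun v => ?_⟩
  · rw [t.symm_diff, (hu v).2]
  · rw [t.act_diff, (hu v).1]

end Transverse

variable {K : Type*} [Field K]

theorem transverse_of_op_colSum_smul_ne_zero {t : BiTableau lam} {s : BiTableau mu}
    (h : MulOpposite.op (colSum K t) • tabloidOf K s ≠ 0) : Transverse t s := by
  intro v w hr hc
  by_contra hvw
  have hcol : Hyp.swap v w ∈ t.colGroup := t.swap_mem_labelGroup (f := colLabel) colLabel_reflect hc
  have hrow : Hyp.swap v w ∈ s.rowGroup := s.swap_mem_labelGroup (f := rowLabel) rowLabel_reflect hr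
  exact h (op_colSum_smul_tabloidOf_eq_zero K hcol hrow (Hyp.sgn_swap hvw) (Hyp.swap_mul_self v w))

theorem dominates_of_op_colSum_smul_ne_zero {t : BiTableau lam} {m : PermMod K mu}
    (h : MulOpposite.op (colSum K t) • m ≠ 0) : lam.Dominates mu := by
  by_contra hd
  exact h ((Submodule.mem_bot K).1 (op_smul_mem_of_forall_tabloidOf (fun s => by
    by_contra hs
    exact hd (transverse_of_op_colSum_smul_ne_zero hs).dominates) m))

theorem exists_op_colSum_smul_eq (t : BiTableau lam) (m : PermMod K lam) :
    ∃ c : K, MulOpposite.op (colSum K t) • m = c • polytabloid K t := by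
  suffices hmem : MulOpposite.op (colSum K t) • m ∈ Submodule.span K {polytabloid K t} by
    obtain ⟨c, hc⟩ := Submodule.mem_span_singleton.1 hmem
    exact ⟨c, hc.symm⟩
  refine op_smul_mem_of_forall_tabloidOf (fun s => ?_) m
  by_cases hs : MulOpposite.op (colSum K t) • tabloidOf K s = 0
  · rw [hs]
    exact zero_mem _
  · obtain ⟨σ, hσ, hrow⟩ := (transverse_of_op_colSum_smul_ne_zero hs).exists_colGroup
    rw [tabloidOf_congr K hrow, op_colSum_smul_tabloidOf_act K hσ]
    exact Submodule.smul_mem _ _ (Submodule.mem_span_singleton_self _)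

end Dominance

/-! ### Horizontal edges -/

theorem IsMatching.eq_of_le {A : Type} {s t : Setoid A} (hs : IsMatching s) (ht : IsMatching t)
    (h : s ≤ t) : s = t := by
  refine h.antisymm fun x y hxy => ?_
  by_cases hyx : y = x
  · exact hyx ▸ Setoid.refl' s x
  · obtain ⟨z, ⟨hzx, hxz⟩, -⟩ := hs x
    rwa [(ht x).unique ⟨hyx, hxy⟩ ⟨hzx, h hxz⟩]

theorem card_avoiding {A B C : Type} {R : Setoid B} {f : A → B} (g : C → B)
    (hg : ∀ c c', R (g c) (g c') → c = c') (hfg : ∀ a c, ¬ R (f a) (g c))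
    (hcover : ∀ b, (∃ a, R (f a) b) ∨ ∃ c, R (g c) b) :
    Nat.card (Avoiding R f) = Nat.card C := by
  let F (c : C) : Avoiding R f := ⟨Quotient.mk R (g c), fun a h => hfg a c (Quotient.exact h)⟩
  refine (Nat.card_congr (Equiv.ofBijective F ⟨fun c c' h => ?_, ?_⟩)).symm
  · exact hg c c' (Quotient.exact (congrArg Subtype.val h))
  · rintro ⟨⟨b⟩, hb⟩
    obtain ⟨a, ha⟩ | ⟨c, hc⟩ := hcover b
    · exact (hb a (Quotient.sound ha)).elim
    · exact ⟨c, Subtype.ext (Quotient.sound hc)⟩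

namespace Diagram

variable {r : ℕ} {d e : Diagram r} {k l : ℕ}

/-- The top vertices on horizontal edges. -/
def topArc (d : Diagram r) : Set (Node r) := {v | ∃ u, u ≠ v ∧ d.rel (Sum.inl v) (Sum.inl u)}

/-- The bottom vertices on horizontal edges. -/
def botArc (d : Diagram r) : Set (Node r) := {v | ∃ u, u ≠ v ∧ d.rel (Sum.inr v) (Sum.inr u)}

theorem hasHorizontal_iff : d.HasHorizontal k ↔ 2 * k ≤ d.topArc.ncard := Iff.rfl

theorem eq_of_rel {x y z : Node r ⊕ Node r} (hy : d.rel x y) (hz : d.rel x z) (hyx : y ≠ x)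
    (hzx : z ≠ x) : y = z :=
  (d.matching x).unique ⟨hyx, hy⟩ ⟨hzx, hz⟩

theorem eq_of_rel_inr {v v' w : Node r} (h : d.rel (Sum.inl v) (Sum.inr w))
    (h' : d.rel (Sum.inl v') (Sum.inr w)) : v = v' :=
  Sum.inl_injective (eq_of_rel (d.rel.symm' h) (d.rel.symm' h') Sum.inl_ne_inr Sum.inl_ne_inr)

theorem eq_of_rel_inl {v w w' : Node r} (h : d.rel (Sum.inl v) (Sum.inr w))
    (h' : d.rel (Sum.inl v) (Sum.inr w')) : w = w' :=
  Sum.inr_injective (eq_of_rel h h' Sum.inr_ne_inl Sum.inr_ne_inl)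

theorem exists_rel_inr {v : Node r} (hv : v ∉ d.topArc) :
    ∃ w, d.rel (Sum.inl v) (Sum.inr w) := by
  obtain ⟨u | w, ⟨hne, hrel⟩, -⟩ := d.matching (Sum.inl v)
  · exact (hv ⟨u, fun h => hne (congrArg _ h), hrel⟩).elim
  · exact ⟨w, hrel⟩

theorem exists_rel_inl {w : Node r} (hw : w ∉ d.botArc) :
    ∃ v, d.rel (Sum.inl v) (Sum.inr w) := by
  obtain ⟨v | u, ⟨hne, hrel⟩, -⟩ := d.matching (Sum.inr w)
  · exact ⟨v, d.rel.symm' hrel⟩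
  · exact (hw ⟨u, fun h => hne (congrArg _ h), hrel⟩).elim

theorem notMem_topArc {v w : Node r} (h : d.rel (Sum.inl v) (Sum.inr w)) : v ∉ d.topArc :=
  fun ⟨_, hne, hrel⟩ =>
    Sum.inr_ne_inl (eq_of_rel h hrel Sum.inr_ne_inl fun e => hne (Sum.inl_injective e))

theorem notMem_botArc {v w : Node r} (h : d.rel (Sum.inl v) (Sum.inr w)) : w ∉ d.botArc :=
  fun ⟨_, hne, hrel⟩ => Sum.inl_ne_inr
    (eq_of_rel (d.rel.symm' h) hrel Sum.inl_ne_inr fun e => hne (Sum.inr_injective e))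

theorem ncard_topArc (d : Diagram r) : d.topArc.ncard = d.botArc.ncard := by
  have hcompl : (d.topArcᶜ).ncard = (d.botArcᶜ).ncard := by
    choose! f hf using fun v (hv : v ∈ d.topArcᶜ) => exists_rel_inr hv
    refine Set.ncard_congr (fun v _ => f v) (fun v hv => notMem_botArc (hf v hv))
      (fun v w hv hw h => eq_of_rel_inr (hf v hv) (h ▸ hf w hw)) fun w hw => ?_
    obtain ⟨v, hv⟩ := exists_rel_inl hw
    exact ⟨v, notMem_topArc hv, eq_of_rel_inl (hf v (notMem_topArc hv)) hv⟩
  have htop := Set.ncard_add_ncard_compl d.topArc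
  have hbot := Set.ncard_add_ncard_compl d.botArc
  omega

theorem HasHorizontal.mul_right (h : d.HasHorizontal k) (e : Diagram r) :
    (d.mul e).HasHorizontal k :=
  h.trans (Set.ncard_le_ncard fun _ ⟨u, hne, hrel⟩ => ⟨u, hne, glue_upper hrel⟩)

theorem HasHorizontal.mul_left (h : e.HasHorizontal k) (d : Diagram r) :
    (d.mul e).HasHorizontal k := by
  rw [hasHorizontal_iff, ncard_topArc] at h ⊢
  exact h.trans (Set.ncard_le_ncard fun _ ⟨u, hne, hrel⟩ => ⟨u, hne, glue_lower hrel⟩)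

theorem ncard_setOf_fst_lt (hl : l ≤ r) : {v : Node r | (v.1 : ℕ) < l}.ncard = 2 * l := by
  have hprod : {v : Node r | (v.1 : ℕ) < l} =
      (({i : Fin r | (i : ℕ) < l} : Finset (Fin r)) ×ˢ (Finset.univ : Finset ℤˣ) :
        Finset (Node r)) := by
    ext v
    simp only [Set.mem_ofPred_eq, Finset.coe_product, Set.mem_prod, Finset.mem_coe,
      Finset.mem_filter, Finset.mem_univ, true_and, and_true]
  rw [hprod, Set.ncard_coe_finset, Finset.card_product, Fin.card_filter_val_lt, min_eq_right hl]
  exact mul_comm _ _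

theorem arcs_rel_inl_reflect {v : Node r} (hv : (v.1 : ℕ) < l) :
    (arcs l).rel (Sum.inl v) (Sum.inl (reflect v)) := by
  change arcLabel l _ = arcLabel l _
  simp [arcLabel, reflect, not_le.2 hv]

theorem arcs_rel_inr_reflect {v : Node r} (hv : (v.1 : ℕ) < l) :
    (arcs l).rel (Sum.inr v) (Sum.inr (reflect v)) := by
  change arcLabel l _ = arcLabel l _
  simp [arcLabel, reflect, not_le.2 hv]

theorem arcs_rel_inl_inr {v : Node r} (hv : l ≤ (v.1 : ℕ)) :
    (arcs l).rel (Sum.inl v) (Sum.inr v) := by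
  change arcLabel l _ = arcLabel l _
  simp [arcLabel, hv]

theorem arcs_rel_le {E : Setoid (Node r ⊕ Node r)}
    (hinl : ∀ v : Node r, (v.1 : ℕ) < l → E (Sum.inl v) (Sum.inl (reflect v)))
    (hinr : ∀ v : Node r, (v.1 : ℕ) < l → E (Sum.inr v) (Sum.inr (reflect v)))
    (hvert : ∀ v : Node r, l ≤ (v.1 : ℕ) → E (Sum.inl v) (Sum.inr v)) : (arcs l).rel ≤ E := by
  have hinl' (v w : Node r) (hvw : v.1 = w.1) (hv : (v.1 : ℕ) < l) :
      E (Sum.inl v) (Sum.inl w) := by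
    obtain rfl | rfl := eq_or_eq_reflect hvw.symm
    exacts [E.refl' _, hinl v hv]
  have hinr' (v w : Node r) (hvw : v.1 = w.1) (hv : (v.1 : ℕ) < l) :
      E (Sum.inr v) (Sum.inr w) := by
    obtain rfl | rfl := eq_or_eq_reflect hvw.symm
    exacts [E.refl' _, hinr v hv]
  rintro (v | v) (w | w) hvw <;> change arcLabel l _ = arcLabel l _ at hvw <;>
    simp only [arcLabel, Sum.elim_inl, Sum.elim_inr] at hvw <;>
    split_ifs at hvw with hv <;>
    simp only [reduceCtorEq, Sum.inl.injEq, Sum.inr.injEq] at hvw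
  · exact hvw ▸ E.refl' _
  · exact hinl' v w hvw (not_le.1 hv)
  · exact hvw ▸ hvert v hv
  · exact hvw ▸ E.symm' (hvert v hv)
  · exact hvw ▸ E.refl' _
  · exact hinr' v w hvw (not_le.1 hv)

theorem mul_ofPerm_rel (d : Diagram r) (σ : Hyp r) :
    (d.mul (ofPerm σ)).rel = d.rel.comap (Sum.map id σ.1) :=
  comp_graphOf_right _ _

theorem topArc_mul_ofPerm (d : Diagram r) (σ : Hyp r) : (d.mul (ofPerm σ)).topArc = d.topArc := by
  rw [topArc, mul_ofPerm_rel]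
  rfl

theorem arcs_mul_ofPerm_eq {σ : Hyp r} (h : (arcs l).rel ≤ d.rel.comap (Sum.map id σ.1.symm)) :
    (arcs l).mul (ofPerm σ) = d := by
  refine Diagram.ext (IsMatching.eq_of_le (Diagram.matching _) d.matching fun x y hxy => ?_)
  rw [mul_ofPerm_rel] at hxy
  have hcomap : d.rel (Sum.map id σ.1.symm (Sum.map id σ.1 x))
      (Sum.map id σ.1.symm (Sum.map id σ.1 y)) := h hxy
  simpa only [Sum.map_map, Equiv.symm_comp_self, Function.id_comp, Sum.map_id_id, id_eq]
    using hcomap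

theorem topArc_arcs : (arcs l : Diagram r).topArc = {v : Node r | (v.1 : ℕ) < l} := by
  ext v
  refine ⟨fun ⟨u, hne, hrel⟩ => ?_, fun hv => ⟨reflect v, reflect_ne v, arcs_rel_inl_reflect hv⟩⟩
  by_contra hv
  exact notMem_topArc (arcs_rel_inl_inr (not_lt.1 hv)) ⟨u, hne, hrel⟩

theorem hasHorizontal_arcs_iff (hl : l ≤ r) : (arcs l : Diagram r).HasHorizontal k ↔ k ≤ l := by
  rw [hasHorizontal_iff, topArc_arcs, ncard_setOf_fst_lt hl, Nat.mul_le_mul_left_iff two_pos]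

theorem hasHorizontal_mul_ofPerm_iff {σ : Hyp r} :
    (d.mul (ofPerm σ)).HasHorizontal k ↔ d.HasHorizontal k := by
  rw [hasHorizontal_iff, topArc_mul_ofPerm, ← hasHorizontal_iff]

theorem arcs_mul_arcs (l : ℕ) : (arcs l : Diagram r).mul (arcs l) = arcs l :=
  (Diagram.ext ((Diagram.matching _).eq_of_le (Diagram.matching _)
    (arcs_rel_le (fun _ hv => glue_upper (arcs_rel_inl_reflect hv))
      (fun _ hv => glue_lower (arcs_rel_inr_reflect hv)) fun v hv =>
        Setoid.trans' (glue (arcs l : Diagram r).rel (arcs l : Diagram r).rel)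
          (glue_upper (p := .inl v) (q := .inr v) (arcs_rel_inl_inr hv))
          (glue_lower (p := .inl v) (q := .inr v) (arcs_rel_inl_inr hv))))).symm

/-- A label on three rows of vertices which separates the closed loops of `arcs l` on top of
`arcs l`. It is `none` off these loops. -/
def loopLabel (l : ℕ) : Node r ⊕ Node r ⊕ Node r → Option (Fin r) :=
  Sum.elim (fun _ => none)
    (Sum.elim (fun v => if l ≤ v.1 then none else some v.1) fun _ => none)

theorem glue_arcs_arcs_le (l : ℕ) :
    glue (arcs l : Diagram r).rel (arcs l : Diagram r).rel ≤ Setoid.ker (loopLabel l) := by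
  have hupper : (arcs l : Diagram r).rel ≤ (Setoid.ker (loopLabel l)).comap upper :=
    arcs_rel_le (fun _ _ => rfl) (fun _ _ => rfl) fun v hv => by
      change loopLabel l _ = loopLabel l _
      simp [upper, loopLabel, hv]
  have hlower : (arcs l : Diagram r).rel ≤ (Setoid.ker (loopLabel l)).comap Sum.inr :=
    arcs_rel_le (fun _ _ => rfl) (fun _ _ => rfl) fun v hv => by
      change loopLabel l _ = loopLabel l _
      simp [loopLabel, hv]
  exact glue_le hupper hlower

theorem loops_arcs (hl : l ≤ r) : loops (arcs l : Diagram r).rel (arcs l : Diagram r).rel = l := by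
  have hlabel {x y} (h : glue (arcs l : Diagram r).rel (arcs l : Diagram r).rel x y) :
      loopLabel l x = loopLabel l y := glue_arcs_arcs_le l h
  rw [loops, card_avoiding fun i : Fin l => .inr (.inl (Fin.castLE hl i, 1)), Nat.card_fin]
  · intro i j hij
    simpa [loopLabel, Fin.ext_iff, not_le.2 i.2, not_le.2 j.2] using hlabel hij
  · rintro (v | v) i hvi <;> simpa [loopLabel, outer, not_le.2 i.2] using hlabel hvi
  · rintro (v | v | v)
    · exact .inl ⟨.inl v, Setoid.refl' _ _⟩
    · by_cases hv : l ≤ (v.1 : ℕ)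
      · exact .inl ⟨.inl v, glue_upper (p := .inl v) (q := .inr v) (arcs_rel_inl_inr hv)⟩
      · refine .inr ⟨⟨v.1, not_le.1 hv⟩, ?_⟩
        change glue _ _ (.inr (.inl (v.1, 1))) _
        obtain h | h := eq_or_eq_reflect (v := v) (w := (v.1, 1)) rfl
        · rw [h]
        · rw [h]
          exact Setoid.symm' _ (glue_lower (p := .inl v) (q := .inl (reflect v))
            (arcs_rel_inl_reflect (not_le.1 hv)))
    · exact .inl ⟨.inr v, Setoid.refl' _ _⟩

end Diagram

theorem Hyp.shift_apply {r : ℕ} (l : Fin (r + 1)) (σ : Hyp (r - l)) (v : Node (r - l)) :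
    (Hyp.shift l σ).1 (shiftEquiv l v) = shiftEquiv l (σ.1 v) :=
  Equiv.Perm.extendDomain_apply_image _ _ _

namespace Diagram

variable {r : ℕ} {l : Fin (r + 1)} {d : Diagram r}

theorem arcs_mul_ofPerm_shift_rel (σ : Hyp (r - l)) (v : Node (r - l)) :
    ((arcs l).mul (ofPerm (Hyp.shift l σ))).rel (Sum.inl (shiftEquiv l (σ.1 v)))
      (Sum.inr (shiftEquiv l v)) := by
  rw [mul_ofPerm_rel, ← Hyp.shift_apply]
  exact arcs_rel_inl_inr (Hyp.le_shift l σ _ (shiftEquiv l v).2)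

theorem arcs_mul_ofPerm_shift_injective (l : Fin (r + 1)) :
    Function.Injective fun σ : Hyp (r - l) => (arcs l).mul (ofPerm (Hyp.shift l σ)) := by
  refine fun σ τ h => Subtype.ext (Equiv.ext fun v => (shiftEquiv l).injective (Subtype.ext ?_))
  have hσ := arcs_mul_ofPerm_shift_rel σ v
  dsimp only at h
  rw [h] at hσ
  exact eq_of_rel_inr hσ (arcs_mul_ofPerm_shift_rel τ v)

theorem topArc_eq_of_not_hasHorizontal
    (htop : ∀ v : Node r, (v.1 : ℕ) < l → d.rel (Sum.inl v) (Sum.inl (reflect v)))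
    (hd : ¬ d.HasHorizontal (l + 1)) : d.topArc = {v : Node r | (v.1 : ℕ) < l} := by
  have hsub : {v : Node r | (v.1 : ℕ) < l} ⊆ d.topArc := fun v hv =>
    ⟨reflect v, reflect_ne v, htop v hv⟩
  refine (hsub.antisymm ?_).symm
  rintro v ⟨u, huv, hrel⟩
  by_contra hv
  have hu : ¬ (u.1 : ℕ) < l := fun hu => by
    have h := eq_of_rel (htop u hu) (d.rel.symm' hrel)
      (fun e => reflect_ne u (Sum.inl_injective e)) fun e => huv (Sum.inl_injective e).symm
    exact hv (Sum.inl_injective h ▸ hu)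
  have hsub' : insert v (insert u {v : Node r | (v.1 : ℕ) < l}) ⊆ d.topArc :=
    Set.insert_subset ⟨u, huv, hrel⟩
      (Set.insert_subset ⟨v, huv.symm, d.rel.symm' hrel⟩ hsub)
  have hcard := Set.ncard_le_ncard hsub'
  rw [Set.ncard_insert_of_notMem fun h => h.elim (fun h => huv h.symm) hv,
    Set.ncard_insert_of_notMem (s := {v : Node r | (v.1 : ℕ) < l}) hu,
    ncard_setOf_fst_lt (Nat.lt_succ_iff.1 l.2)] at hcard
  exact hd hcard

theorem exists_rel_shiftEquiv (htop : d.topArc = {v : Node r | (v.1 : ℕ) < l})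
    (hbot : d.botArc = {v : Node r | (v.1 : ℕ) < l}) : ∃ σ : Hyp (r - l), ∀ v,
      d.rel (Sum.inl (shiftEquiv l (σ.1 v))) (Sum.inr (shiftEquiv l v)) := by
  have hex (v : Node (r - l)) :
      ∃ u : Node (r - l), d.rel (Sum.inl (shiftEquiv l u)) (Sum.inr (shiftEquiv l v)) := by
    have hv : (shiftEquiv l v : Node r) ∉ d.botArc := hbot ▸ not_lt.2 (shiftEquiv l v).2
    obtain ⟨u, hu⟩ := exists_rel_inl hv
    have hlu := notMem_topArc hu
    rw [htop] at hlu
    exact ⟨(shiftEquiv l).symm ⟨u, not_lt.1 hlu⟩, by rwa [Equiv.apply_symm_apply]⟩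
  choose f hf using hex
  have hinj : Function.Injective f := fun v w h =>
    (shiftEquiv l).injective (Subtype.ext (eq_of_rel_inl (hf v) (h ▸ hf w)))
  exact ⟨⟨Equiv.ofBijective f (Finite.injective_iff_bijective.1 hinj), fun v =>
    (shiftEquiv l).injective (Subtype.ext
      (eq_of_rel_inr (hf (reflect v)) (d.mirror _ _ (hf v))))⟩, hf⟩

theorem exists_arcs_mul_ofPerm_shift_eq
    (htop : ∀ v : Node r, (v.1 : ℕ) < l → d.rel (Sum.inl v) (Sum.inl (reflect v)))
    (hbot : ∀ v : Node r, (v.1 : ℕ) < l → d.rel (Sum.inr v) (Sum.inr (reflect v)))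
    (hd : ¬ d.HasHorizontal (l + 1)) :
    ∃ σ : Hyp (r - l), (arcs l).mul (ofPerm (Hyp.shift l σ)) = d := by
  have htopArc := topArc_eq_of_not_hasHorizontal htop hd
  have hsub : {v : Node r | (v.1 : ℕ) < l} ⊆ d.botArc := fun v hv =>
    ⟨reflect v, reflect_ne v, hbot v hv⟩
  have hbotArc : d.botArc = {v : Node r | (v.1 : ℕ) < l} :=
    (Set.eq_of_subset_of_ncard_le hsub (by rw [← ncard_topArc, htopArc])).symm
  obtain ⟨σ, hσ⟩ := exists_rel_shiftEquiv htopArc hbotArc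
  have hfix (v : Node r) (hv : (v.1 : ℕ) < l) : (Hyp.shift l σ).1.symm v = v := by
    rw [Equiv.symm_apply_eq, Hyp.shift_of_lt l σ v (not_le.2 hv)]
  refine ⟨σ, arcs_mul_ofPerm_eq (arcs_rel_le htop (fun v hv => ?_) fun v hv => ?_)⟩
  · change d.rel (Sum.inr ((Hyp.shift l σ).1.symm v)) (Sum.inr ((Hyp.shift l σ).1.symm _))
    rw [hfix v hv, hfix (reflect v) hv]
    exact hbot v hv
  · obtain ⟨u, hu⟩ := (shiftEquiv l).surjective ⟨v, hv⟩
    have hv' : v = (Hyp.shift l σ).1 (shiftEquiv l (σ.1.symm u)) := by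
      rw [Hyp.shift_apply, Equiv.apply_symm_apply, hu]
    change d.rel (Sum.inl v) (Sum.inr ((Hyp.shift l σ).1.symm v))
    rw [hv', Equiv.symm_apply_apply, Hyp.shift_apply]
    exact hσ _

end Diagram

/-! ### The corner of a layer of the Brauer algebra -/

namespace Brauer

variable {K : Type*} [Field K] {δ : K} {r k : ℕ} {d : Diagram r}

theorem diag_mem_idealJ (h : d.HasHorizontal k) : (diag d : Brauer K δ r) ∈ idealJ K δ r k := by
  rw [idealJ, TwoSidedIdeal.mem_asIdeal]
  exact TwoSidedIdeal.subset_span ⟨⟨d, h⟩, rfl⟩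

/-- The span of the diagrams with at least `k` horizontal edges in each row: a description of
`J_k` as a vector space. -/
def horizontalSpan (K : Type*) [Field K] (δ : K) (r k : ℕ) : Submodule K (Brauer K δ r) :=
  Submodule.span K (diag '' {d : Diagram r | d.HasHorizontal k})

theorem diag_mem_horizontalSpan (h : d.HasHorizontal k) :
    (diag d : Brauer K δ r) ∈ horizontalSpan K δ r k :=
  Submodule.subset_span ⟨d, h, rfl⟩

theorem mul_mem_horizontalSpan_left {x : Brauer K δ r} (y : Brauer K δ r)
    (hx : x ∈ horizontalSpan K δ r k) : y * x ∈ horizontalSpan K δ r k := by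
  induction y using Brauer.induction with
  | h0 => simp
  | hadd a b ha hb => simpa only [add_mul] using add_mem ha hb
  | hd c d =>
    induction hx using Submodule.span_induction with
    | mem x h =>
      obtain ⟨e, he, rfl⟩ := h
      rw [smul_mul_assoc, diag_mul_diag]
      exact Submodule.smul_mem _ _
        (Submodule.smul_mem _ _ (diag_mem_horizontalSpan (he.mul_left d)))
    | zero => simp
    | add a b _ _ ha hb => simpa only [mul_add] using add_mem ha hb
    | smul a x _ hx => simpa only [mul_smul_comm] using Submodule.smul_mem _ a hx

theorem mul_mem_horizontalSpan_right {x : Brauer K δ r} (y : Brauer K δ r)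
    (hx : x ∈ horizontalSpan K δ r k) : x * y ∈ horizontalSpan K δ r k := by
  induction y using Brauer.induction with
  | h0 => simp
  | hadd a b ha hb => simpa only [mul_add] using add_mem ha hb
  | hd c d =>
    induction hx using Submodule.span_induction with
    | mem x h =>
      obtain ⟨e, he, rfl⟩ := h
      rw [mul_smul_comm, diag_mul_diag]
      exact Submodule.smul_mem _ _
        (Submodule.smul_mem _ _ (diag_mem_horizontalSpan (he.mul_right d)))
    | zero => simp
    | add a b _ _ ha hb => simpa only [add_mul] using add_mem ha hb
    | smul a x _ hx => simpa only [smul_mul_assoc] using Submodule.smul_mem _ a hx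

theorem mem_horizontalSpan_of_mem_idealJ {x : Brauer K δ r} (hx : x ∈ idealJ K δ r k) :
    x ∈ horizontalSpan K δ r k := by
  let I : TwoSidedIdeal (Brauer K δ r) := .mk' (horizontalSpan K δ r k) (zero_mem _) add_mem
    neg_mem (mul_mem_horizontalSpan_left _) (mul_mem_horizontalSpan_right _)
  have mem_I (x) : x ∈ I ↔ x ∈ horizontalSpan K δ r k := TwoSidedIdeal.mem_mk' _ _ _ _ _ _ _
  have span_le_I : TwoSidedIdeal.span (Set.range fun d : {d : Diagram r // d.HasHorizontal k} =>
      (diag d.1 : Brauer K δ r)) ≤ I := by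
    rw [TwoSidedIdeal.span_le]
    rintro _ ⟨d, rfl⟩
    exact (mem_I _).2 (diag_mem_horizontalSpan d.2)
  exact (mem_I x).1 (span_le_I hx)

/-- The coefficient of a diagram in an element of the Brauer algebra. -/
def coeffDiag (d : Diagram r) : Brauer K δ r →ₗ[K] K := Finsupp.lapply d

theorem coeffDiag_diag_self (d : Diagram r) : coeffDiag d (diag d : Brauer K δ r) = 1 :=
  Finsupp.single_eq_same

theorem coeffDiag_diag_of_ne {d e : Diagram r} (h : e ≠ d) :
    coeffDiag d (diag e : Brauer K δ r) = 0 :=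
  Finsupp.single_eq_of_ne' h

theorem coeffDiag_eq_zero_of_mem_idealJ {x : Brauer K δ r} (hx : x ∈ idealJ K δ r k)
    (hd : ¬ d.HasHorizontal k) : coeffDiag d x = 0 := by
  have horizontalSpan_le : horizontalSpan K δ r k ≤ LinearMap.ker (coeffDiag d) := by
    rw [horizontalSpan, Submodule.span_le]
    rintro _ ⟨e, he, rfl⟩
    exact coeffDiag_diag_of_ne fun h => hd (h ▸ he)
  exact horizontalSpan_le (mem_horizontalSpan_of_mem_idealJ hx)

variable {l : Fin (r + 1)}

theorem isIdempotentElem_idem (hδ : δ ≠ 0) (l : Fin (r + 1)) : IsIdempotentElem (idem K δ l) := by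
  rw [IsIdempotentElem, idem, smul_mul_smul_comm, diag_mul_diag, Diagram.arcs_mul_arcs,
    Diagram.loops_arcs (Nat.lt_succ_iff.1 l.2), smul_smul, mul_assoc, ← mul_pow,
    inv_mul_cancel₀ hδ, one_pow, mul_one]

theorem idem_mem_idealJ (h : k ≤ l) : idem K δ l ∈ idealJ K δ r k :=
  Submodule.smul_of_tower_mem _ _
    (diag_mem_idealJ ((Diagram.hasHorizontal_arcs_iff (Nat.lt_succ_iff.1 l.2)).2 h))

theorem ofHypAlg_single_mul_idem (σ : Hyp (r - l)) (c : K) :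
    ofHypAlg K δ l (MonoidAlgebra.single σ c) * idem K δ l =
      (c * δ⁻¹ ^ (l : ℕ)) •
        diag ((Diagram.arcs l).mul (Diagram.ofPerm (Hyp.shift l σ))) := by
  have ofHypAlg_single : ofHypAlg K δ l (MonoidAlgebra.single σ c) =
      c • diag (Diagram.ofPerm (Hyp.shift l σ)) := by
    simp [ofHypAlg, ofHyp, MonoidAlgebra.lift_single]
  rw [ofHypAlg_single, idem, smul_mul_smul_comm, ofPerm_mul_diag, Diagram.shift_mul_arcs]

theorem coeffDiag_ofHypAlg_mul_idem (a : HypAlg K (r - l)) (σ : Hyp (r - l)) :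
    coeffDiag ((Diagram.arcs l).mul (Diagram.ofPerm (Hyp.shift l σ)))
      (ofHypAlg K δ l a * idem K δ l) = a.coeff σ * δ⁻¹ ^ (l : ℕ) := by
  induction a using MonoidAlgebra.induction_linear with
  | zero => simp
  | add a b ha hb => simp [add_mul, ha, hb]
  | single τ c =>
    rw [ofHypAlg_single_mul_idem, map_smul, MonoidAlgebra.coeff_single]
    obtain rfl | hτ := eq_or_ne τ σ
    · rw [coeffDiag_diag_self, smul_eq_mul, mul_one, Finsupp.single_eq_same]
    · rw [coeffDiag_diag_of_ne (Diagram.arcs_mul_ofPerm_shift_injective l |>.ne hτ),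
        Finsupp.single_eq_of_ne' hτ, smul_zero, zero_mul]

theorem eq_zero_of_ofHypAlg_mul_idem_mem (hδ : δ ≠ 0) {a : HypAlg K (r - l)}
    (h : ofHypAlg K δ l a * idem K δ l ∈ idealJ K δ r (l + 1)) : a = 0 := by
  ext σ
  have not_hasHorizontal : ¬ ((Diagram.arcs l).mul
      (Diagram.ofPerm (Hyp.shift l σ))).HasHorizontal (l + 1) := by
    rw [Diagram.hasHorizontal_mul_ofPerm_iff,
      Diagram.hasHorizontal_arcs_iff (Nat.lt_succ_iff.1 l.2)]
    exact Nat.not_succ_le_self l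
  have hcoeff := coeffDiag_eq_zero_of_mem_idealJ h not_hasHorizontal
  rw [coeffDiag_ofHypAlg_mul_idem] at hcoeff
  exact (mul_eq_zero.1 hcoeff).resolve_right (pow_ne_zero _ (inv_ne_zero hδ))

theorem exists_idem_mul_diag_mul_idem (l : Fin (r + 1)) (d : Diagram r) :
    ∃ c : K, idem K δ l * diag d * idem K δ l =
      c • diag (((Diagram.arcs l).mul d).mul (Diagram.arcs l)) := by
  rw [idem, smul_mul_assoc, smul_mul_smul_comm, diag_mul_diag, smul_mul_assoc,
    diag_mul_diag, smul_smul, smul_smul]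
  exact ⟨_, rfl⟩

theorem exists_ofHypAlg_mul_idem_sub_mem (hδ : δ ≠ 0) (l : Fin (r + 1)) (x : Brauer K δ r) :
    ∃ a : HypAlg K (r - l),
      ofHypAlg K δ l a * idem K δ l - idem K δ l * x * idem K δ l ∈ idealJ K δ r (l + 1) := by
  induction x using Brauer.induction with
  | h0 => exact ⟨0, by simp⟩
  | hadd x y hx hy =>
    obtain ⟨a, ha⟩ := hx
    obtain ⟨b, hb⟩ := hy
    exact ⟨a + b, by simpa only [map_add, add_mul, mul_add, add_sub_add_comm] using add_mem ha hb⟩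
  | hd c d =>
    obtain ⟨c', hc'⟩ := exists_idem_mul_diag_mul_idem (K := K) (δ := δ) l d
    rw [mul_smul_comm, smul_mul_assoc, hc', smul_smul]
    by_cases h : (((Diagram.arcs l).mul d).mul (Diagram.arcs l)).HasHorizontal (l + 1)
    · refine ⟨0, ?_⟩
      rw [map_zero, zero_mul, zero_sub]
      exact neg_mem (Submodule.smul_of_tower_mem _ _ (diag_mem_idealJ h))
    · obtain ⟨σ, hσ⟩ := Diagram.exists_arcs_mul_ofPerm_shift_eq
        (fun v hv => glue_upper (s := ((Diagram.arcs l).mul d).rel) (p := .inl v)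
          (q := .inl (reflect v)) (glue_upper (p := .inl v) (q := .inl (reflect v))
            (Diagram.arcs_rel_inl_reflect hv)))
        (fun v hv => glue_lower (Diagram.arcs_rel_inr_reflect hv)) h
      refine ⟨MonoidAlgebra.single σ (c * c' * δ ^ (l : ℕ)), ?_⟩
      rw [ofHypAlg_single_mul_idem, hσ, mul_assoc, ← mul_pow, mul_inv_cancel₀ hδ, one_pow, mul_one,
        sub_self]
      exact zero_mem _

end Brauer

section IsCorner

variable {K A C : Type*} [CommRing K] [Ring A] [Algebra K A] [Ring C] [Algebra K C]

/-- The map `a ↦ φ a * e` identifies the algebra `A` with the corner algebra `e C e` of an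
idempotent `e` that commutes with `φ`. -/
structure IsCorner (φ : A →ₐ[K] C) (e : C) : Prop where
  isIdempotentElem : IsIdempotentElem e
  commute (a : A) : Commute (φ a) e
  injective : Function.Injective fun a => φ a * e
  exists_eq (x : C) : ∃ a, φ a * e = e * x * e

namespace IsCorner

variable {φ : A →ₐ[K] C} {e : C} (h : IsCorner φ e)
include h

/-- The element `a` of `A` with `φ a * e = e * x * e`. -/
def symbol : C →ₗ[K] A where
  toFun x := (h.exists_eq x).choose
  map_add' x y := h.injective <| by
    simp only [map_add, add_mul, (h.exists_eq x).choose_spec, (h.exists_eq y).choose_spec]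
    rw [(h.exists_eq (x + y)).choose_spec, mul_add, add_mul]
  map_smul' c x := h.injective <| by
    simp only [map_smul, smul_mul_assoc, (h.exists_eq x).choose_spec, RingHom.id_apply]
    rw [(h.exists_eq (c • x)).choose_spec, mul_smul_comm, smul_mul_assoc]

theorem map_symbol_mul (x : C) : φ (h.symbol x) * e = e * x * e := (h.exists_eq x).choose_spec

theorem symbol_eq {x : C} {a : A} (ha : φ a * e = e * x * e) : h.symbol x = a :=
  h.injective ((h.map_symbol_mul x).trans ha.symm)

theorem symbol_one : h.symbol 1 = 1 :=
  h.symbol_eq (by rw [map_one, one_mul, mul_one, h.isIdempotentElem.eq])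

theorem symbol_mul_left (x : C) : h.symbol (e * x) = h.symbol x :=
  h.symbol_eq (by rw [h.map_symbol_mul, ← mul_assoc, h.isIdempotentElem.eq])

theorem symbol_map_mul (a : A) (x : C) : h.symbol (φ a * x) = a * h.symbol x :=
  h.symbol_eq (by rw [map_mul, mul_assoc, h.map_symbol_mul, ← mul_assoc e, ← (h.commute a).eq]
                  simp only [mul_assoc])

end IsCorner

end IsCorner

theorem Brauer.isCorner {K : Type*} [Field K] {δ : K} {r : ℕ} (hδ : δ ≠ 0) (l : Fin (r + 1)) :
    IsCorner ((Ideal.Quotient.mkₐ K (idealJ K δ r (l + 1))).comp (ofHypAlg K δ l))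
      (Ideal.Quotient.mkₐ K (idealJ K δ r (l + 1)) (idem K δ l)) where
  isIdempotentElem := (isIdempotentElem_idem hδ l).map _
  commute a := (show Commute (ofHypAlg K δ l a) (idem K δ l) from ofHypAlg_mul_idem K δ l a).map
    (Ideal.Quotient.mkₐ K (idealJ K δ r (l + 1)))
  injective := by
    intro a b hab
    rw [← sub_eq_zero]
    refine eq_zero_of_ofHypAlg_mul_idem_mem hδ (l := l) ?_
    rw [map_sub, sub_mul]
    exact Ideal.Quotient.eq.1 hab
  exists_eq x := by
    obtain ⟨x, rfl⟩ := Ideal.Quotient.mk_surjective x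
    obtain ⟨a, ha⟩ := exists_ofHypAlg_mul_idem_sub_mem hδ l x
    exact ⟨a, Ideal.Quotient.eq.2 ha⟩

/-! ### Induced modules -/

section Induced

variable {K : Type*} [Field K] {δ : K} {r : ℕ} {Q : Type*} [Ring Q] [Algebra K Q]
  {π : Brauer K δ r →ₐ[K] Q} {l : Fin (r + 1)}

instance : IsScalarTower K (Brauer K δ r)ᵐᵒᵖ (Corner π l) where
  smul_assoc c b x := Corner.ext <| by
    change x.val * π (c • b.unop) = c • (x.val * π b.unop)
    rw [map_smul, mul_smul_comm]

theorem Corner.val_op_smul (b : Brauer K δ r) (x : Corner π l) :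
    (MulOpposite.op b • x).val = x.val * π b := rfl

theorem Corner.val_smul (a : HypAlg K (r - l)) (x : Corner π l) :
    (a • x).val = π (Brauer.ofHypAlg K δ l a) * x.val := rfl

theorem Corner.op_smul_smul (b : Brauer K δ r) (a : HypAlg K (r - l)) (x : Corner π l) :
    MulOpposite.op b • a • x = a • MulOpposite.op b • x :=
  Corner.ext (mul_assoc _ _ _)

variable (π l) in
/-- The generator `e_l` of the right module `e_l Q`. -/
def Corner.idem : Corner π l := ⟨π (Brauer.idem K δ l), 1, mul_one _⟩

theorem Corner.val_idem : (Corner.idem π l).val = π (Brauer.idem K δ l) := rfl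

theorem Corner.exists_op_smul_idem_eq (hπ : Function.Surjective π) (x : Corner π l) :
    ∃ b : Brauer K δ r, MulOpposite.op b • Corner.idem π l = x := by
  obtain ⟨_, y, rfl⟩ := x
  obtain ⟨b, rfl⟩ := hπ y
  exact ⟨b, rfl⟩

section Unit

variable {M : Type*} [AddCommGroup M] [Module K M] [Module (HypAlg K (r - l))ᵐᵒᵖ M]

variable (π l M) in
/-- The map `m ↦ m ⊗ e_l` from `M` to `M ⊗ e_l Q`. -/
def unitMap : M →+ TensorCorner π l M :=
  (balanced π l M).mkQ.toAddMonoidHom.comp (TensorProduct.mk K _ M (Corner.idem π l)).toAddMonoidHom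

theorem mk_op_smul_idem_tmul (b : Brauer K δ r) (m : M) :
    (Submodule.Quotient.mk ((MulOpposite.op b • Corner.idem π l) ⊗ₜ m) : TensorCorner π l M) =
      MulOpposite.op b • unitMap π l M m := rfl

theorem mk_smul_tmul (a : HypAlg K (r - l)) (x : Corner π l) (m : M) :
    (Submodule.Quotient.mk ((a • x) ⊗ₜ m) : TensorCorner π l M) =
      Submodule.Quotient.mk (x ⊗ₜ (MulOpposite.op a • m)) :=
  (Submodule.Quotient.eq _).2 (Submodule.subset_span ⟨a, x, m, rfl⟩)

theorem op_smul_unitMap_congr {b c : Brauer K δ r}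
    (h : π (Brauer.idem K δ l * b) = π (Brauer.idem K δ l * c)) (m : M) :
    MulOpposite.op b • unitMap π l M m = MulOpposite.op c • unitMap π l M m := by
  have hbc : MulOpposite.op b • Corner.idem π l = MulOpposite.op c • Corner.idem π l := by
    refine Corner.ext ?_
    rwa [Corner.val_op_smul, Corner.val_op_smul, Corner.val_idem, ← map_mul, ← map_mul]
  rw [← mk_op_smul_idem_tmul, hbc, mk_op_smul_idem_tmul]

theorem unitMap_op_smul (a : HypAlg K (r - l)) (m : M) :
    unitMap π l M (MulOpposite.op a • m) =
      MulOpposite.op (Brauer.ofHypAlg K δ l a) • unitMap π l M m := by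
  have hcomm :
      MulOpposite.op (Brauer.ofHypAlg K δ l a) • Corner.idem π l = a • Corner.idem π l := by
    refine Corner.ext ?_
    rw [Corner.val_op_smul, Corner.val_smul, Corner.val_idem, ← map_mul, ← map_mul,
      Brauer.ofHypAlg_mul_idem]
  rw [← mk_op_smul_idem_tmul, hcomm, mk_smul_tmul]
  rfl

theorem op_idem_smul_unitMap (hδ : δ ≠ 0) (m : M) :
    MulOpposite.op (Brauer.idem K δ l) • unitMap π l M m = unitMap π l M m := by
  rw [← one_smul (Brauer K δ r)ᵐᵒᵖ (unitMap π l M m), ← mul_smul, ← MulOpposite.op_one,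
    ← MulOpposite.op_mul]
  refine op_smul_unitMap_congr ?_ m
  rw [one_mul, mul_one, (Brauer.isIdempotentElem_idem hδ l).eq]

theorem tensorCorner_induction (hπ : Function.Surjective π) {P : TensorCorner π l M → Prop}
    (z : TensorCorner π l M) (zero : P 0) (add : ∀ x y, P x → P y → P (x + y))
    (op_smul_unitMap : ∀ (b : Brauer K δ r) m, P (MulOpposite.op b • unitMap π l M m)) : P z := by
  obtain ⟨w, rfl⟩ := Submodule.Quotient.mk_surjective _ z
  induction w using TensorProduct.induction_on with
  | zero => exact zero
  | tmul x m =>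
    obtain ⟨b, rfl⟩ := Corner.exists_op_smul_idem_eq hπ x
    exact op_smul_unitMap b m
  | add x y hx hy => exact add _ _ hx hy

theorem tensorCorner_hom_ext {X : Type*} [AddCommGroup X] [Module (Brauer K δ r)ᵐᵒᵖ X]
    (hπ : Function.Surjective π) {F G : TensorCorner π l M →ₗ[(Brauer K δ r)ᵐᵒᵖ] X}
    (h : ∀ m, F (unitMap π l M m) = G (unitMap π l M m)) : F = G := by
  refine LinearMap.ext fun z => ?_
  induction z using tensorCorner_induction hπ with
  | zero => rw [map_zero, map_zero]
  | add x y hx hy => rw [map_add, map_add, hx, hy]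
  | op_smul_unitMap b m => rw [map_smul, map_smul, h]

end Unit

section Retraction

variable {M : Type*} [AddCommGroup M] [Module K M] [Module (HypAlg K (r - l))ᵐᵒᵖ M]
  [IsScalarTower K (HypAlg K (r - l))ᵐᵒᵖ M]
  (h : IsCorner (π.comp (Brauer.ofHypAlg K δ l)) (π (Brauer.idem K δ l)))

variable (M) in
/-- The map `m ⊗ x ↦ m a` with `e_l x e_l = a e_l`, before the tensor product over `K` is replaced
by the one over the group algebra. -/
def preRetraction : Corner π l ⊗[K] M →ₗ[K] M :=
  TensorProduct.lift (LinearMap.mk₂ K (fun x m => MulOpposite.op (h.symbol x.val) • m)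
    (fun x y m => by rw [map_add, map_add, MulOpposite.op_add, add_smul])
    (fun c x m => by rw [map_smul, map_smul, MulOpposite.op_smul, smul_assoc])
    (fun x m n => smul_add _ _ _)
    (fun c x m => smul_comm _ _ _))

theorem preRetraction_tmul (x : Corner π l) (m : M) :
    preRetraction M h (x ⊗ₜ m) = MulOpposite.op (h.symbol x.val) • m := rfl

theorem preRetraction_eq_zero_of_mem_balanced {z : Corner π l ⊗[K] M} (hz : z ∈ balanced π l M) :
    preRetraction M h z = 0 := by
  suffices hop : ∀ b : Brauer K δ r, preRetraction M h (MulOpposite.op b • z) = 0 by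
    simpa only [MulOpposite.op_one, one_smul] using hop 1
  induction hz using Submodule.span_induction with
  | mem z hz =>
    obtain ⟨a, x, m, rfl⟩ := hz
    intro b
    have hsymbol : h.symbol (a • MulOpposite.op b • x).val =
        a * h.symbol (MulOpposite.op b • x).val := h.symbol_map_mul a _
    rw [smul_sub, TensorProduct.smul_tmul', TensorProduct.smul_tmul', Corner.op_smul_smul, map_sub,
      preRetraction_tmul, preRetraction_tmul, hsymbol, MulOpposite.op_mul, mul_smul, sub_self]
  | zero => intro b; rw [smul_zero, map_zero]
  | add x y _ _ hx hy => intro b; rw [smul_add, map_add, hx, hy, add_zero]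
  | smul a x _ hx => intro b; rw [← mul_smul]; exact hx (a.unop * b)

variable (M) in
/-- The map `M ⊗ e_l Q → M` that sends `m ⊗ x` to `m a`, where `e_l x e_l = a e_l`. It is
multiplication by `e_l`, followed by the identification of `M ⊗ e_l Q e_l` with `M`. -/
def retraction : TensorCorner π l M →+ M :=
  QuotientAddGroup.lift (balanced π l M).toAddSubgroup (preRetraction M h).toAddMonoidHom
    fun _ hz => preRetraction_eq_zero_of_mem_balanced h hz

theorem retraction_op_smul_unitMap (b : Brauer K δ r) (m : M) :
    retraction M h (MulOpposite.op b • unitMap π l M m) = MulOpposite.op (h.symbol (π b)) • m := by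
  rw [← h.symbol_mul_left]
  rfl

theorem retraction_unitMap (m : M) : retraction M h (unitMap π l M m) = m := by
  have := retraction_op_smul_unitMap h 1 m
  rwa [map_one, h.symbol_one, MulOpposite.op_one, MulOpposite.op_one, one_smul, one_smul] at this

include h in
theorem Corner.idem_mul_val (x : Corner π l) : π (Brauer.idem K δ l) * x.val = x.val := by
  obtain ⟨_, y, rfl⟩ := x
  exact (mul_assoc _ _ y).symm.trans (congrArg (· * y) h.isIdempotentElem.eq)

theorem Corner.op_idem_smul (x : Corner π l) :
    MulOpposite.op (Brauer.idem K δ l) • x = h.symbol x.val • Corner.idem π l := by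
  refine Corner.ext ((h.map_symbol_mul _).trans ?_).symm
  rw [Corner.idem_mul_val h, Corner.val_op_smul]

theorem op_idem_smul_eq_unitMap_retraction (z : TensorCorner π l M) :
    MulOpposite.op (Brauer.idem K δ l) • z = unitMap π l M (retraction M h z) := by
  obtain ⟨w, rfl⟩ := Submodule.Quotient.mk_surjective _ z
  induction w using TensorProduct.induction_on with
  | zero => rw [Submodule.Quotient.mk_zero, smul_zero, map_zero, map_zero]
  | tmul x m =>
    rw [← Submodule.Quotient.mk_smul, TensorProduct.smul_tmul', Corner.op_idem_smul h,
      mk_smul_tmul]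
    rfl
  | add x y hx hy => rw [Submodule.Quotient.mk_add, smul_add, hx, hy, map_add, map_add]

theorem retraction_op_ofHypAlg_smul (a : HypAlg K (r - l)) (z : TensorCorner π l M) :
    retraction M h (MulOpposite.op (Brauer.ofHypAlg K δ l a) • z) =
      MulOpposite.op a • retraction M h z := by
  refine Function.LeftInverse.injective (retraction_unitMap h) ?_
  rw [← op_idem_smul_eq_unitMap_retraction, ← mul_smul, ← MulOpposite.op_mul,
    Brauer.ofHypAlg_mul_idem, MulOpposite.op_mul, mul_smul, op_idem_smul_eq_unitMap_retraction h,
    unitMap_op_smul]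

end Retraction

section Localization

variable {M M' : Type*} [AddCommGroup M] [Module K M] [Module (HypAlg K (r - l))ᵐᵒᵖ M]
  [AddCommGroup M'] [Module K M'] [Module (HypAlg K (r - l))ᵐᵒᵖ M']
  [IsScalarTower K (HypAlg K (r - l))ᵐᵒᵖ M']
  (h : IsCorner (π.comp (Brauer.ofHypAlg K δ l)) (π (Brauer.idem K δ l)))

/-- The homomorphism `M → M'` that a homomorphism `M ⊗ e_l B → M' ⊗ e_l Q` induces after
multiplication by `e_l`. -/
def localize (F : IndBig δ l M →ₗ[(Brauer K δ r)ᵐᵒᵖ] TensorCorner π l M') :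
    M →ₗ[(HypAlg K (r - l))ᵐᵒᵖ] M' where
  toFun m := retraction M' h (F (unitMap _ l M m))
  map_add' m n := by rw [map_add, map_add, map_add]
  map_smul' a m := by
    obtain ⟨a, rfl⟩ := MulOpposite.op_surjective a
    rw [unitMap_op_smul, map_smul, retraction_op_ofHypAlg_smul, RingHom.id_apply]

theorem localize_apply (F : IndBig δ l M →ₗ[(Brauer K δ r)ᵐᵒᵖ] TensorCorner π l M') (m : M) :
    localize h F m = retraction M' h (F (unitMap _ l M m)) := rfl

theorem apply_unitMap (hδ : δ ≠ 0)
    (F : IndBig δ l M →ₗ[(Brauer K δ r)ᵐᵒᵖ] TensorCorner π l M') (m : M) :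
    F (unitMap _ l M m) = unitMap π l M' (localize h F m) := by
  rw [localize_apply, ← op_idem_smul_eq_unitMap_retraction, ← map_smul, op_idem_smul_unitMap hδ]

variable (π l) in
/-- The map `e_l B → e_l Q`. -/
def cornerMap : Corner (AlgHom.id K (Brauer K δ r)) l →ₗ[(Brauer K δ r)ᵐᵒᵖ] Corner π l where
  toFun x := ⟨π x.val, by
    obtain ⟨_, y, rfl⟩ := x
    exact ⟨π y, (map_mul π _ _).symm⟩⟩
  map_add' x y := Corner.ext (map_add π x.val y.val)
  map_smul' b x := Corner.ext (map_mul π x.val b.unop)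

theorem cornerMap_smul (a : HypAlg K (r - l)) (x : Corner (AlgHom.id K (Brauer K δ r)) l) :
    cornerMap π l (a • x) = a • cornerMap π l x :=
  Corner.ext (map_mul π _ _)

variable [IsScalarTower K (HypAlg K (r - l))ᵐᵒᵖ M]

variable (π) in
/-- The homomorphism `M ⊗ e_l B → M' ⊗ e_l Q` induced by a homomorphism `M → M'`. -/
def tensorCornerMap (f : M →ₗ[(HypAlg K (r - l))ᵐᵒᵖ] M') :
    IndBig δ l M →ₗ[(Brauer K δ r)ᵐᵒᵖ] TensorCorner π l M' :=
  Submodule.mapQ _ _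
    (TensorProduct.AlgebraTensorModule.map (cornerMap π l) (f.restrictScalars K)) <|
    Submodule.span_le.2 <| by
      rintro _ ⟨a, x, m, rfl⟩
      refine Submodule.subset_span ⟨a, cornerMap π l x, f m, ?_⟩
      rw [map_sub, TensorProduct.AlgebraTensorModule.map_tmul,
        TensorProduct.AlgebraTensorModule.map_tmul, LinearMap.restrictScalars_apply,
        LinearMap.restrictScalars_apply, map_smul f, cornerMap_smul]

theorem tensorCornerMap_unitMap (f : M →ₗ[(HypAlg K (r - l))ᵐᵒᵖ] M') (m : M) :
    tensorCornerMap π f (unitMap _ l M m) = unitMap π l M' (f m) := rfl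

theorem localize_tensorCornerMap (f : M →ₗ[(HypAlg K (r - l))ᵐᵒᵖ] M') :
    localize h (tensorCornerMap π f) = f :=
  LinearMap.ext fun m => retraction_unitMap h (f m)

theorem retraction_apply (hδ : δ ≠ 0)
    (F : IndBig δ l M →ₗ[(Brauer K δ r)ᵐᵒᵖ] TensorCorner π l M') (z : IndBig δ l M) :
    retraction M' h (F z) =
      localize h F (retraction M h (tensorCornerMap π LinearMap.id z)) := by
  induction z using tensorCorner_induction (π := AlgHom.id K _) Function.surjective_id with
  | zero => simp only [map_zero]
  | add x y hx hy => simp only [map_add, hx, hy]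
  | op_smul_unitMap b m =>
    rw [map_smul F, map_smul (tensorCornerMap π _), apply_unitMap h hδ, tensorCornerMap_unitMap,
      retraction_op_smul_unitMap, retraction_op_smul_unitMap, map_smul, LinearMap.id_apply]

theorem localize_comp (hδ : δ ≠ 0) {X : Type*} [AddCommGroup X] [Module K X]
    [Module (HypAlg K (r - l))ᵐᵒᵖ X]
    (F : IndBig δ l M →ₗ[(Brauer K δ r)ᵐᵒᵖ] TensorCorner π l M')
    (G : IndBig δ l X →ₗ[(Brauer K δ r)ᵐᵒᵖ] IndBig δ l M) :
    localize h (F ∘ₗ G) =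
      localize h F ∘ₗ localize h (tensorCornerMap π LinearMap.id ∘ₗ G) :=
  LinearMap.ext fun m => retraction_apply h hδ F (G (unitMap _ l X m))

theorem localize_surjective_iff (hπ : Function.Surjective π) (hδ : δ ≠ 0)
    {F : IndBig δ l M →ₗ[(Brauer K δ r)ᵐᵒᵖ] TensorCorner π l M'} :
    Function.Surjective (localize h F) ↔ Function.Surjective F := by
  constructor
  · intro hF
    rw [← LinearMap.range_eq_top, Submodule.eq_top_iff']
    intro z
    induction z using tensorCorner_induction hπ with
    | zero => exact zero_mem _
    | add x y hx hy => exact add_mem hx hy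
    | op_smul_unitMap b m =>
      obtain ⟨m, rfl⟩ := hF m
      exact Submodule.smul_mem _ _ ⟨_, apply_unitMap h hδ F m⟩
  · intro hF m
    obtain ⟨z, hz⟩ := hF (unitMap π l M' m)
    exact ⟨_, by rw [← retraction_apply h hδ, hz, retraction_unitMap]⟩

variable (M) in
/-- The action of the endomorphisms of `M ⊗ e_l B` on `M`, which is the image of `M ⊗ e_l Q` under
multiplication by `e_l`. -/
def localizeEnd (hδ : δ ≠ 0) : Module.End (Brauer K δ r)ᵐᵒᵖ (IndBig δ l M) →+*
    Module.End (HypAlg K (r - l))ᵐᵒᵖ M where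
  toFun F := localize h (tensorCornerMap π LinearMap.id ∘ₗ F)
  map_one' := localize_tensorCornerMap h LinearMap.id
  map_mul' F G := localize_comp h hδ (tensorCornerMap π LinearMap.id ∘ₗ F) G
  map_zero' := by ext1 m; simp [localize_apply]
  map_add' F G := by ext1 m; simp [localize_apply]

theorem localizeEnd_comp (hδ : δ ≠ 0)
    (F : IndBig δ l M' →ₗ[(Brauer K δ r)ᵐᵒᵖ] IndBig δ l M)
    (G : IndBig δ l M →ₗ[(Brauer K δ r)ᵐᵒᵖ] IndBig δ l M') :
    localizeEnd M h hδ (F ∘ₗ G) =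
      localize h (tensorCornerMap π LinearMap.id ∘ₗ F) ∘ₗ
        localize h (tensorCornerMap π LinearMap.id ∘ₗ G) :=
  localize_comp h hδ (tensorCornerMap π LinearMap.id ∘ₗ F) G

theorem tensorCornerMap_id_comp_tensorCornerMap (f : M →ₗ[(HypAlg K (r - l))ᵐᵒᵖ] M') :
    tensorCornerMap π LinearMap.id ∘ₗ tensorCornerMap (AlgHom.id K (Brauer K δ r)) f =
      tensorCornerMap π f :=
  tensorCorner_hom_ext (π := AlgHom.id K _) Function.surjective_id fun _ => rfl

theorem detects_indBig_iff (hδ : δ ≠ 0) {D : Type*} [Semiring D]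
    {χ : Module.End (HypAlg K (r - l))ᵐᵒᵖ M →+* D} :
    Detects (χ.comp (localizeEnd M h hδ)) (IndBig δ l M') ↔ Detects χ M' := by
  constructor
  · rintro ⟨F, G, hFG⟩
    rw [RingHom.comp_apply, localizeEnd_comp] at hFG
    exact ⟨_, _, hFG⟩
  · rintro ⟨f, g, hfg⟩
    refine ⟨tensorCornerMap _ f, tensorCornerMap _ g, ?_⟩
    rwa [RingHom.comp_apply, localizeEnd_comp, tensorCornerMap_id_comp_tensorCornerMap,
      tensorCornerMap_id_comp_tensorCornerMap, localize_tensorCornerMap, localize_tensorCornerMap]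

end Localization

section Vanishing

variable {M : Type*} [AddCommGroup M] [Module K M] [Module (HypAlg K (r - l))ᵐᵒᵖ M]

theorem op_smul_eq_zero {j : Brauer K δ r} (hj : π j = 0) (z : TensorCorner π l M) :
    MulOpposite.op j • z = 0 := by
  obtain ⟨w, rfl⟩ := Submodule.Quotient.mk_surjective _ z
  rw [← Submodule.Quotient.mk_smul]
  induction w using TensorProduct.induction_on with
  | zero => rw [smul_zero, Submodule.Quotient.mk_zero]
  | tmul x m =>
    have hx : MulOpposite.op j • x = 0 :=
      Corner.ext (by rw [Corner.val_op_smul, hj, mul_zero]; rfl)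
    rw [TensorProduct.smul_tmul', hx, TensorProduct.zero_tmul, Submodule.Quotient.mk_zero]
  | add x y hx hy => rw [smul_add, Submodule.Quotient.mk_add, hx, hy, add_zero]

theorem hom_indLayer_eq_zero (hδ : δ ≠ 0) {m : Fin (r + 1)} (hlm : l < m) {X : Type*}
    [AddCommGroup X] [Module K X] [Module (HypAlg K (r - m))ᵐᵒᵖ X]
    (F : IndBig δ m X →ₗ[(Brauer K δ r)ᵐᵒᵖ] IndLayer δ l M) : F = 0 := by
  refine tensorCorner_hom_ext Function.surjective_id fun x => ?_
  rw [← op_idem_smul_unitMap hδ, map_smul, LinearMap.zero_apply]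
  exact op_smul_eq_zero (Ideal.Quotient.eq_zero_iff_mem.2 (Brauer.idem_mem_idealJ hlm)) _

theorem not_detects_indBig (hδ : δ ≠ 0) {m : Fin (r + 1)} (hlm : l < m)
    [IsScalarTower K (HypAlg K (r - l))ᵐᵒᵖ M] {D : Type*} [Semiring D]
    (χ : Module.End (HypAlg K (r - l))ᵐᵒᵖ M →+* D) {X : Type*} [AddCommGroup X] [Module K X]
    [Module (HypAlg K (r - m))ᵐᵒᵖ X] :
    ¬ Detects (χ.comp (localizeEnd M (Brauer.isCorner hδ l) hδ)) (IndBig δ m X) := by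
  rintro ⟨F, G, hFG⟩
  refine hFG ?_
  have hF := hom_indLayer_eq_zero hδ hlm (tensorCornerMap _ LinearMap.id ∘ₗ F)
  have hzero : localizeEnd M (Brauer.isCorner hδ l) hδ (F ∘ₗ G) = 0 := by
    ext1 v
    exact (congrArg _ (LinearMap.congr_fun hF _)).trans (map_zero _)
  rw [RingHom.comp_apply, hzero, map_zero]

end Vanishing

end Induced

section Finiteness

variable {K : Type*} [Field K] {δ : K} {r : ℕ}

instance : Finite (Diagram r) :=
  Finite.of_injective (fun d : Diagram r => fun x y => d.rel x y) fun _ _ h =>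
    Diagram.ext (Setoid.ext fun x y => iff_of_eq (congrFun (congrFun h x) y))

instance : Module.Finite K (Brauer K δ r) := inferInstanceAs (Module.Finite K (Diagram r →₀ K))

instance {l : Fin (r + 1)} : Module.Finite K (Corner (AlgHom.id K (Brauer K δ r)) l) :=
  inferInstanceAs (Module.Finite K (LinearMap.range _))

instance {n : ℕ} {lam : BiPartition n} : Finite (BiTableau lam) :=
  Finite.of_injective BiTableau.entry fun ⟨_, _⟩ ⟨_, _⟩ h => by
    congr

instance {n : ℕ} {lam : BiPartition n} : Finite (Tabloid lam) :=
  inferInstanceAs (Finite (Quotient (rowEquiv lam)))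

instance {n : ℕ} {lam : BiPartition n} : Module.Finite K (PermMod K lam) :=
  inferInstanceAs (Module.Finite K (Tabloid lam →₀ K))

instance {n : ℕ} {lam : BiPartition n} : IsNoetherian (HypAlg K n)ᵐᵒᵖ (PermMod K lam) :=
  isNoetherian_of_tower K inferInstance

instance {n : ℕ} {lam : BiPartition n} : IsArtinian (HypAlg K n)ᵐᵒᵖ (PermMod K lam) :=
  isArtinian_of_tower K inferInstance

variable {l : Fin (r + 1)} {M : Type*} [AddCommGroup M] [Module K M] [Module.Finite K M]
  [Module (HypAlg K (r - l))ᵐᵒᵖ M]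

instance : IsNoetherian (Brauer K δ r)ᵐᵒᵖ (IndBig δ l M) :=
  have : IsNoetherian (Brauer K δ r)ᵐᵒᵖ (Corner (AlgHom.id K (Brauer K δ r)) l ⊗[K] M) :=
    isNoetherian_of_tower K inferInstance
  inferInstance

instance : IsArtinian (Brauer K δ r)ᵐᵒᵖ (IndBig δ l M) :=
  have : IsArtinian (Brauer K δ r)ᵐᵒᵖ (Corner (AlgHom.id K (Brauer K δ r)) l ⊗[K] M) :=
    isArtinian_of_tower K inferInstance
  inferInstance

end Finiteness

/-! ### Young modules -/

section YoungHyp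

variable {K : Type*} [Field K] {n : ℕ} {lam mu : BiPartition n}

theorem polytabloid_ne_zero (t : BiTableau lam) : polytabloid K t ≠ 0 := fun h =>
  one_ne_zero ((coeff_polytabloid K t).symm.trans (by rw [h, map_zero]))

theorem map_polytabloid (f : Module.End (HypAlg K n)ᵐᵒᵖ (PermMod K lam)) (t : BiTableau lam) :
    f (polytabloid K t) = coeff K t (f (polytabloid K t)) • polytabloid K t := by
  obtain ⟨c, hc⟩ := exists_op_colSum_smul_eq t (f (tabloidOf K t))
  rw [← map_smul, ← polytabloid] at hc
  rw [hc, map_smul, coeff_polytabloid, smul_eq_mul, mul_one]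

variable (K) in
/-- The character by which the endomorphisms of `M(λ)` act on the polytabloid of `t`. It detects the
Young module `Y(λ)` among the summands of `M(λ)`. -/
def polyChar (t : BiTableau lam) : Module.End (HypAlg K n)ᵐᵒᵖ (PermMod K lam) →+* K where
  toFun f := coeff K t (f (polytabloid K t))
  map_one' := coeff_polytabloid K t
  map_mul' f g := by
    rw [Module.End.mul_apply, map_polytabloid g, f.map_smul_of_tower, map_smul, smul_eq_mul,
      mul_comm, map_smul, coeff_polytabloid, smul_eq_mul, mul_one]
  map_zero' := by rw [LinearMap.zero_apply, map_zero]
  map_add' f g := by rw [LinearMap.add_apply, map_add]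

theorem apply_polytabloid (f : Module.End (HypAlg K n)ᵐᵒᵖ (PermMod K lam)) (t : BiTableau lam) :
    f (polytabloid K t) = polyChar K t f • polytabloid K t := map_polytabloid f t

theorem dominates_of_detects {t : BiTableau lam} (h : Detects (polyChar K t) (PermMod K mu)) :
    lam.Dominates mu := by
  obtain ⟨i, p, hip⟩ := h
  refine dominates_of_op_colSum_smul_ne_zero (K := K) (t := t) (m := p (tabloidOf K t)) fun h0 => ?_
  rw [← map_smul, ← polytabloid] at h0
  refine smul_ne_zero hip (polytabloid_ne_zero (K := K) t) ?_
  rw [← apply_polytabloid, LinearMap.comp_apply, h0, map_zero]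

variable {Y Y' : Submodule (HypAlg K n)ᵐᵒᵖ (PermMod K lam)}

theorem IsYoungHyp.polytabloid_mem (hY : IsYoungHyp K lam Y) (t : BiTableau lam) :
    polytabloid K t ∈ Y := hY.2.2 (Submodule.subset_span ⟨t, rfl⟩)

theorem isYoungHyp_iff (t : BiTableau lam) : IsYoungHyp K lam Y ↔
    Indecomposable (HypAlg K n)ᵐᵒᵖ Y ∧ (∃ Z, IsCompl Y Z) ∧ Detects (polyChar K t) Y := by
  refine and_congr_right fun _ => and_congr_right fun ⟨Z, h⟩ => ?_
  rw [detects_iff_of_isCompl h]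
  have hproj := apply_polytabloid (Y.projection Z h) t
  constructor
  · intro hY h0
    have hmem : polytabloid K t ∈ Y := hY (Submodule.subset_span ⟨t, rfl⟩)
    rw [h0, zero_smul, Submodule.projection_apply_of_mem_left h hmem] at hproj
    exact polytabloid_ne_zero t hproj
  · intro h0
    refine specht_le K (t := t) (((Y.restrictScalars K).smul_mem_iff h0).1 ?_)
    exact hproj ▸ Submodule.projection_apply_mem h _

theorem exists_isYoungHyp (K : Type*) [Field K] (lam : BiPartition n) :
    ∃ Y, IsYoungHyp K lam Y := by
  obtain ⟨t⟩ := nonempty_biTableau lam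
  obtain ⟨Y, hY⟩ := exists_indecomposable_isCompl_detects (polyChar K t)
  exact ⟨Y, (isYoungHyp_iff t).2 hY⟩

theorem IsYoungHyp.nonempty_linearEquiv (hY : IsYoungHyp K lam Y) (hY' : IsYoungHyp K lam Y') :
    Nonempty (Y ≃ₗ[(HypAlg K n)ᵐᵒᵖ] Y') := by
  obtain ⟨t⟩ := nonempty_biTableau lam
  exact ((isYoungHyp_iff t).1 hY).2.2.nonempty_linearEquiv hY.1 hY'.1 ((isYoungHyp_iff t).1 hY').2.2

theorem IsYoungHyp.isSummand_iff_detects (hY : IsYoungHyp K lam Y) (t : BiTableau lam)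
    {X : Type*} [AddCommGroup X] [Module (HypAlg K n)ᵐᵒᵖ X] :
    IsSummand (HypAlg K n)ᵐᵒᵖ Y X ↔ Detects (polyChar K t) X :=
  have hd := ((isYoungHyp_iff t).1 hY).2.2
  ⟨hd.of_isSummand, hd.isSummand hY.1⟩

theorem IsYoungHyp.dominates (hY : IsYoungHyp K lam Y)
    (h : IsSummand (HypAlg K n)ᵐᵒᵖ Y (PermMod K mu)) : lam.Dominates mu := by
  obtain ⟨t⟩ := nonempty_biTableau lam
  exact dominates_of_detects ((hY.isSummand_iff_detects t).1 h)

theorem IsYoungHyp.exists_op_colSum_smul_eq (hY : IsYoungHyp K lam Y) (t : BiTableau lam) :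
    ∃ y : Y, MulOpposite.op (colSum K t) • y = ⟨polytabloid K t, hY.polytabloid_mem t⟩ := by
  obtain ⟨Z, h⟩ := hY.2.1
  refine ⟨Y.projectionOnto Z h (tabloidOf K t), ?_⟩
  rw [← map_smul]
  exact Submodule.projectionOnto_apply_of_mem_left h _

end YoungHyp

section Young

variable {K : Type*} [Field K] {δ : K} {r : ℕ} (hδ : δ ≠ 0) {x : Index r}

/-- The character of the endomorphism ring of `M(l, λ)` that detects the Young module `Y(l, λ)`: the
endomorphisms act on `M(λ)` through the layer `l`, hence on the polytabloid of `t`. -/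
def youngChar (t : BiTableau x.2) : Module.End (Brauer K δ r)ᵐᵒᵖ (BPermMod δ x) →+* K :=
  (polyChar K t).comp (localizeEnd (PermMod K x.2) (Brauer.isCorner hδ x.1) hδ)

variable {N N' P : Submodule (Brauer K δ r)ᵐᵒᵖ (BPermMod δ x)}

theorem IsYoung.detects (hN : IsYoung δ x N) (t : BiTableau x.2) : Detects (youngChar hδ t) N := by
  obtain ⟨-, ⟨P, h⟩, Y, hY, f, hf⟩ := hN
  rw [detects_iff_of_isCompl h]
  intro h0
  set F : IndBig δ x.1 (PermMod K x.2) →ₗ[(Brauer K δ r)ᵐᵒᵖ] IndLayer δ x.1 Y :=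
    f ∘ₗ N.projectionOnto P h
  have hF : Function.Surjective F := hf.comp (Submodule.projectionOnto_surjective h)
  have hFN : F ∘ₗ N.projection P h = F :=
    LinearMap.ext fun z => congrArg f (Submodule.projectionOnto_projection h z)
  have hker : localize (Brauer.isCorner hδ x.1) F (polytabloid K t) = 0 := by
    rw [← hFN, localize_comp _ hδ, LinearMap.comp_apply]
    refine (congrArg _ ((apply_polytabloid _ t).trans ?_)).trans (map_zero _)
    exact (congrArg (· • polytabloid K t) h0).trans (zero_smul K _)
  obtain ⟨y, hy⟩ := hY.exists_op_colSum_smul_eq t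
  obtain ⟨m, rfl⟩ := (localize_surjective_iff (Brauer.isCorner hδ x.1)
    (Ideal.Quotient.mkₐ_surjective K _) hδ).2 hF y
  obtain ⟨c, hc⟩ := TypeC.exists_op_colSum_smul_eq t m
  rw [← map_smul, hc, LinearMap.map_smul_of_tower, hker, smul_zero] at hy
  exact polytabloid_ne_zero t (congrArg Subtype.val hy).symm

theorem isYoung_of_detects (hN : Indecomposable (Brauer K δ r)ᵐᵒᵖ N) (h : IsCompl N P)
    {t : BiTableau x.2} (ht : Detects (youngChar hδ t) N) : IsYoung δ x N := by
  obtain ⟨Y, hY⟩ := exists_isYoungHyp K x.2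
  obtain ⟨Z, hZ⟩ := hY.2.1
  have hχ := (detects_iff_of_isCompl hZ).1 ((isYoungHyp_iff t).1 hY).2.2
  let p := Y.projectionOnto Z hZ
  let F : IndBig δ x.1 (PermMod K x.2) →ₗ[(Brauer K δ r)ᵐᵒᵖ] IndLayer δ x.1 Y := tensorCornerMap _ p
  let E := localizeEnd (PermMod K x.2) (Brauer.isCorner hδ x.1) hδ (N.projection P h)
  have hpE : Function.Bijective (p ∘ₗ E ∘ₗ Y.subtype) := by
    refine hY.1.bijective_comp_of_map_ne_zero (χ := polyChar K t) (f := E ∘ₗ Y.subtype) ?_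
    have hfactor : (E ∘ₗ Y.subtype) ∘ₗ p = E * Y.projection Z hZ := rfl
    rw [hfactor, map_mul]
    exact mul_ne_zero ((detects_iff_of_isCompl h).1 ht) hχ
  have hloc : localize (Brauer.isCorner hδ x.1) (F ∘ₗ N.projection P h) = p ∘ₗ E := by
    rw [localize_comp _ hδ, localize_tensorCornerMap]
    rfl
  have hsurj : Function.Surjective (F ∘ₗ N.projection P h) := by
    rw [← localize_surjective_iff (Brauer.isCorner hδ x.1) (Ideal.Quotient.mkₐ_surjective K _) hδ,
      hloc]
    exact Function.Surjective.of_comp (g := Y.subtype) hpE.2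
  exact ⟨hN, ⟨P, h⟩, Y, hY, F ∘ₗ N.subtype,
    Function.Surjective.of_comp (g := N.projectionOnto P h) hsurj⟩

theorem exists_isYoung (hδ : δ ≠ 0) (x : Index r) : ∃ N, IsYoung δ x N := by
  obtain ⟨t⟩ := nonempty_biTableau x.2
  obtain ⟨N, hN, ⟨P, h⟩, hd⟩ := exists_indecomposable_isCompl_detects (youngChar hδ t)
  exact ⟨N, isYoung_of_detects hδ hN h hd⟩

variable (hN : IsYoung δ x N)

include hN hδ

theorem IsYoung.nonempty_linearEquiv (hN' : IsYoung δ x N') :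
    Nonempty (N ≃ₗ[(Brauer K δ r)ᵐᵒᵖ] N') := by
  obtain ⟨t⟩ := nonempty_biTableau x.2
  exact (hN.detects hδ t).nonempty_linearEquiv hN.1 hN'.1 (hN'.detects hδ t)

theorem IsYoung.occursOnce : OccursOnce (Brauer K δ r)ᵐᵒᵖ N (BPermMod δ x) := by
  obtain ⟨t⟩ := nonempty_biTableau x.2
  exact hN.1.occursOnce_of_detects (hN.detects hδ t)

theorem IsYoung.isSummand_iff_detects (t : BiTableau x.2) {X : Type*} [AddCommGroup X]
    [Module (Brauer K δ r)ᵐᵒᵖ X] :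
    IsSummand (Brauer K δ r)ᵐᵒᵖ N X ↔ Detects (youngChar hδ t) X :=
  have hd := hN.detects hδ t
  ⟨hd.of_isSummand, hd.isSummand hN.1⟩

theorem IsYoung.not_isSummand_of_lt {y : Index r} (hxy : x.1 < y.1) :
    ¬ IsSummand (Brauer K δ r)ᵐᵒᵖ N (BPermMod δ y) := by
  obtain ⟨t⟩ := nonempty_biTableau x.2
  rw [hN.isSummand_iff_detects hδ t]
  exact not_detects_indBig hδ hxy (polyChar K t)

theorem IsYoung.isSummand_iff {mu : BiPartition (r - x.1)}
    {Y : Submodule (HypAlg K (r - x.1))ᵐᵒᵖ (PermMod K x.2)} (hY : IsYoungHyp K x.2 Y) :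
    IsSummand (Brauer K δ r)ᵐᵒᵖ N (BPermMod δ ⟨x.1, mu⟩) ↔
      IsSummand (HypAlg K (r - x.1))ᵐᵒᵖ Y (PermMod K mu) := by
  obtain ⟨t⟩ := nonempty_biTableau x.2
  rw [hN.isSummand_iff_detects hδ t, hY.isSummand_iff_detects t]
  exact detects_indBig_iff (Brauer.isCorner hδ x.1) hδ

theorem IsYoung.dominates {mu : BiPartition (r - x.1)}
    (h : IsSummand (Brauer K δ r)ᵐᵒᵖ N (BPermMod δ ⟨x.1, mu⟩)) : x.2.Dominates mu := by
  obtain ⟨Y, hY⟩ := exists_isYoungHyp K x.2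
  exact hY.dominates ((hN.isSummand_iff hδ hY).1 h)

theorem IsYoung.index_eq {y : Index r} {P : Submodule (Brauer K δ r)ᵐᵒᵖ (BPermMod δ y)}
    (hP : IsYoung δ y P) (e : N ≃ₗ[(Brauer K δ r)ᵐᵒᵖ] P) : x = y := by
  have hNy : IsSummand (Brauer K δ r)ᵐᵒᵖ N (BPermMod δ y) :=
    hP.2.1.elim fun Q hQ => ⟨P, Q, hQ, ⟨e⟩⟩
  have hPx : IsSummand (Brauer K δ r)ᵐᵒᵖ P (BPermMod δ x) :=
    hN.2.1.elim fun Q hQ => ⟨N, Q, hQ, ⟨e.symm⟩⟩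
  have hxy : x.1 = y.1 := le_antisymm (not_lt.1 fun h => hP.not_isSummand_of_lt hδ h hPx)
    (not_lt.1 fun h => hN.not_isSummand_of_lt hδ h hNy)
  obtain ⟨l, lam⟩ := x
  obtain ⟨m, mu⟩ := y
  obtain rfl : l = m := hxy
  exact congrArg _ ((hN.dominates hδ hNy).antisymm (hP.dominates hδ hPx))

end Young

end TypeC

end

theorem mainTheorem10 {K : Type*} [Field K] (δ : K) (hδ : δ ≠ 0) (r : ℕ) :
    -- the Young modules exist and are unique up to isomorphism
    (∀ x : TypeC.Index r,
      (∃ Y, TypeC.IsYoungHyp K x.2 Y) ∧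
      (∀ Y Y', TypeC.IsYoungHyp K x.2 Y → TypeC.IsYoungHyp K x.2 Y' →
        Nonempty (Y ≃ₗ[(TypeC.HypAlg K (r - x.1))ᵐᵒᵖ] Y')) ∧
      (∃ N, TypeC.IsYoung δ x N) ∧
      (∀ N N', TypeC.IsYoung δ x N → TypeC.IsYoung δ x N' →
        Nonempty (N ≃ₗ[(TypeC.Brauer K δ r)ᵐᵒᵖ] N'))) ∧
    -- 1
    (∀ (x : TypeC.Index r) (N), TypeC.IsYoung δ x N →
      TypeC.OccursOnce (TypeC.Brauer K δ r)ᵐᵒᵖ N (TypeC.BPermMod δ x)) ∧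
    -- 2
    (∀ (x y : TypeC.Index r) (N), TypeC.IsYoung δ x N → x.1 < y.1 →
      ¬ TypeC.IsSummand (TypeC.Brauer K δ r)ᵐᵒᵖ N (TypeC.BPermMod δ y)) ∧
    -- 3
    (∀ (l : Fin (r + 1)) (lam mu : TypeC.BiPartition (r - l)) (Y) (N),
      TypeC.IsYoungHyp K lam Y → TypeC.IsYoung δ ⟨l, lam⟩ N →
      (TypeC.IsSummand (TypeC.Brauer K δ r)ᵐᵒᵖ N (TypeC.BPermMod δ ⟨l, mu⟩) ↔
        TypeC.IsSummand (TypeC.HypAlg K (r - l))ᵐᵒᵖ Y (TypeC.PermMod K mu)) ∧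
      (TypeC.IsSummand (TypeC.HypAlg K (r - l))ᵐᵒᵖ Y (TypeC.PermMod K mu) →
        lam.Dominates mu)) ∧
    -- 4
    (∀ (x y : TypeC.Index r) (N) (P), TypeC.IsYoung δ x N → TypeC.IsYoung δ y P →
      Nonempty (N ≃ₗ[(TypeC.Brauer K δ r)ᵐᵒᵖ] P) → x = y) := by
  refine ⟨fun x => ⟨TypeC.exists_isYoungHyp K x.2, fun Y Y' hY => hY.nonempty_linearEquiv,
      TypeC.exists_isYoung hδ x, fun N N' hN => hN.nonempty_linearEquiv hδ⟩,
    fun x N hN => hN.occursOnce hδ,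
    fun x y N hN => hN.not_isSummand_of_lt hδ,
    fun l lam mu Y N hY hN => ⟨hN.isSummand_iff hδ hY, hY.dominates⟩,
    fun x y N P hN hP ⟨e⟩ => hN.index_eq hδ hP e⟩
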